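/- Let $d\ge 0$ and let $(\Omega,\mathcal F,\mathbb P)$ be a probability space. Write $X_{m,n}=X_n-X_m$. Consider a process $X=(X_n)_{n\ge0}$ in $\mathbb R^d$ of one of the following two kinds, together with a finite-state Markov chain $R=(R_n)_{n\ge 0}$ (arbitrary initial laws are allowed). (a) *Irreducible Markov chain on a periodic graph.* Let $\Lambda\subset\mathbb R^d$ be a lattice (discrete, spanning $\mathbb R^d$) acting on the vertex set $V$ of a (directed, loops allowed) graph $G$, with a position map $\mathrm{pos}:V\to\mathbb R^d$ such that $\mathrm{pos}(\gamma+x)=\gamma+\mathrm{pos}(x)$. The action preserves adjacency, $V/\Lambda$ is finite, and every vertex has finitely many neighbours. Let $Y$ be a Markov chain on $V$ whose transition matrix $P$ satisfies $P(\gamma+x,\gamma+y)=P(x,y)$ for $\gamma\in\Lambda$ and charges only edges of $G$, and suppose that the chain induced on $V/\Lambda$ is irreducible (for instance, that $Y$ is irreducible). Put $X_n=\mathrm{pos}(Y_n)$, and let $R_n$ be the class of $Y_n$ in $V/\Lambda$. (b) *Irreducible hidden Markov walk.* Let $R$ be an irreducible Markov chain on a finite set $S$. Conditionally on $R$, the increments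 $X_{n+1}-X_n$ are independent, with laws $\nu_{R_n,R_{n+1}}$ for some fixed probability measures $\nu_{r,r'}$ on $\mathbb R^d$ (for instance depending on $r$ only). The jumps are bounded: for some $K$, $\nu_{r,r'}$ is carried by $\{|x|\le K\}$ whenever the transition $r\to r'$ has positive probability. Fix any state $e$ of $R$, and let $\tau_0=0$, $\tau_{k+1}=\inf\{n>\tau_k: R_n=e\}$ (if $R_0=e$, these are the return times to the initial state). Then: 1. *Bounded jumps.* There is a constant $K'$ with $|X_{n+1}-X_n|\le K'$ for all $n$, almost surely. 2. *Regeneration structure.* The $\tau_k$ are measurable, and $0=\tau_0<\tau_1<\tau_2<\dots<\infty$ almost surely. The random variables $\big(\tau_k-\tau_{k-1},\{X_{\tau_{k-1},\tau_{k-1}+m}:0\le m\le\tau_k-\tau_{k-1}\}\big)$, $k\ge1$, are independent, and they are identically distributed for $k\ge2$. 3. *Law of large numbers.* $X_n/n\to v:=\mathbb E[X_{\tau_1,\tau_2}]/\mathbb E[\tau_2-\tau_1]$ almost surely. 4. *Invariance principle.* Let $\bar X_n=X_n-nv$ and $\bar X^{(N)}_t=N^{-1/2}\big(\bar X_{\lfloor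 Nt\rfloor}+(Nt-\lfloor Nt\rfloor)(\bar X_{\lfloor Nt\rfloor+1}-\bar X_{\lfloor Nt\rfloor})\big)$. For every $T>0$, $\bar X^{(N)}$ converges in distribution under $\mathbb P$, in $C([0,T],\mathbb R^d)$ with the uniform topology, to a Brownian motion started at $0$ with (possibly degenerate) covariance matrix $M=\mathbb E[\bar X_{\tau_1,\tau_2}\otimes\bar X_{\tau_1,\tau_2}]/\mathbb E[\tau_2-\tau_1]$. 5. *Geometric tails.* There are $C$ and $\rho\in[0,1)$ with $\mathbb P(\tau_{k+1}-\tau_k>n)\le C\rho^n$ for all $k,n\ge0$. In particular $\mathbb E[(\tau_{k+1}-\tau_k)^{2p}]<\infty$ for all $k\ge0$ and all $1\le p<\infty$. -/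

import Mathlib

open MeasureTheory ProbabilityTheory Filter Topology

noncomputable section

/-! ### Paths: linear interpolation, rescaling, Brownian motion -/

/-- The linear interpolation `u ↦ x_⌊u⌋ + (u - ⌊u⌋) (x_{⌊u⌋+1} - x_⌊u⌋)` of a sequence. -/
def linInterp {d : ℕ} (x : ℕ → EuclideanSpace ℝ (Fin d)) (u : ℝ) : EuclideanSpace ℝ (Fin d) :=
  x ⌊u⌋₊ + (u - (⌊u⌋₊ : ℝ)) • (x (⌊u⌋₊ + 1) - x ⌊u⌋₊)

theorem linInterp_eq {d : ℕ} (x : ℕ → EuclideanSpace ℝ (Fin d)) (n : ℕ) {u : ℝ}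
    (h : (n : ℝ) ≤ u) (h' : u ≤ n + 1) :
    linInterp x u = x n + (u - (n : ℝ)) • (x (n + 1) - x n) := by
  have h0 : (0 : ℝ) ≤ u := le_trans (Nat.cast_nonneg n) h
  rcases h'.lt_or_eq with h1 | h1
  · have : ⌊u⌋₊ = n := (Nat.floor_eq_iff h0).2 ⟨h, h1⟩
    simp [linInterp, this]
  · have : ⌊u⌋₊ = n + 1 := by rw [h1]; exact_mod_cast Nat.floor_natCast (R := ℝ) (n + 1)
    rw [linInterp, this, h1]
    simp

theorem continuous_linInterp {d : ℕ} (x : ℕ → EuclideanSpace ℝ (Fin d)) :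
    Continuous (linInterp x) := by
  have key : ∀ n : ℕ, ContinuousOn (linInterp x) (Set.Iic (n : ℝ)) := by
    intro n
    induction n with
    | zero =>
      have : ContinuousOn (fun u : ℝ => x 0 + u • (x 1 - x 0)) (Set.Iic ((0 : ℕ) : ℝ)) := by
        fun_prop
      refine this.congr fun u hu => ?_
      have h0 : ⌊u⌋₊ = 0 := Nat.floor_of_nonpos (by simpa using hu)
      simp [linInterp, h0]
    | succ n ih =>
      have h1 : ContinuousOn (linInterp x) (Set.Icc (n : ℝ) (n + 1)) := by
        have : ContinuousOn (fun u : ℝ => x n + (u - (n : ℝ)) • (x (n + 1) - x n))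
            (Set.Icc (n : ℝ) (n + 1)) := by fun_prop
        exact this.congr fun u hu => linInterp_eq x n hu.1 hu.2
      have h2 := ih.union_of_isClosed h1 isClosed_Iic isClosed_Icc
      rw [Set.Iic_union_Icc_eq_Iic (by linarith)] at h2
      simpa using h2
  refine continuous_iff_continuousAt.2 fun u => ?_
  obtain ⟨n, hn⟩ := exists_nat_gt u
  exact (key n).continuousAt (Iic_mem_nhds hn)

/-- The space `C([0,T], ℝ^d)` with the uniform topology. -/
abbrev PathSpace (d : ℕ) (T : ℝ) : Type := C(Set.Icc (0 : ℝ) T, EuclideanSpace ℝ (Fin d))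

instance pathSpaceMeasurableSpace (d : ℕ) (T : ℝ) : MeasurableSpace (PathSpace d T) := borel _

instance pathSpaceBorelSpace (d : ℕ) (T : ℝ) : BorelSpace (PathSpace d T) := ⟨rfl⟩

/-- The rescaled path `x^{(N)}_t = N^{-1/2} (x_⌊Nt⌋ + (Nt - ⌊Nt⌋)(x_{⌊Nt⌋+1} - x_⌊Nt⌋))`
on `[0,T]`. -/
def rescaledPath {d : ℕ} (T : ℝ) (N : ℕ) (x : ℕ → EuclideanSpace ℝ (Fin d)) : PathSpace d T where
  toFun t := (Real.sqrt N)⁻¹ • linInterp x (N * (t : ℝ))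
  continuous_toFun := by
    have := continuous_linInterp x
    fun_prop

/-- `W` is the law on `C([0,T], ℝ^d)` of a Brownian motion started at `0` with covariance
matrix `M` (possibly degenerate). -/
structure IsBrownianLaw {d : ℕ} (T : ℝ) (M : Matrix (Fin d) (Fin d) ℝ)
    (W : Measure (PathSpace d T)) : Prop where
  posSemidef : M.PosSemidef
  zero : ∀ t : Set.Icc (0 : ℝ) T, (t : ℝ) = 0 → ∀ᵐ w ∂W, w t = 0
  law_increment : ∀ s t : Set.Icc (0 : ℝ) T, s ≤ t →
    HasLaw (fun w : PathSpace d T => w t - w s)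
      (multivariateGaussian 0 (((t : ℝ) - (s : ℝ)) • M)) W
  indep_increments : HasIndepIncrements (fun t (w : PathSpace d T) => w t) W

/-- The process `Z` satisfies the (annealed) invariance principle with covariance matrix `M`:
for every `T > 0`, `Z^{(N)}` converges in distribution in `C([0,T], ℝ^d)` to a Brownian motion
with covariance matrix `M`. -/
def InvariancePrinciple {d : ℕ} {Ω : Type*} [MeasurableSpace Ω] (μ : Measure Ω)
    [IsProbabilityMeasure μ] (Z : ℕ → Ω → EuclideanSpace ℝ (Fin d))
    (M : Matrix (Fin d) (Fin d) ℝ) : Prop :=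
  ∀ T : ℝ, 0 < T → ∃ (W : Measure (PathSpace d T)) (_ : IsProbabilityMeasure W),
    IsBrownianLaw T M W ∧
    TendstoInDistribution (fun (N : ℕ) ω => rescaledPath T N (fun n => Z n ω)) atTop
      (fun w : PathSpace d T => w) (fun _ => μ) W

/-! ### Regeneration structures and the conditions of the rough invariance principle -/

/-- The length `τ_{k+1} - τ_k` of the `k`-th interval, `k = 0, 1, …`. -/
def blockLength {Ω : Type*} (τ : ℕ → Ω → ℕ) (k : ℕ) (ω : Ω) : ℕ := τ (k + 1) ω - τ k ω

/-- The pair `(τ_{k+1} - τ_k, {X_{τ_k + m} - X_{τ_k} : 0 ≤ m ≤ τ_{k+1} - τ_k})`. The finite path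
is recorded as the infinite sequence that stays constant after time `τ_{k+1} - τ_k`; together with
the length it carries the same information. -/
def block {d : ℕ} {Ω : Type*} (X : ℕ → Ω → EuclideanSpace ℝ (Fin d)) (τ : ℕ → Ω → ℕ)
    (k : ℕ) (ω : Ω) : ℕ × (ℕ → EuclideanSpace ℝ (Fin d)) :=
  (blockLength τ k ω, fun m => X (τ k ω + min m (blockLength τ k ω)) ω - X (τ k ω) ω)

/-- `τ` is a regeneration structure for `X`: `0 = τ_0 < τ_1 < …` almost surely, the blocks between
consecutive times are independent, and all but the first one have the same distribution. -/
structure IsRegenerationStructure {d : ℕ} {Ω : Type*} [MeasurableSpace Ω] (μ : Measure Ω)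
    (X : ℕ → Ω → EuclideanSpace ℝ (Fin d)) (τ : ℕ → Ω → ℕ) : Prop where
  measurable : ∀ k, Measurable (τ k)
  zero : ∀ᵐ ω ∂μ, τ 0 ω = 0
  strictMono : ∀ᵐ ω ∂μ, StrictMono fun k => τ k ω
  indep : iIndepFun (fun k => block X τ k) μ
  identDistrib : ∀ k, 1 ≤ k → IdentDistrib (block X τ k) (block X τ 1) μ μ

/-- The speed `v = E[X_{τ_2} - X_{τ_1}] / E[τ_2 - τ_1]`. -/
def speed {d : ℕ} {Ω : Type*} [MeasurableSpace Ω] (μ : Measure Ω)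
    (X : ℕ → Ω → EuclideanSpace ℝ (Fin d)) (τ : ℕ → Ω → ℕ) : EuclideanSpace ℝ (Fin d) :=
  (∫ ω, (blockLength τ 1 ω : ℝ) ∂μ)⁻¹ • ∫ ω, (X (τ 2 ω) ω - X (τ 1 ω) ω) ∂μ

/-- The centered process `X_n - n v`. -/
def centered {d : ℕ} {Ω : Type*} (X : ℕ → Ω → EuclideanSpace ℝ (Fin d))
    (v : EuclideanSpace ℝ (Fin d)) (n : ℕ) (ω : Ω) : EuclideanSpace ℝ (Fin d) :=
  X n ω - (n : ℝ) • v

/-- The matrix `E[Z_{τ_1,τ_2} ⊗ Z_{τ_1,τ_2}] / E[τ_2 - τ_1]`, `Z_{τ_1,τ_2} = Z_{τ_2} - Z_{τ_1}`. -/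
def blockCovariance {d : ℕ} {Ω : Type*} [MeasurableSpace Ω] (μ : Measure Ω)
    (Z : ℕ → Ω → EuclideanSpace ℝ (Fin d)) (τ : ℕ → Ω → ℕ) : Matrix (Fin d) (Fin d) ℝ :=
  Matrix.of fun i j =>
    (∫ ω, (Z (τ 2 ω) ω - Z (τ 1 ω) ω) i * (Z (τ 2 ω) ω - Z (τ 1 ω) ω) j ∂μ) /
      ∫ ω, (blockLength τ 1 ω : ℝ) ∂μ

/-- `E[(τ_{k+1} - τ_k)^q] < ∞` for all `k ≥ 0`. -/
def HasBlockMoments {Ω : Type*} [MeasurableSpace Ω] (μ : Measure Ω) (τ : ℕ → Ω → ℕ)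
    (q : ℝ) : Prop :=
  ∀ k, Integrable (fun ω => (blockLength τ k ω : ℝ) ^ q) μ

/-- The lengths `τ_{k+1} - τ_k` have geometric tails, uniformly in `k ≥ 0`. -/
def HasGeometricTails {Ω : Type*} [MeasurableSpace Ω] (μ : Measure Ω) (τ : ℕ → Ω → ℕ) : Prop :=
  ∃ C ρ : ℝ, 0 ≤ ρ ∧ ρ < 1 ∧ ∀ k n : ℕ, μ.real {ω | n < blockLength τ k ω} ≤ C * ρ ^ n

/-- The conditions, on a process `X` with regeneration times `τ`, of the invariance principle in
rough path topology: bounded jumps, regeneration structure, strong law of large numbers with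
speed `v`, annealed invariance principle for `X_n - n v` with the covariance matrix of a
regeneration interval, and a moment of order `2p`, `p ≥ 4`, of the regeneration intervals. -/
structure RoughInvarianceConditions {d : ℕ} {Ω : Type*} [MeasurableSpace Ω] (μ : Measure Ω)
    [IsProbabilityMeasure μ] (X : ℕ → Ω → EuclideanSpace ℝ (Fin d)) (τ : ℕ → Ω → ℕ) : Prop where
  measurable : ∀ n, Measurable (X n)
  bounded_jumps : ∃ K : ℝ, ∀ᵐ ω ∂μ, ∀ n, ‖X (n + 1) ω - X n ω‖ ≤ K
  regeneration : IsRegenerationStructure μ X τ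
  law_of_large_numbers :
    ∀ᵐ ω ∂μ, Tendsto (fun n : ℕ => (n : ℝ)⁻¹ • X n ω) atTop (𝓝 (speed μ X τ))
  invariance_principle :
    InvariancePrinciple μ (centered X (speed μ X τ))
      (blockCovariance μ (centered X (speed μ X τ)) τ)
  moments : ∃ p : ℝ, 4 ≤ p ∧ HasBlockMoments μ τ (2 * p)

/-! ### Markov chains, hidden Markov walks -/

/-- `P` is a transition matrix on `S`. -/
structure IsTransitionMatrix {S : Type*} (P : S → S → ℝ) : Prop where
  nonneg : ∀ x y, 0 ≤ P x y
  hasSum_one : ∀ x, HasSum (P x) 1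

/-- From every state every state can be reached with positive probability. -/
def IsIrreducibleChain {S : Type*} (P : S → S → ℝ) : Prop :=
  ∀ x y, Relation.ReflTransGen (fun a b => 0 < P a b) x y

/-- `Y` is a Markov chain with transition matrix `P` on the discrete countable state space `S`,
with an arbitrary initial distribution. -/
structure IsMarkovChain {S Ω : Type*} [MeasurableSpace Ω] (μ : Measure Ω) (P : S → S → ℝ)
    (Y : ℕ → Ω → S) : Prop where
  measurable : ∀ n s, MeasurableSet {ω | Y n ω = s}
  law : ∀ (n : ℕ) (s : ℕ → S),
    μ.real {ω | ∀ i ≤ n, Y i ω = s i} =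
      μ.real {ω | Y 0 ω = s 0} * ∏ i ∈ Finset.range n, P (s i) (s (i + 1))

/-- `X` is a hidden Markov walk driven by `R`: `R` is a Markov chain with transition matrix `P`
and, conditionally on `R`, the increments `X_{i+1} - X_i` are independent with laws
`ν (R_i) (R_{i+1})`. The case of increments whose law depends on `R_i` alone, or on `R_{i+1}`
alone, is that of a `ν` which depends on one of its two arguments only. -/
structure IsHiddenMarkovWalk {d : ℕ} {S Ω : Type*} [MeasurableSpace Ω] (μ : Measure Ω)
    (P : S → S → ℝ) (ν : S → S → Measure (EuclideanSpace ℝ (Fin d)))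
    (R : ℕ → Ω → S) (X : ℕ → Ω → EuclideanSpace ℝ (Fin d)) : Prop where
  hidden_chain : IsMarkovChain μ P R
  measurable : ∀ n, Measurable (X n)
  law_increments : ∀ (n : ℕ) (r : ℕ → S) (A : ℕ → Set (EuclideanSpace ℝ (Fin d))),
    (∀ i, MeasurableSet (A i)) →
    μ.real {ω | (∀ i ≤ n, R i ω = r i) ∧ ∀ i < n, X (i + 1) ω - X i ω ∈ A i} =
      μ.real {ω | ∀ i ≤ n, R i ω = r i} *
        ∏ i ∈ Finset.range n, (ν (r i) (r (i + 1))).real (A i)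

/-- The successive visit times `T_0 = 0`, `T_{n+1} = inf {k > T_n : R_k = e}` of the state `e`.
If the chain starts in `e` these are its return times to the initial state. -/
def visitTime {S Ω : Type*} (R : ℕ → Ω → S) (e : S) : ℕ → Ω → ℕ
  | 0, _ => 0
  | n + 1, ω => sInf {k | visitTime R e n ω < k ∧ R k ω = e}

/-! ### Periodic graphs -/

/-- A graph (directed, loops allowed) with vertices realized in `ℝ^d` by `pos`, periodic with
respect to the lattice `Λ`: translation by `Λ` preserves adjacency, there are finitely many
vertices modulo `Λ`, and every vertex has finitely many neighbours. The realization need not be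
injective. -/
structure PeriodicGraph {d : ℕ} (Λ : Submodule ℤ (EuclideanSpace ℝ (Fin d))) (V : Type*)
    [AddAction Λ V] extends Digraph V where
  pos : V → EuclideanSpace ℝ (Fin d)
  pos_vadd : ∀ (γ : Λ) x, pos (γ +ᵥ x) = (γ : EuclideanSpace ℝ (Fin d)) + pos x
  adj_vadd : ∀ (γ : Λ) x y, Adj (γ +ᵥ x) (γ +ᵥ y) ↔ Adj x y
  finite_quotient : Finite (AddAction.orbitRel.Quotient Λ V)
  locally_finite : ∀ x, {y | Adj x y}.Finite

/-- `P` is the transition matrix of a Markov chain on the periodic graph `G`: jumps are along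
edges, and `P` is invariant under the lattice. -/
structure PeriodicGraph.IsTransition {d : ℕ} {Λ : Submodule ℤ (EuclideanSpace ℝ (Fin d))}
    {V : Type*} [AddAction Λ V] (G : PeriodicGraph Λ V) (P : V → V → ℝ) : Prop where
  isTransitionMatrix : IsTransitionMatrix P
  adj_of_pos : ∀ x y, 0 < P x y → G.Adj x y
  vadd : ∀ (γ : Λ) x y, P (γ +ᵥ x) (γ +ᵥ y) = P x y

/-- Irreducibility of the chain that a `Λ`-invariant transition matrix induces on the vertices
modulo `Λ`. It follows from irreducibility on the vertices themselves. -/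
def IsIrreducibleMod {d : ℕ} (Λ : Submodule ℤ (EuclideanSpace ℝ (Fin d))) {V : Type*}
    [AddAction Λ V] (P : V → V → ℝ) : Prop :=
  ∀ x y, ∃ γ : Λ, Relation.ReflTransGen (fun a b => 0 < P a b) x (γ +ᵥ y)

theorem IsIrreducibleChain.isIrreducibleMod {d : ℕ} {Λ : Submodule ℤ (EuclideanSpace ℝ (Fin d))}
    {V : Type*} [AddAction Λ V] {P : V → V → ℝ} (h : IsIrreducibleChain P) :
    IsIrreducibleMod Λ P := fun x y => ⟨0, h x _⟩

/-- The class of a vertex modulo the lattice. -/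
def latticeClass {d : ℕ} (Λ : Submodule ℤ (EuclideanSpace ℝ (Fin d))) {V : Type*}
    [AddAction Λ V] (x : V) : AddAction.orbitRel.Quotient Λ V :=
  Quotient.mk _ x

end

/-! ### Measures on path space -/

/-! Both kinds of process are hidden Markov walks over a finite irreducible chain. For a chain on a
periodic graph this is `PeriodicGraph.IsTransition.isHiddenMarkovWalk`: by invariance under the
lattice, the joint law of the next class and of the displacement depends on the present vertex only
through its class. The jumps are bounded because there are finitely many classes, with finitely many
neighbours for each representative.

For a hidden Markov walk, the Markov property `IsHiddenMarkovWalk.measure_inter_step` shows that,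
given the past, the excursion up to the next visit to `e` has a law that depends on the present
state only (`IsHiddenMarkovWalk.exists_measure_inter_excursion`). At a visit this state is always
`e`, so the blocks between visits are independent, and from the second one on they have the same
law. By finiteness and irreducibility there are `m` and `θ < 1` such that, whatever the past, `e` is
avoided for `m` steps with probability at most `θ`; iterating this gives geometric tails.

From there on only three facts matter: regeneration, geometric tails and bounded jumps
(`IsRegenerationStructure.roughInvarianceConditions`). The increments of `X_n - n v` over the blocks
after the first are i.i.d., centered by the choice of `v`, and have fourth moments because a block
increment is at most a constant times the block length. The strong law for lengths and displacements
of blocks gives that of `X_n / n`, by inverting the renewal times and using bounded jumps.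

For the invariance principle, characteristic functions of i.i.d. sums give the finite-dimensional
limits, and a maximal inequality with fourth moments gives the modulus of continuity. Both pass to
`X`, since blocks up to time `N T` are `o(√N)` in probability and the number of renewals up to time
`N t` is close to `N t / E[τ_2 - τ_1]`. The modulus gives tightness by Arzelà–Ascoli, and every
limit point is a Brownian law with the right covariance. As this law is unique, the whole sequence
converges; its existence comes out of the same compactness argument. -/

section PathSpace

variable {d : ℕ} {T : ℝ}

/-- Evaluation along a dense sequence of times embeds path space measurably in a countable
product. -/
theorem measurableEmbedding_eval_denseSeq (hT : 0 ≤ T) :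
    MeasurableEmbedding (fun (w : PathSpace d T) (n : ℕ) =>
      haveI : Nonempty (Set.Icc (0 : ℝ) T) := ⟨⟨0, le_rfl, hT⟩⟩
      w (TopologicalSpace.denseSeq (Set.Icc (0 : ℝ) T) n)) := by
  have : Nonempty (Set.Icc (0 : ℝ) T) := ⟨⟨0, le_rfl, hT⟩⟩
  -- Lusin–Souslin: a continuous injection of a Polish space is a measurable embedding. Injectivity
  -- is continuity of paths and density of the times.
  refine Continuous.measurableEmbedding (by fun_prop) fun w w' h => ?_
  ext1 t
  have := (TopologicalSpace.denseRange_denseSeq (Set.Icc (0 : ℝ) T)).equalizer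
    w.continuous w'.continuous (funext fun n => congrFun h n)
  exact congrFun this t

theorem measurable_pathSpace_of_eval {Ω : Type*} [MeasurableSpace Ω] (hT : 0 ≤ T)
    {Z : Ω → PathSpace d T} (h : ∀ t, Measurable fun ω => Z ω t) : Measurable Z := by
  rw [← (measurableEmbedding_eval_denseSeq (d := d) hT).measurable_comp_iff]
  exact measurable_pi_lambda _ fun n => h _

/-- A finite measure on path space is determined by its finite-dimensional marginals. -/
theorem PathSpace.measure_ext (hT : 0 ≤ T) {W W' : Measure (PathSpace d T)}
    [IsFiniteMeasure W] (h : ∀ I : Finset (Set.Icc (0 : ℝ) T),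
      W.map (fun w => I.restrict (fun t => w t)) = W'.map (fun w => I.restrict (fun t => w t))) :
    W = W' := by
  classical
  have : Nonempty (Set.Icc (0 : ℝ) T) := ⟨⟨0, le_rfl, hT⟩⟩
  have he := measurableEmbedding_eval_denseSeq (d := d) hT
  set q := TopologicalSpace.denseSeq (Set.Icc (0 : ℝ) T) with hq
  set φ := fun (w : PathSpace d T) (n : ℕ) => w (q n) with hφ
  have hmeas : ∀ I : Finset (Set.Icc (0 : ℝ) T),
      Measurable (fun w : PathSpace d T => I.restrict (fun t => w t)) := fun I => by
    refine measurable_pi_lambda _ fun t => Continuous.measurable ?_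
    fun_prop
  have hfin : ∀ J : Finset ℕ,
      (W.map φ).map J.restrict = (W'.map φ).map J.restrict := by
    intro J
    let g : (J.image q → EuclideanSpace ℝ (Fin d)) → (J → EuclideanSpace ℝ (Fin d)) :=
      fun x n => x ⟨q n, Finset.mem_image_of_mem q n.2⟩
    have hg : Measurable g := measurable_pi_lambda _ fun n => measurable_pi_apply _
    rw [Measure.map_map (Finset.measurable_restrict J) he.measurable,
      Measure.map_map (Finset.measurable_restrict J) he.measurable]
    have : J.restrict ∘ φ = g ∘ fun w : PathSpace d T => (J.image q).restrict (fun t => w t) := rfl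
    rw [this, ← Measure.map_map hg (hmeas _), ← Measure.map_map hg (hmeas _), h]
  have hmap : W.map φ = W'.map φ := by
    have h1 : IsProjectiveLimit (W.map φ) (fun J : Finset ℕ => (W.map φ).map J.restrict) :=
      fun J => rfl
    have h2 : IsProjectiveLimit (W'.map φ) (fun J : Finset ℕ => (W.map φ).map J.restrict) :=
      fun J => (hfin J).symm
    exact h1.unique h2
  rw [← he.comap_map W, ← he.comap_map W', hmap]

theorem measurable_pathSpace_eval (t : Set.Icc (0 : ℝ) T) :
    Measurable fun w : PathSpace d T => w t :=
  Continuous.measurable (by fun_prop)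

/-- The law of a Brownian motion is determined by its covariance matrix. -/
theorem IsBrownianLaw.unique (hT : 0 ≤ T) {M : Matrix (Fin d) (Fin d) ℝ}
    {W W' : Measure (PathSpace d T)} [IsProbabilityMeasure W] [IsProbabilityMeasure W']
    (h : IsBrownianLaw T M W) (h' : IsBrownianLaw T M W') : W = W' := by
  classical
  refine PathSpace.measure_ext hT fun I => ?_
  let z : Set.Icc (0 : ℝ) T := ⟨0, le_rfl, hT⟩
  -- With time `0` put in front, the values at the times of `I` are almost surely partial sums of
  -- the increments along `t`, since the path starts at `0`; `g` forms these sums.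
  let t : Fin (I.card + 1) → Set.Icc (0 : ℝ) T := Fin.cons z (I.orderEmbOfFin rfl)
  have ht : Monotone t := by
    rw [Fin.monotone_iff_le_succ]
    intro i
    rcases i with ⟨_ | i, hi⟩
    · exact (t _).2.1
    · exact (I.orderEmbOfFin rfl).monotone (by simp [Fin.le_def])
  let D : PathSpace d T → Fin I.card → EuclideanSpace ℝ (Fin d) :=
    fun w i => w (t i.succ) - w (t i.castSucc)
  have hDi : ∀ i, Measurable fun w => D w i := fun i =>
    (measurable_pathSpace_eval _).sub (measurable_pathSpace_eval _)
  have hD : Measurable D := measurable_pi_lambda _ hDi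
  let g : (Fin I.card → EuclideanSpace ℝ (Fin d)) → (I → EuclideanSpace ℝ (Fin d)) :=
    fun x i => ∑ j ∈ Finset.Iic ((I.orderIsoOfFin rfl).symm i), x j
  have hg : Measurable g := by
    refine measurable_pi_lambda _ fun i => ?_
    exact Finset.measurable_fun_sum _ fun j _ => measurable_pi_apply j
  have key : ∀ {U : Measure (PathSpace d T)} [IsProbabilityMeasure U], IsBrownianLaw T M U →
      U.map (fun w => I.restrict (fun t => w t)) =
        (Measure.pi fun i : Fin I.card => multivariateGaussian 0
          (((t i.succ : ℝ) - (t i.castSucc : ℝ)) • M)).map g := by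
    intro U _ hU
    have hlaw : ∀ i : Fin I.card, U.map (fun w => D w i) = multivariateGaussian 0
          (((t i.succ : ℝ) - (t i.castSucc : ℝ)) • M) := fun i =>
      (hU.law_increment _ _ (ht (Fin.castSucc_le_succ i))).map_eq
    have hind := (iIndepFun_iff_map_fun_eq_pi_map (μ := U) (fun i => (hDi i).aemeasurable)).1
      (hU.indep_increments _ t ht)
    simp only [hlaw] at hind
    rw [← hind, Measure.map_map hg hD]
    refine Measure.map_congr ?_
    filter_upwards [hU.zero z rfl] with w hw
    ext1 i
    simp only [Function.comp_apply, g, D]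
    rw [Fin.sum_Iic_sub _ (fun j => w (t j))]
    simp [t, hw, Finset.orderEmbOfFin]
  rw [key h, key h']

/-- The paths started at `0` with modulus of continuity at most `ε j` at scale `δ j`, for
all `j`, form a compact set. -/
theorem isCompact_setOf_modulus (hT : 0 ≤ T) {δ ε : ℕ → ℝ} (hδ : ∀ j, 0 < δ j)
    (hε : Tendsto ε atTop (𝓝 0)) :
    IsCompact {w : PathSpace d T | w ⟨0, le_rfl, hT⟩ = 0 ∧
      ∀ j s t, dist s t ≤ δ j → dist (w s) (w t) ≤ ε j} := by
  set z : Set.Icc (0 : ℝ) T := ⟨0, le_rfl, hT⟩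
  have hequi : ∀ (f : {f : Set.Icc (0 : ℝ) T → EuclideanSpace ℝ (Fin d) | f z = 0 ∧
      ∀ j s t, dist s t ≤ δ j → dist (f s) (f t) ≤ ε j} → Set.Icc (0 : ℝ) T →
        EuclideanSpace ℝ (Fin d)), (∀ g, f g = g.1) → Equicontinuous f := by
    intro f hf t
    rw [Metric.equicontinuousAt_iff]
    intro r hr
    obtain ⟨j, hj⟩ := (hε.eventually_lt_const hr).exists
    refine ⟨δ j, hδ j, fun s hs g => ?_⟩
    rw [hf]
    exact (g.2.2 j t s (by rw [dist_comm]; exact hs.le)).trans_lt hj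
  have hbound : ∃ B : ℝ, ∀ (f : Set.Icc (0 : ℝ) T → EuclideanSpace ℝ (Fin d)), f z = 0 →
      (∀ j s t, dist s t ≤ δ j → dist (f s) (f t) ≤ ε j) → ∀ t, ‖f t‖ ≤ B := by
    -- Any `t` is reached from `0` in `m` steps of length at most `δ 0`, each of which changes `f`
    -- by at most `ε 0`.
    obtain ⟨m, hm⟩ := exists_nat_gt (T / δ 0)
    refine ⟨m * ε 0, fun f hf0 hf t => ?_⟩
    have hm0 : (0 : ℝ) < m := lt_of_le_of_lt (div_nonneg hT (hδ 0).le) hm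
    let p : ℕ → Set.Icc (0 : ℝ) T := fun i => Set.projIcc 0 T hT (i * (t / m))
    have step : ∀ i : ℕ, ‖f (p i)‖ ≤ i * ε 0 := by
      intro i
      induction i with
      | zero =>
        have : p 0 = z := by simp [p, z, Set.projIcc_of_le_left]
        simp [this, hf0]
      | succ i ih =>
        have hd : dist (p (i + 1)) (p i) ≤ δ 0 := by
          refine (Set.abs_projIcc_sub_projIcc hT).trans ?_
          have : ((i + 1 : ℕ) : ℝ) * (t / m) - i * (t / m) = t / m := by push_cast; ring
          rw [this, abs_of_nonneg (div_nonneg t.2.1 hm0.le), div_le_iff₀ hm0]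
          rw [div_lt_iff₀ (hδ 0)] at hm
          linarith [t.2.2]
        have := hf 0 _ _ hd
        rw [dist_eq_norm] at this
        push_cast
        linarith [norm_le_norm_add_norm_sub' (f (p (i + 1))) (f (p i))]
    have hpm : p m = t := by
      have : (m : ℝ) * (t / m) = t := by field_simp
      simp [p, this]
    simpa [hpm] using step m
  obtain ⟨B, hB⟩ := hbound
  -- The modulus condition forces continuity, so the image in the product topology is described by
  -- pointwise conditions alone and is closed there.
  have himage : ContinuousMap.toFun '' {w : PathSpace d T | w z = 0 ∧
      ∀ j s t, dist s t ≤ δ j → dist (w s) (w t) ≤ ε j} =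
      {f : Set.Icc (0 : ℝ) T → EuclideanSpace ℝ (Fin d) | f z = 0 ∧
        ∀ j s t, dist s t ≤ δ j → dist (f s) (f t) ≤ ε j} := by
    ext f
    constructor
    · rintro ⟨w, hw, rfl⟩
      exact hw
    · intro hf
      exact ⟨⟨f, (hequi (fun g => g.1) fun _ => rfl).continuous ⟨f, hf⟩⟩, hf, rfl⟩
  refine ArzelaAscoli.isCompact_of_equicontinuous _ ?_ ?_
  · rw [himage]
    refine (isCompact_univ_pi fun _ : Set.Icc (0 : ℝ) T =>
      isCompact_closedBall (0 : EuclideanSpace ℝ (Fin d)) B).of_isClosed_subset ?_ ?_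
    · have : {f : Set.Icc (0 : ℝ) T → EuclideanSpace ℝ (Fin d) | f z = 0 ∧
        ∀ j s t, dist s t ≤ δ j → dist (f s) (f t) ≤ ε j} =
        {f | f z = 0} ∩ ⋂ (j) (s) (t) (_ : dist s t ≤ δ j), {f | dist (f s) (f t) ≤ ε j} := by
        ext f; simp only [Set.mem_ofPred_eq, Set.mem_inter_iff, Set.mem_iInter]
      rw [this]
      refine (isClosed_eq (continuous_apply _) continuous_const).inter ?_
      refine isClosed_iInter fun j => isClosed_iInter fun s => isClosed_iInter fun t =>
        isClosed_iInter fun _ => ?_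
      exact isClosed_le ((continuous_apply s).dist (continuous_apply t)) continuous_const
    · intro f hf t _
      simpa using hB f hf.1 hf.2 t
  · intro t
    rw [Metric.equicontinuousAt_iff]
    intro r hr
    obtain ⟨j, hj⟩ := (hε.eventually_lt_const hr).exists
    refine ⟨δ j, hδ j, fun s hs g => ?_⟩
    exact (g.2.2 j t s (by rw [dist_comm]; exact hs.le)).trans_lt hj

end PathSpace

/-! ### Tightness and convergence in distribution to Brownian motion -/

section PathConvergence

variable {d : ℕ} {T : ℝ}

/-- The strict inequality on the values makes this a union of open sets, so the event is measurable
with no supremum over uncountably many times. -/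
theorem isOpen_setOf_modulus_gt (δ ε : ℝ) :
    IsOpen {w : PathSpace d T | ∃ s t, dist s t ≤ δ ∧ ε < dist (w s) (w t)} := by
  have : {w : PathSpace d T | ∃ s t, dist s t ≤ δ ∧ ε < dist (w s) (w t)} =
      ⋃ (s) (t) (_ : dist s t ≤ δ), {w : PathSpace d T | ε < dist (w s) (w t)} := by
    ext w; simp only [Set.mem_ofPred_eq, Set.mem_iUnion, exists_prop]
  rw [this]
  refine isOpen_iUnion fun s => isOpen_iUnion fun t => isOpen_iUnion fun _ => ?_
  exact isOpen_lt continuous_const (by fun_prop)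

/-- The modulus of continuity of a random path is small in probability at small scales. -/
theorem exists_measure_modulus_gt_le (W : Measure (PathSpace d T)) [IsFiniteMeasure W]
    {ε : ℝ} (hε : 0 < ε) {η : ENNReal} (hη : 0 < η) :
    ∃ δ > 0, W {w | ∃ s t, dist s t ≤ δ ∧ ε < dist (w s) (w t)} ≤ η := by
  let B : ℕ → Set (PathSpace d T) := fun n =>
    {w | ∃ s t, dist s t ≤ 1 / ((n : ℝ) + 1) ∧ ε < dist (w s) (w t)}
  have hB : Tendsto (W ∘ B) atTop (𝓝 (W (⋂ n, B n))) := by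
    refine tendsto_measure_iInter_atTop
      (fun n => (isOpen_setOf_modulus_gt _ _).measurableSet.nullMeasurableSet) ?_
      ⟨0, measure_ne_top _ _⟩
    rintro m n hmn w ⟨s, t, h, h'⟩
    exact ⟨s, t, h.trans (one_div_le_one_div_of_le (by positivity) (by gcongr)), h'⟩
  have hempty : ⋂ n, B n = ∅ := by
    refine Set.eq_empty_of_forall_notMem fun w hw => ?_
    obtain ⟨δ, hδ, h⟩ := Metric.uniformContinuous_iff.1
      (CompactSpace.uniformContinuous_of_continuous w.continuous) ε hε
    obtain ⟨n, hn⟩ := exists_nat_one_div_lt hδ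
    obtain ⟨s, t, hst, hw'⟩ := Set.mem_iInter.1 hw n
    exact lt_asymm hw' (h (hst.trans_lt hn))
  rw [hempty, measure_empty] at hB
  obtain ⟨n, hn⟩ := (hB.eventually_le_const hη).exists
  exact ⟨1 / ((n : ℝ) + 1), by positivity, hn⟩

/-- The finitely many `N` not covered by the hypothesis are absorbed by shrinking `δ`, each single
law having a small modulus. Imposing modulus `1 / (j + 1)` at scale `δ j` for all `j`, with
exceptional probabilities that sum to less than `η`, leaves a compact set of paths. -/
theorem isTightMeasureSet_of_modulus (hT : 0 ≤ T) (W : ℕ → Measure (PathSpace d T))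
    [∀ N, IsProbabilityMeasure (W N)] (h0 : ∀ N, ∀ᵐ w ∂W N, w ⟨0, le_rfl, hT⟩ = 0)
    (hmod : ∀ ε > 0, ∀ η > 0, ∃ δ > 0, ∀ᶠ N in atTop,
      W N {w | ∃ s t, dist s t ≤ δ ∧ ε < dist (w s) (w t)} ≤ η) :
    IsTightMeasureSet (Set.range W) := by
  have hall : ∀ ε > 0, ∀ η > 0, ∃ δ > 0, ∀ N,
      W N {w | ∃ s t, dist s t ≤ δ ∧ ε < dist (w s) (w t)} ≤ η := by
    intro ε hε η hη
    obtain ⟨δ, hδ, h⟩ := hmod ε hε η hη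
    obtain ⟨N₀, hN₀⟩ := eventually_atTop.1 h
    choose δ' hδ' h' using fun N => exists_measure_modulus_gt_le (W N) hε hη
    have hpos : 0 < ((Finset.range (N₀ + 1)).inf' Finset.nonempty_range_add_one δ') :=
      (Finset.lt_inf'_iff _).2 fun N _ => hδ' N
    refine ⟨min δ ((Finset.range (N₀ + 1)).inf' Finset.nonempty_range_add_one δ'),
      lt_min hδ hpos, fun N => ?_⟩
    rcases le_or_gt N₀ N with hN | hN
    · refine (measure_mono ?_).trans (hN₀ N hN)
      rintro w ⟨s, t, hst, hw⟩
      exact ⟨s, t, hst.trans (min_le_left _ _), hw⟩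
    · refine (measure_mono ?_).trans (h' N)
      rintro w ⟨s, t, hst, hw⟩
      exact ⟨s, t, hst.trans ((min_le_right _ _).trans
        (Finset.inf'_le _ (Finset.mem_range.2 (by omega)))), hw⟩
  rw [isTightMeasureSet_iff_exists_isCompact_measure_compl_le]
  intro η hη
  obtain ⟨η', hη', hsum⟩ := ENNReal.exists_pos_sum_of_countable hη.ne' ℕ
  choose δ hδ h using fun j : ℕ => hall (1 / ((j : ℝ) + 1)) (by positivity) (η' j)
    (by exact_mod_cast hη' j)
  refine ⟨_, isCompact_setOf_modulus hT (δ := δ) (ε := fun j => 1 / ((j : ℝ) + 1)) hδ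
    tendsto_one_div_add_atTop_nhds_zero_nat, ?_⟩
  rintro _ ⟨N, rfl⟩
  calc _ ≤ W N ({w | w ⟨0, le_rfl, hT⟩ ≠ 0} ∪
        ⋃ j, {w | ∃ s t, dist s t ≤ δ j ∧ 1 / ((j : ℝ) + 1) < dist (w s) (w t)}) := by
        refine measure_mono fun w hw => ?_
        by_contra hcon
        simp only [Set.mem_union, Set.mem_iUnion, Set.mem_ofPred_eq, not_or, not_exists, not_and,
          not_lt, not_not] at hcon
        exact hw ⟨by simpa using hcon.1, hcon.2⟩
    _ ≤ W N {w | w ⟨0, le_rfl, hT⟩ ≠ 0} +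
        ∑' j, W N {w | ∃ s t, dist s t ≤ δ j ∧ 1 / ((j : ℝ) + 1) < dist (w s) (w t)} :=
      (measure_union_le _ _).trans (by gcongr; exact measure_iUnion_le _)
    _ ≤ 0 + ∑' j, (η' j : ENNReal) := by
      gcongr with j
      · exact (ae_iff.1 (h0 N)).le
      · exact h j N
    _ ≤ η := by rw [zero_add]; exact hsum.le

/-- A probability measure on path space whose increments have the characteristic functions of
independent Gaussian vectors is a Brownian law. -/
theorem isBrownianLaw_of_charFun (hT : 0 ≤ T) {M : Matrix (Fin d) (Fin d) ℝ} (hM : M.PosSemidef)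
    (W : Measure (PathSpace d T)) [IsProbabilityMeasure W]
    (h0 : ∀ᵐ w ∂W, w ⟨0, le_rfl, hT⟩ = 0)
    (hfdd : ∀ (n : ℕ) (t : Fin (n + 1) → Set.Icc (0 : ℝ) T), Monotone t →
      ∀ u : Fin n → EuclideanSpace ℝ (Fin d),
      ∫ w, Complex.exp ((∑ i, inner ℝ (w (t i.succ) - w (t i.castSucc)) (u i) : ℝ) * Complex.I) ∂W =
        ∏ i, Complex.exp (-(((t i.succ : ℝ) - (t i.castSucc : ℝ)) *
          ((u i).ofLp ⬝ᵥ M.mulVec (u i).ofLp) / 2 : ℝ))) :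
    IsBrownianLaw T M W := by
  have hpos : ∀ s t : Set.Icc (0 : ℝ) T, s ≤ t → (((t : ℝ) - (s : ℝ)) • M).PosSemidef :=
    fun s t hst => hM.smul (sub_nonneg.2 hst)
  have hmeas : ∀ s t : Set.Icc (0 : ℝ) T, Measurable fun w : PathSpace d T => w t - w s :=
    fun s t => (measurable_pathSpace_eval _).sub (measurable_pathSpace_eval _)
  have hgauss : ∀ (s t : Set.Icc (0 : ℝ) T) (_ : s ≤ t) (u : EuclideanSpace ℝ (Fin d)),
      charFun (multivariateGaussian 0 (((t : ℝ) - (s : ℝ)) • M)) u =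
        Complex.exp (-(((t : ℝ) - (s : ℝ)) * (u.ofLp ⬝ᵥ M.mulVec u.ofLp) / 2 : ℝ)) := by
    intro s t hst u
    rw [charFun_multivariateGaussian (hpos s t hst)]
    congr 1
    simp [Matrix.smul_mulVec]
  have hlaw : ∀ s t : Set.Icc (0 : ℝ) T, s ≤ t → W.map (fun w : PathSpace d T => w t - w s) =
      multivariateGaussian 0 (((t : ℝ) - (s : ℝ)) • M) := by
    intro s t hst
    have : IsProbabilityMeasure (W.map (fun w : PathSpace d T => w t - w s)) :=
      Measure.isProbabilityMeasure_map (hmeas s t).aemeasurable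
    refine Measure.ext_of_charFun (funext fun u => ?_)
    rw [hgauss s t hst, charFun_apply, integral_map (hmeas s t).aemeasurable
      (by fun_prop)]
    -- A single increment, `n = 1`, gives the marginal laws; for general `n` the hypothesis then
    -- says that the joint characteristic function factorizes.
    have := hfdd 1 ![s, t] (by
      rw [Fin.monotone_iff_le_succ]; intro i; fin_cases i; simpa using hst) (fun _ => u)
    simpa using this
  refine ⟨hM, fun t ht => ?_, fun s t hst => ⟨(hmeas s t).aemeasurable, hlaw s t hst⟩, ?_⟩
  · have : t = ⟨0, le_rfl, hT⟩ := Subtype.ext ht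
    rw [this]; exact h0
  · intro n t ht
    rw [iIndepFun_iff_charFun_pi (fun i => (hmeas _ _).aemeasurable)]
    intro u
    rw [charFun_apply, integral_map (by fun_prop) (by fun_prop)]
    have h2 : ∀ i : Fin n, t i.castSucc ≤ t i.succ := fun i => ht (Fin.castSucc_le_succ i)
    simp_rw [hlaw _ _ (h2 _), hgauss _ _ (h2 _)]
    rw [← hfdd n t ht (fun i => u i)]
    rfl

/-- Convergence in distribution to a Brownian motion, from convergence of finite-dimensional
distributions and control of the modulus of continuity. -/
theorem exists_tendstoInDistribution_brownian (hT : 0 ≤ T) {M : Matrix (Fin d) (Fin d) ℝ}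
    (hM : M.PosSemidef) {Ω : Type*} [MeasurableSpace Ω] (μ : Measure Ω) [IsProbabilityMeasure μ]
    (Z : ℕ → Ω → PathSpace d T) (hZ : ∀ N, Measurable (Z N))
    (h0 : ∀ N ω, Z N ω ⟨0, le_rfl, hT⟩ = 0)
    (hfdd : ∀ (n : ℕ) (t : Fin (n + 1) → Set.Icc (0 : ℝ) T), Monotone t →
      ∀ u : Fin n → EuclideanSpace ℝ (Fin d),
      Tendsto (fun N => ∫ ω, Complex.exp
        ((∑ i, inner ℝ (Z N ω (t i.succ) - Z N ω (t i.castSucc)) (u i) : ℝ) * Complex.I) ∂μ)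
        atTop (𝓝 (∏ i, Complex.exp (-(((t i.succ : ℝ) - (t i.castSucc : ℝ)) *
          ((u i).ofLp ⬝ᵥ M.mulVec (u i).ofLp) / 2 : ℝ)))))
    (hmod : ∀ ε > 0, ∀ η > 0, ∃ δ > 0, ∀ᶠ N in atTop,
      μ {ω | ∃ s t, dist s t ≤ δ ∧ ε < dist (Z N ω s) (Z N ω t)} ≤ η) :
    ∃ (W : Measure (PathSpace d T)) (_ : IsProbabilityMeasure W), IsBrownianLaw T M W ∧
      TendstoInDistribution Z atTop (fun w : PathSpace d T => w) (fun _ => μ) W := by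
  have hprob : ∀ N, IsProbabilityMeasure (μ.map (Z N)) := fun N =>
    Measure.isProbabilityMeasure_map (hZ N).aemeasurable
  let law : ℕ → ProbabilityMeasure (PathSpace d T) := fun N => ⟨μ.map (Z N), hprob N⟩
  have hclosed : IsClosed {w : PathSpace d T | w ⟨0, le_rfl, hT⟩ = 0} :=
    isClosed_eq (by fun_prop) continuous_const
  have hlaw0 : ∀ N, ∀ᵐ w ∂(μ.map (Z N)), w ⟨0, le_rfl, hT⟩ = 0 := fun N => by
    rw [ae_map_iff (hZ N).aemeasurable hclosed.measurableSet]
    exact Eventually.of_forall (h0 N)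
  have htight : IsTightMeasureSet (Set.range fun N => μ.map (Z N)) := by
    refine isTightMeasureSet_of_modulus hT _ hlaw0 fun ε hε η hη => ?_
    obtain ⟨δ, hδ, h⟩ := hmod ε hε η hη
    refine ⟨δ, hδ, h.mono fun N hN => ?_⟩
    rw [Measure.map_apply (hZ N) (isOpen_setOf_modulus_gt _ _).measurableSet]
    exact hN
  -- Prokhorov's theorem. The limit law is taken from this compactness, so no Brownian motion has to
  -- be constructed beforehand.
  have hcomp : IsCompact (closure (Set.range law)) := by
    refine isCompact_closure_of_isTightMeasureSet (htight.subset ?_)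
    rintro _ ⟨_, ⟨N, rfl⟩, rfl⟩
    exact ⟨N, rfl⟩
  have hmem : ∀ N, law N ∈ closure (Set.range law) := fun N => subset_closure ⟨N, rfl⟩
  have hcluster : ∀ W : ProbabilityMeasure (PathSpace d T), MapClusterPt W atTop law →
      IsBrownianLaw T M (W : Measure (PathSpace d T)) := by
    intro W hW
    -- Along an ultrafilter the cluster point is a limit, and both closed events and integrals of
    -- bounded continuous functions pass to it.
    obtain ⟨U, hU, hUW⟩ := mapClusterPt_iff_ultrafilter.1 hW
    refine isBrownianLaw_of_charFun hT hM _ ?_ ?_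
    · have h1 := ProbabilityMeasure.limsup_measure_closed_le_of_tendsto hUW hclosed
      have h2 : ∀ N, (law N : Measure (PathSpace d T)) {w | w ⟨0, le_rfl, hT⟩ = 0} = 1 := fun N =>
        (prob_compl_eq_zero_iff hclosed.measurableSet).1 (ae_iff.1 (hlaw0 N))
      simp only [h2, limsup_const] at h1
      rw [ae_iff, ← Set.compl_ofPred, prob_compl_eq_zero_iff hclosed.measurableSet]
      exact le_antisymm prob_le_one h1
    · intro n t ht u
      let f : BoundedContinuousFunction (PathSpace d T) ℂ :=
        BoundedContinuousFunction.ofNormedAddCommGroup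
          (fun w : PathSpace d T => Complex.exp
            ((∑ i, inner ℝ (w (t i.succ) - w (t i.castSucc)) (u i) : ℝ) * Complex.I))
          (by fun_prop) 1 (fun w => by rw [Complex.norm_exp_ofReal_mul_I])
      have h1 := (ProbabilityMeasure.tendsto_iff_forall_integral_rclike_tendsto ℂ).1 hUW f
      have h2 : ∀ N, ∫ w, f w ∂(law N : Measure (PathSpace d T)) = ∫ ω, Complex.exp
        ((∑ i, inner ℝ (Z N ω (t i.succ) - Z N ω (t i.castSucc)) (u i) : ℝ) * Complex.I) ∂μ :=
        fun N => integral_map (hZ N).aemeasurable f.continuous.aestronglyMeasurable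
      simp_rw [h2] at h1
      exact tendsto_nhds_unique h1 ((hfdd n t ht u).mono_left hU)
  obtain ⟨W, -, hW⟩ := hcomp.exists_mapClusterPt (u := law) (f := atTop)
    (tendsto_principal.2 (Eventually.of_forall hmem))
  have hB := hcluster W hW
  refine ⟨W, inferInstance, hB, ⟨fun N => (hZ N).aemeasurable, by fun_prop, ?_⟩⟩
  -- In a compact set a sequence with only one cluster point converges; uniqueness of the Brownian
  -- law leaves only one.
  have hlim : Tendsto law atTop (𝓝 W) :=
    hcomp.tendsto_nhds_of_unique_mapClusterPt (Eventually.of_forall hmem) fun W' _ hW' =>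
      Subtype.ext <| by
        have := W'.2
        have := W.2
        exact (hcluster W' hW').unique hT hB
  simp only [Measure.map_id']
  exact hlim

end PathConvergence

/-! ### Fourth moments and a maximal inequality for independent sums -/

section FourthMoment

variable {Ω : Type*} [MeasurableSpace Ω] {μ : Measure Ω} [IsProbabilityMeasure μ]

theorem MeasureTheory.MemLp.integrable_pow_of_le {f : Ω → ℝ} {n k : ℕ} (hf : MemLp f n μ)
    (hk : k ≤ n) : Integrable (fun ω => f ω ^ k) μ := by
  have h : MemLp f k μ := hf.mono_exponent (by exact_mod_cast hk)
  have h2 := h.integrable_norm_pow'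
  rw [← integrable_norm_iff (by have := h.1; fun_prop)]
  simpa [norm_pow] using h2

variable {Y : ℕ → Ω → ℝ} {m₂ m₄ : ℝ}

theorem memLp_sum_range {μ : Measure Ω} {p : ENNReal} (h4 : ∀ i, MemLp (Y i) p μ) (n : ℕ) :
    MemLp (fun ω => ∑ i ∈ Finset.range n, Y i ω) p μ :=
  memLp_finsetSum _ fun i _ => h4 i

/-- One induction carries the three moments. In the binomial expansion a mixed term vanishes as soon
as one factor has exponent one, so the fourth moment grows by at most `6 n m₂² + m₄ ≤ (3 m₂² + m₄)
(2 n + 1)`. -/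
theorem integral_sum_range_pow_four_le (hmeas : ∀ i, Measurable (Y i)) (hindep : iIndepFun Y μ)
    (h4 : ∀ i, MemLp (Y i) 4 μ) (h0 : ∀ i, ∫ ω, Y i ω ∂μ = 0)
    (hm2 : ∀ i, ∫ ω, Y i ω ^ 2 ∂μ ≤ m₂) (hm4 : ∀ i, ∫ ω, Y i ω ^ 4 ∂μ ≤ m₄) (n : ℕ) :
    ∫ ω, (∑ i ∈ Finset.range n, Y i ω) ∂μ = 0 ∧
    ∫ ω, (∑ i ∈ Finset.range n, Y i ω) ^ 2 ∂μ ≤ n * m₂ ∧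
    ∫ ω, (∑ i ∈ Finset.range n, Y i ω) ^ 4 ∂μ ≤ (3 * m₂ ^ 2 + m₄) * n ^ 2 := by
  induction n with
  | zero => simp
  | succ n ih =>
    obtain ⟨i1, i2, i4⟩ := ih
    set S : Ω → ℝ := fun ω => ∑ i ∈ Finset.range n, Y i ω with hS
    have hSY : IndepFun S (Y n) μ := by
      have := hindep.indepFun_finsetSum_of_notMem hmeas (s := Finset.range n) (i := n) (by simp)
      convert this using 1
      ext ω; simp [hS]
    have hSm : MemLp S 4 μ := memLp_sum_range h4 n
    have hS' : ∀ k ≤ 4, Integrable (fun ω => S ω ^ k) μ := fun k hk =>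
      hSm.integrable_pow_of_le (n := 4) hk
    have hY' : ∀ k ≤ 4, Integrable (fun ω => Y n ω ^ k) μ := fun k hk =>
      (h4 n).integrable_pow_of_le (n := 4) hk
    have hpow : ∀ a b : ℕ, IndepFun (fun ω => S ω ^ a) (fun ω => Y n ω ^ b) μ := fun a b =>
      hSY.comp (φ := fun x : ℝ => x ^ a) (ψ := fun x : ℝ => x ^ b) (by fun_prop) (by fun_prop)
    have hint : ∀ a ≤ 4, ∀ b ≤ 4, Integrable (fun ω => S ω ^ a * Y n ω ^ b) μ :=
      fun a ha b hb => (hpow a b).integrable_mul (hS' a ha) (hY' b hb)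
    have hprod : ∀ a ≤ 4, ∀ b ≤ 4, ∫ ω, S ω ^ a * Y n ω ^ b ∂μ =
        (∫ ω, S ω ^ a ∂μ) * ∫ ω, Y n ω ^ b ∂μ := fun a ha b hb =>
      (hpow a b).integral_fun_mul_eq_mul_integral (hS' a ha).1 (hY' b hb).1
    have hs1 : ∫ ω, S ω ^ 1 ∂μ = 0 := by simpa using i1
    have hy1 : ∫ ω, Y n ω ^ 1 ∂μ = 0 := by simpa using h0 n
    have hs2 : 0 ≤ ∫ ω, S ω ^ 2 ∂μ := integral_nonneg fun ω => by positivity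
    have hy2 : 0 ≤ ∫ ω, Y n ω ^ 2 ∂μ := integral_nonneg fun ω => by positivity
    simp only [Finset.sum_range_succ]
    refine ⟨?_, ?_, ?_⟩
    · rw [integral_add (by simpa using hS' 1 (by norm_num)) (by simpa using hY' 1 (by norm_num)),
        i1, h0, add_zero]
    · have : ∀ ω, (S ω + Y n ω) ^ 2 = S ω ^ 2 + (2 * (S ω ^ 1 * Y n ω ^ 1) + Y n ω ^ 2) :=
        fun ω => by ring
      change ∫ ω, (S ω + Y n ω) ^ 2 ∂μ ≤ _
      simp_rw [this]
      have j1 := (hint 1 (by norm_num) 1 (by norm_num)).const_mul 2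
      have k1 := j1.add (hY' 2 (by norm_num))
      simp only [Pi.add_def] at k1
      rw [integral_add (hS' 2 (by norm_num)) k1, integral_add j1 (hY' 2 (by norm_num)),
        integral_const_mul, hprod 1 (by norm_num) 1 (by norm_num), hs1]
      push_cast
      linarith [hm2 n]
    · have : ∀ ω, (S ω + Y n ω) ^ 4 = S ω ^ 4 + (4 * (S ω ^ 3 * Y n ω ^ 1) +
          (6 * (S ω ^ 2 * Y n ω ^ 2) + (4 * (S ω ^ 1 * Y n ω ^ 3) + Y n ω ^ 4))) :=
        fun ω => by ring
      change ∫ ω, (S ω + Y n ω) ^ 4 ∂μ ≤ _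
      simp_rw [this]
      have j3 := (hint 1 (by norm_num) 3 (by norm_num)).const_mul 4
      have j2 := (hint 2 (by norm_num) 2 (by norm_num)).const_mul 6
      have j1 := (hint 3 (by norm_num) 1 (by norm_num)).const_mul 4
      have k3 := j3.add (hY' 4 le_rfl)
      have k2 := j2.add k3
      have k1 := j1.add k2
      simp only [Pi.add_def] at k1 k2 k3
      rw [integral_add (hS' 4 le_rfl) k1, integral_add j1 k2, integral_add j2 k3,
        integral_add j3 (hY' 4 le_rfl)]
      simp only [integral_const_mul]
      rw [hprod 3 (by norm_num) 1 (by norm_num), hprod 2 (by norm_num) 2 (by norm_num),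
        hprod 1 (by norm_num) 3 (by norm_num), hs1, hy1]
      have hmul : (∫ ω, S ω ^ 2 ∂μ) * ∫ ω, Y n ω ^ 2 ∂μ ≤ (n * m₂) * m₂ :=
        mul_le_mul i2 (hm2 n) hy2 (hs2.trans i2)
      have hy4 : 0 ≤ ∫ ω, Y n ω ^ 4 ∂μ := integral_nonneg fun ω => by positivity
      have hm4' := hm4 n
      push_cast
      nlinarith [sq_nonneg m₂, Nat.cast_nonneg (α := ℝ) n,
        mul_nonneg (Nat.cast_nonneg (α := ℝ) n) (hy4.trans hm4')]

/-- Convexity gives `(S + Y)⁴ ≥ S⁴ + 4 S³ Y`, and the linear term integrates to zero over past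
events because `Y` is centered and independent of the past. The sum at time `n` has `n + 1` terms,
as `Y n` is known at time `n` of the natural filtration. -/
theorem submartingale_sum_range_pow_four (hmeas : ∀ i, Measurable (Y i)) (hindep : iIndepFun Y μ)
    (h4 : ∀ i, MemLp (Y i) 4 μ) (h0 : ∀ i, ∫ ω, Y i ω ∂μ = 0) :
    Submartingale (fun n ω => (∑ i ∈ Finset.range (n + 1), Y i ω) ^ 4)
      (Filtration.natural Y fun i => (hmeas i).stronglyMeasurable) μ := by
  set 𝒢 := Filtration.natural Y fun i => (hmeas i).stronglyMeasurable
  have hY : ∀ {i n : ℕ}, i ≤ n → Measurable[𝒢 n] (Y i) := fun {i n} hin =>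
    ((Filtration.stronglyAdapted_natural fun i => (hmeas i).stronglyMeasurable) i).measurable.mono
      (𝒢.mono hin) le_rfl
  have hS : ∀ n, Measurable[𝒢 n] fun ω => ∑ i ∈ Finset.range (n + 1), Y i ω := fun n =>
    Finset.measurable_fun_sum _ fun i hi => hY (by simpa [Nat.lt_succ_iff] using hi)
  have hint : ∀ n, Integrable (fun ω => (∑ i ∈ Finset.range (n + 1), Y i ω) ^ 4) μ := fun n =>
    (memLp_sum_range h4 _).integrable_pow_of_le (n := 4) le_rfl
  refine submartingale_of_setIntegral_le_succ
    (fun n => ((hS n).pow_const 4).stronglyMeasurable) hint fun n A hA => ?_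
  set S : Ω → ℝ := fun ω => ∑ i ∈ Finset.range (n + 1), Y i ω with hSdef
  have hA' : MeasurableSet A := 𝒢.le n A hA
  let g : Ω → ℝ := A.indicator fun ω => S ω ^ 3
  have hg : Measurable[𝒢 n] g := ((hS n).pow_const 3).indicator hA
  have hS3 : Integrable (fun ω => S ω ^ 3) μ :=
    (memLp_sum_range h4 _).integrable_pow_of_le (n := 4) (by norm_num)
  have hgint : Integrable g μ := hS3.indicator hA'
  have hYint : Integrable (Y (n + 1)) μ := by
    simpa using (h4 (n + 1)).integrable_pow_of_le (n := 4) (k := 1) (by norm_num)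
  have hind : IndepFun g (Y (n + 1)) μ := by
    have h1 := hindep.indep_comap_natural_of_lt (fun i => (hmeas i).stronglyMeasurable)
      (Nat.lt_succ_self n)
    exact indep_of_indep_of_le_left h1.symm hg.comap_le
  have hmulint : Integrable (fun ω => g ω * Y (n + 1) ω) μ := hind.integrable_mul hgint hYint
  have hzero : ∫ ω, g ω * Y (n + 1) ω ∂μ = 0 := by
    rw [hind.integral_fun_mul_eq_mul_integral hgint.1 hYint.1, h0, mul_zero]
  have hle : ∀ ω, A.indicator (fun ω => S ω ^ 4) ω + 4 * (g ω * Y (n + 1) ω) ≤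
      A.indicator (fun ω => (∑ i ∈ Finset.range (n + 1 + 1), Y i ω) ^ 4) ω := by
    intro ω
    by_cases hω : ω ∈ A
    · simp only [g, Set.indicator_of_mem hω]
      rw [Finset.sum_range_succ]
      change S ω ^ 4 + 4 * (S ω ^ 3 * Y (n + 1) ω) ≤ (S ω + Y (n + 1) ω) ^ 4
      -- The remainder is `6 S² Y² + 4 S Y³ + Y⁴ = Y² (Y + 2 S)² + 2 S² Y²`.
      nlinarith [sq_nonneg (Y (n + 1) ω * (Y (n + 1) ω + 2 * S ω)),
        sq_nonneg (Y (n + 1) ω * S ω)]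
    · simp [g, hω]
  rw [← integral_indicator hA', ← integral_indicator hA']
  have hi4 : Integrable (A.indicator fun ω => S ω ^ 4) μ := (hint n).indicator hA'
  calc ∫ ω, A.indicator (fun ω => S ω ^ 4) ω ∂μ
      = ∫ ω, (A.indicator (fun ω => S ω ^ 4) ω + 4 * (g ω * Y (n + 1) ω)) ∂μ := by
        rw [integral_add hi4 (hmulint.const_mul 4), integral_const_mul, hzero]; ring
    _ ≤ _ := integral_mono (hi4.add (hmulint.const_mul 4)) ((hint (n + 1)).indicator hA') hle

/-- A maximal inequality for sums of independent centered variables with fourth moments. -/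
theorem measureReal_exists_le_sum_pow_four (hmeas : ∀ i, Measurable (Y i))
    (hindep : iIndepFun Y μ)
    (h4 : ∀ i, MemLp (Y i) 4 μ) (h0 : ∀ i, ∫ ω, Y i ω ∂μ = 0)
    (hm2 : ∀ i, ∫ ω, Y i ω ^ 2 ∂μ ≤ m₂) (hm4 : ∀ i, ∫ ω, Y i ω ^ 4 ∂μ ≤ m₄) (n : ℕ)
    {ε : ℝ} (hε : 0 < ε) :
    μ.real {ω | ∃ k ≤ n, ε ≤ (∑ i ∈ Finset.range k, Y i ω) ^ 4} ≤
      (3 * m₂ ^ 2 + m₄) * n ^ 2 / ε := by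
  have hsub := submartingale_sum_range_pow_four hmeas hindep h4 h0
  -- Doob's inequality concerns the sums with at least one term. The empty sum never reaches `ε >
  -- 0`.
  rcases n with _ | n
  · have : {ω | ∃ k ≤ 0, ε ≤ (∑ i ∈ Finset.range k, Y i ω) ^ 4} = ∅ := by
      ext ω; simp [hε]
    rw [this]; simp
  have hmax := maximal_ineq hsub (fun n ω => by positivity) (ε := ⟨ε, hε.le⟩) n
  set B := {ω | ((⟨ε, hε.le⟩ : NNReal) : ℝ) ≤ (Finset.range (n + 1)).sup'
    Finset.nonempty_range_add_one fun k => (∑ i ∈ Finset.range (k + 1), Y i ω) ^ 4} with hB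
  have hint : Integrable (fun ω => (∑ i ∈ Finset.range (n + 1), Y i ω) ^ 4) μ :=
    (memLp_sum_range h4 _).integrable_pow_of_le (n := 4) le_rfl
  have h1 : ε * μ.real B ≤ ∫ ω, (∑ i ∈ Finset.range (n + 1), Y i ω) ^ 4 ∂μ := by
    have h2 : ∫ ω in B, (∑ i ∈ Finset.range (n + 1), Y i ω) ^ 4 ∂μ ≤
        ∫ ω, (∑ i ∈ Finset.range (n + 1), Y i ω) ^ 4 ∂μ :=
      setIntegral_le_integral hint (Eventually.of_forall fun ω => by positivity)
    refine le_trans ?_ h2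
    have h3 := ENNReal.toReal_mono ENNReal.ofReal_ne_top hmax
    rw [ENNReal.toReal_ofReal (integral_nonneg fun ω => by positivity), ENNReal.toReal_mul] at h3
    exact h3
  have hBeq : {ω | ∃ k ≤ n + 1, ε ≤ (∑ i ∈ Finset.range k, Y i ω) ^ 4} ⊆ B := by
    rintro ω ⟨k, hk, hω⟩
    rcases k with _ | k
    · simp at hω; linarith
    · exact hω.trans (Finset.le_sup' (s := Finset.range (n + 1))
        (f := fun k => (∑ i ∈ Finset.range (k + 1), Y i ω) ^ 4) (by simpa using hk))
  have h5 := (integral_sum_range_pow_four_le hmeas hindep h4 h0 hm2 hm4 (n + 1)).2.2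
  rw [le_div_iff₀ hε, mul_comm]
  exact (mul_le_mul_of_nonneg_left (measureReal_mono hBeq) hε.le).trans (h1.trans h5)

end FourthMoment

/-! ### Modulus of continuity of i.i.d. sums -/

section Modulus

variable {d : ℕ} {Ω : Type*} [MeasurableSpace Ω] {μ : Measure Ω} [IsProbabilityMeasure μ]
  {Y : ℕ → Ω → EuclideanSpace ℝ (Fin d)}

theorem MeasureTheory.MemLp.coord {Ω : Type*} [MeasurableSpace Ω] {μ : Measure Ω}
    {f : Ω → EuclideanSpace ℝ (Fin d)} {p : ENNReal} (hf : MemLp f p μ) (j : Fin d) :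
    MemLp (fun ω => f ω j) p μ :=
  (EuclideanSpace.proj (𝕜 := ℝ) j).comp_memLp' hf

/-- Cauchy–Schwarz for the squares of the coordinates; it reduces vectors to the scalar maximal
inequality. -/
theorem norm_pow_four_le_card_mul_sum (x : EuclideanSpace ℝ (Fin d)) :
    ‖x‖ ^ 4 ≤ d * ∑ j, x j ^ 4 := by
  have h := sq_sum_le_card_mul_sum_sq (s := Finset.univ) (f := fun j => x j ^ 2)
  have h2 : ‖x‖ ^ 4 = (∑ j, x j ^ 2) ^ 2 := by
    rw [← EuclideanSpace.real_norm_sq_eq]; ring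
  rw [h2]
  refine h.trans (le_of_eq ?_)
  simp [← pow_mul]

/-- A maximal inequality for sums of i.i.d. centered vectors, uniform in the starting time. -/
theorem exists_measureReal_exists_norm_sum_gt_le (hmeas : ∀ i, Measurable (Y i))
    (hindep : iIndepFun Y μ) (hident : ∀ i, IdentDistrib (Y i) (Y 0) μ μ)
    (h4 : MemLp (Y 0) 4 μ) (h0 : ∫ ω, Y 0 ω ∂μ = 0) :
    ∃ C : ℝ, 0 ≤ C ∧ ∀ (a n : ℕ) (l : ℝ), 0 < l →
      μ.real {ω | ∃ k ≤ n, l < ‖∑ i ∈ Finset.range k, Y (a + i) ω‖} ≤ C * n ^ 2 / l ^ 4 := by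
  have hcoord : ∀ j : Fin d, Measurable fun x : EuclideanSpace ℝ (Fin d) => x j := fun j => by
    fun_prop
  set B : Fin d → ℝ := fun j =>
    3 * (∫ ω, (Y 0 ω j) ^ 2 ∂μ) ^ 2 + ∫ ω, (Y 0 ω j) ^ 4 ∂μ with hB
  have hBn : ∀ j, 0 ≤ B j := fun j => by
    have h2 : 0 ≤ ∫ ω, (Y 0 ω j) ^ 4 ∂μ := integral_nonneg fun ω => by positivity
    positivity
  refine ⟨(∑ j, B j) * d ^ 2, mul_nonneg (Finset.sum_nonneg fun j _ => hBn j) (by positivity),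
    fun a n l hl => ?_⟩
  rcases Nat.eq_zero_or_pos d with hd | hd
  · subst hd
    have : {ω | ∃ k ≤ n, l < ‖∑ i ∈ Finset.range k, Y (a + i) ω‖} = ∅ := by
      refine Set.eq_empty_of_forall_notMem ?_
      rintro ω ⟨k, -, h⟩
      rw [Subsingleton.elim (∑ i ∈ Finset.range k, Y (a + i) ω) 0, norm_zero] at h
      exact lt_asymm hl h
    rw [this]; simp
  have hd' : (0 : ℝ) < d := by exact_mod_cast hd
  -- If each coordinate has fourth power at most `ε`, then the norm has fourth power at most `d · d
  -- · ε = l ^ 4`. The division is the reason for treating `d = 0` apart.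
  set ε := l ^ 4 / d ^ 2 with hε
  have hεpos : 0 < ε := by positivity
  have hj : ∀ j : Fin d, μ.real {ω | ∃ k ≤ n, ε ≤ (∑ i ∈ Finset.range k, Y (a + i) ω j) ^ 4} ≤
      B j * n ^ 2 / ε := by
    intro j
    have hid : ∀ i, IdentDistrib (fun ω => Y (a + i) ω j) (fun ω => Y 0 ω j) μ μ := fun i =>
      (hident (a + i)).comp (hcoord j)
    have hcoordlp : MemLp (fun ω => Y 0 ω j) 4 μ := h4.coord j
    refine measureReal_exists_le_sum_pow_four (Y := fun i ω => Y (a + i) ω j)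
      (m₂ := ∫ ω, (Y 0 ω j) ^ 2 ∂μ) (m₄ := ∫ ω, (Y 0 ω j) ^ 4 ∂μ)
      (fun i => (hcoord j).comp (hmeas _)) ?_ (fun i => (hid i).memLp_iff.2 hcoordlp) ?_ ?_ ?_ n
      hεpos
    · exact (hindep.comp (fun _ x => x j) (fun _ => hcoord j)).precomp
        (g := fun i => a + i) (add_right_injective a)
    · intro i
      rw [(hid i).integral_eq]
      have h1 := (EuclideanSpace.proj (𝕜 := ℝ) j).integral_comp_comm
        (h4.integrable (by norm_num))
      rw [h0] at h1
      simpa using h1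
    · intro i
      exact ((hid i).comp (u := fun x : ℝ => x ^ 2) (by fun_prop)).integral_eq.le
    · intro i
      exact ((hid i).comp (u := fun x : ℝ => x ^ 4) (by fun_prop)).integral_eq.le
  have hsub : {ω | ∃ k ≤ n, l < ‖∑ i ∈ Finset.range k, Y (a + i) ω‖} ⊆
      ⋃ j, {ω | ∃ k ≤ n, ε ≤ (∑ i ∈ Finset.range k, Y (a + i) ω j) ^ 4} := by
    rintro ω ⟨k, hk, hω⟩
    by_contra hcon
    simp only [Set.mem_iUnion, Set.mem_ofPred_eq, not_exists, not_and, not_le] at hcon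
    have h1 := norm_pow_four_le_card_mul_sum (∑ i ∈ Finset.range k, Y (a + i) ω)
    have h2 : ∑ j, (∑ i ∈ Finset.range k, Y (a + i) ω) j ^ 4 ≤ ∑ _j : Fin d, ε := by
      refine Finset.sum_le_sum fun j _ => ?_
      have := (hcon j k hk).le
      simpa using this
    have h3 : l ^ 4 < ‖∑ i ∈ Finset.range k, Y (a + i) ω‖ ^ 4 :=
      pow_lt_pow_left₀ hω hl.le (by norm_num)
    have h4' : (d : ℝ) * ∑ _j : Fin d, ε = l ^ 4 := by
      simp [hε]; field_simp
    have h5 := mul_le_mul_of_nonneg_left h2 hd'.le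
    linarith
  calc _ ≤ μ.real (⋃ j, {ω | ∃ k ≤ n, ε ≤ (∑ i ∈ Finset.range k, Y (a + i) ω j) ^ 4}) :=
        measureReal_mono hsub
    _ ≤ ∑ j, μ.real {ω | ∃ k ≤ n, ε ≤ (∑ i ∈ Finset.range k, Y (a + i) ω j) ^ 4} :=
        measureReal_iUnion_fintype_le _
    _ ≤ ∑ j, B j * n ^ 2 / ε := Finset.sum_le_sum fun j _ => hj j
    _ = _ := by
        rw [← Finset.sum_div, ← Finset.sum_mul, hε]
        field_simp

/-- Cut at the multiples of `h`. Indices at distance at most `h` lie in a common window of length `2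
h` that starts at a cut, and an increment above `2 l` needs a fluctuation above `l` from the start
of that window. A union bound over the windows concludes. -/
theorem exists_measureReal_modulus_sum_gt_le (hmeas : ∀ i, Measurable (Y i))
    (hindep : iIndepFun Y μ) (hident : ∀ i, IdentDistrib (Y i) (Y 0) μ μ)
    (h4 : MemLp (Y 0) 4 μ) (h0 : ∫ ω, Y 0 ω ∂μ = 0) :
    ∃ C : ℝ, 0 ≤ C ∧ ∀ (m h : ℕ) (l : ℝ), 0 < h → 0 < l →
      μ.real {ω | ∃ a b, a ≤ b ∧ b ≤ m ∧ b ≤ a + h ∧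
        2 * l < ‖∑ i ∈ Finset.range b, Y i ω - ∑ i ∈ Finset.range a, Y i ω‖} ≤
        (m / h + 1) * (C * (2 * h) ^ 2 / l ^ 4) := by
  obtain ⟨C, hC, hmax⟩ := exists_measureReal_exists_norm_sum_gt_le hmeas hindep hident h4 h0
  refine ⟨C, hC, fun m h l hh hl => ?_⟩
  have hsub : {ω | ∃ a b, a ≤ b ∧ b ≤ m ∧ b ≤ a + h ∧
        2 * l < ‖∑ i ∈ Finset.range b, Y i ω - ∑ i ∈ Finset.range a, Y i ω‖} ⊆
      ⋃ q ∈ Finset.range (m / h + 1),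
        {ω | ∃ k ≤ 2 * h, l < ‖∑ i ∈ Finset.range k, Y (q * h + i) ω‖} := by
    rintro ω ⟨a, b, hab, hbm, hbh, hω⟩
    by_contra hcon
    simp only [Set.mem_iUnion, Set.mem_ofPred_eq, not_exists, not_and, not_lt, exists_prop] at hcon
    set q := a / h with hq
    have hq1 : q * h ≤ a := Nat.div_mul_le_self a h
    have hq2 : a < q * h + h := by
      have := Nat.lt_div_mul_add (a := a) hh
      simpa [hq] using this
    have hqm : q ∈ Finset.range (m / h + 1) :=
      Finset.mem_range.2 (Nat.lt_succ_of_le (Nat.div_le_div_right (hab.trans hbm)))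
    have key : ∀ c, q * h ≤ c → c ≤ q * h + 2 * h →
        ‖∑ i ∈ Finset.range c, Y i ω - ∑ i ∈ Finset.range (q * h), Y i ω‖ ≤ l := by
      intro c hc hc'
      have := hcon q hqm (c - q * h) (by omega)
      rwa [← add_tsub_cancel_of_le hc, Finset.sum_range_add, add_sub_cancel_left]
    have h1 := key a hq1 (by omega)
    have h2 := key b (by omega) (by omega)
    have h3 := norm_sub_le
      (∑ i ∈ Finset.range b, Y i ω - ∑ i ∈ Finset.range (q * h), Y i ω)
      (∑ i ∈ Finset.range a, Y i ω - ∑ i ∈ Finset.range (q * h), Y i ω)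
    rw [sub_sub_sub_cancel_right] at h3
    linarith
  calc _ ≤ _ := measureReal_mono hsub (measure_ne_top _ _)
    _ ≤ ∑ q ∈ Finset.range (m / h + 1),
        μ.real {ω | ∃ k ≤ 2 * h, l < ‖∑ i ∈ Finset.range k, Y (q * h + i) ω‖} :=
      measureReal_biUnion_finset_le _ _
    _ ≤ ∑ q ∈ Finset.range (m / h + 1), C * (2 * h) ^ 2 / l ^ 4 := by
      refine Finset.sum_le_sum fun q _ => ?_
      have := hmax (q * h) (2 * h) l hl
      push_cast at this
      exact this
    _ ≤ _ := by
      rw [Finset.sum_const, Finset.card_range, nsmul_eq_mul]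
      gcongr
      push_cast
      gcongr
      exact Nat.cast_div_le

/-- Sums of i.i.d. centered vectors have a small modulus of continuity on the diffusive scale. -/
theorem eventually_measureReal_modulus_sum_gt_le (hmeas : ∀ i, Measurable (Y i))
    (hindep : iIndepFun Y μ) (hident : ∀ i, IdentDistrib (Y i) (Y 0) μ μ)
    (h4 : MemLp (Y 0) 4 μ) (h0 : ∫ ω, Y 0 ω ∂μ = 0) {A ε η : ℝ} (hA : 0 ≤ A) (hε : 0 < ε)
    (hη : 0 < η) :
    ∃ δ > 0, ∀ᶠ N : ℕ in atTop, μ.real {ω | ∃ a b : ℕ, a ≤ b ∧ (b : ℝ) ≤ A * N ∧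
      (b : ℝ) ≤ a + δ * N ∧
      ε * √N < ‖∑ i ∈ Finset.range b, Y i ω - ∑ i ∈ Finset.range a, Y i ω‖} ≤ η := by
  obtain ⟨C, hC, hmod⟩ := exists_measureReal_modulus_sum_gt_le hmeas hindep hident h4 h0
  -- With `h` near `δ N`, `m` near `A N` and `l = ε √N / 2`, there are of order `1 / δ` windows,
  -- each with probability of order `δ²`; the total is at most `D δ`. The `64` is `2² · 2⁴`.
  set D := 64 * C * (A + 1) / ε ^ 4 with hD
  have hDn : 0 ≤ D := by positivity
  set δ := min 1 (η / (D + 1)) with hδ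
  have hδpos : 0 < δ := lt_min one_pos (by positivity)
  have hδ1 : δ ≤ 1 := min_le_left _ _
  have hδη : D * δ ≤ η := by
    have h1 : δ ≤ η / (D + 1) := min_le_right _ _
    rw [le_div_iff₀ (by positivity)] at h1
    nlinarith
  refine ⟨δ, hδpos, ?_⟩
  have hlarge : ∀ᶠ N : ℕ in atTop, 1 ≤ δ * N :=
    (tendsto_natCast_atTop_atTop.const_mul_atTop hδpos).eventually_ge_atTop 1
  filter_upwards [hlarge, eventually_gt_atTop 0] with N hN hN0
  have hN0' : (0 : ℝ) < N := by exact_mod_cast hN0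
  have hh : 0 < ⌊δ * N⌋₊ := Nat.floor_pos.2 hN
  have hh' : (0 : ℝ) < ⌊δ * N⌋₊ := by exact_mod_cast hh
  have hhle : (⌊δ * N⌋₊ : ℝ) ≤ δ * N := Nat.floor_le (by positivity)
  have hmle : (⌊A * N⌋₊ : ℝ) ≤ A * N := Nat.floor_le (by positivity)
  have hl : 0 < ε * √N / 2 := by positivity
  refine (measureReal_mono ?_).trans ((hmod ⌊A * N⌋₊ ⌊δ * N⌋₊ (ε * √N / 2) hh hl).trans ?_)
  · rintro ω ⟨a, b, hab, hbA, hbδ, hω⟩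
    refine ⟨a, b, hab, Nat.le_floor hbA, ?_, by linarith⟩
    have : b - a ≤ ⌊δ * N⌋₊ := Nat.le_floor (by rw [Nat.cast_sub hab]; linarith)
    omega
  · have hsq : √(N : ℝ) ^ 4 = (N : ℝ) ^ 2 := by
      rw [show (4 : ℕ) = 2 * 2 by norm_num, pow_mul, Real.sq_sqrt hN0'.le]
    set h : ℝ := (⌊δ * N⌋₊ : ℝ)
    set m : ℝ := (⌊A * N⌋₊ : ℝ)
    calc (m / h + 1) * (C * (2 * h) ^ 2 / (ε * √N / 2) ^ 4)
        = 64 * C / (ε ^ 4 * N ^ 2) * ((m + h) * h) := by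
          rw [div_pow, mul_pow ε, hsq]; field_simp; ring
      _ ≤ 64 * C / (ε ^ 4 * N ^ 2) * ((A * N + 1 * N) * (δ * N)) := by
          gcongr
          exact hhle.trans (by gcongr)
      _ = D * δ := by rw [hD]; field_simp
      _ ≤ η := hδη

end Modulus

/-! ### Characteristic functions at scale `N ^ (-1/2)` -/

section CharFun

variable {Ω : Type*} [MeasurableSpace Ω] {μ : Measure Ω} [IsProbabilityMeasure μ]

/-- A second moment makes the characteristic function twice continuously differentiable; the linear
Taylor term is the mean, which vanishes. -/
theorem taylor_charFun_of_centered {V : Ω → ℝ} (hV : MemLp V 2 μ) (h0 : ∫ ω, V ω ∂μ = 0) :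
    (fun t : ℝ => charFun (μ.map V) t - (1 - ((∫ ω, V ω ^ 2 ∂μ : ℝ) : ℂ) * t ^ 2 / 2)) =o[𝓝 0]
      fun t : ℝ => t ^ 2 := by
  have hm : AEMeasurable V μ := hV.1.aemeasurable
  have hid : MemLp id 2 (μ.map V) := (memLp_map_measure_iff (by fun_prop) hm).2 hV
  have h := fun t => taylorWithinEval_charFun_two_zero (P := μ) hm hid t
  have h1 : (fun t : ℝ => charFun (μ.map V) t -
      (1 - ((∫ ω, V ω ^ 2 ∂μ : ℝ) : ℂ) * t ^ 2 / 2)) =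
      fun t : ℝ => charFun (μ.map V) t - taylorWithinEval (charFun (μ.map V)) 2 Set.univ 0 t := by
    ext t
    rw [h t, h0]
    simp
  have : IsProbabilityMeasure (μ.map V) := Measure.isProbabilityMeasure_map hm
  rw [h1]
  convert! taylor_isLittleO_univ ?_
  · simp
  · exact contDiff_charFun hid

/-- Powers `n N ∼ θ N` of the characteristic function at scale `N ^ (-1/2)`. -/
theorem tendsto_charFun_inv_sqrt_pow {V : Ω → ℝ} (hV : MemLp V 2 μ) (h0 : ∫ ω, V ω ∂μ = 0)
    {n : ℕ → ℕ} {θ : ℝ} (hn : Tendsto (fun N : ℕ => (n N : ℝ) / N) atTop (𝓝 θ)) :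
    Tendsto (fun N : ℕ => charFun (μ.map V) (√N)⁻¹ ^ n N) atTop
      (𝓝 (Complex.exp (-(θ * (∫ ω, V ω ^ 2 ∂μ) / 2 : ℝ)))) := by
  set σ2 : ℝ := ∫ ω, V ω ^ 2 ∂μ
  set g : ℕ → ℂ := fun N => charFun (μ.map V) (√N)⁻¹ - 1 with hg
  have hs : Tendsto (fun N : ℕ => (√(N : ℝ))⁻¹) atTop (𝓝 0) :=
    tendsto_inv_atTop_zero.comp (Real.tendsto_sqrt_atTop.comp tendsto_natCast_atTop_atTop)
  have hNg : Tendsto (fun N : ℕ => (N : ℂ) * g N) atTop (𝓝 (-(σ2 / 2 : ℝ))) := by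
    have h1 := ((taylor_charFun_of_centered hV h0).comp_tendsto hs).tendsto_inv_smul_nhds_zero
    rw [← tendsto_sub_nhds_zero_iff]
    refine h1.congr' ?_
    filter_upwards [eventually_gt_atTop 0] with N hN
    have hN' : (0 : ℝ) < N := by exact_mod_cast hN
    have h2 : (√(N : ℝ))⁻¹ ^ 2 = (N : ℝ)⁻¹ := by rw [inv_pow, Real.sq_sqrt hN'.le]
    have h3 : (((√(N : ℝ))⁻¹ : ℝ) : ℂ) ^ 2 = ((N : ℝ) : ℂ)⁻¹ := by
      rw [← Complex.ofReal_pow, h2, Complex.ofReal_inv]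
    have hNc : (N : ℂ) ≠ 0 := by exact_mod_cast hN.ne'
    simp only [Function.comp_apply, h2, h3, inv_inv, hg]
    simp only [Complex.real_smul]
    push_cast
    field_simp
    ring
  have hlog := Complex.tendsto_nat_mul_log_one_add_of_tendsto hNg
  have hn' : Tendsto (fun N : ℕ => (((n N : ℝ) / N : ℝ) : ℂ)) atTop (𝓝 (θ : ℂ)) :=
    (Complex.continuous_ofReal.tendsto _).comp hn
  have hmul := hn'.mul hlog
  have hlim := (Complex.continuous_exp.tendsto _).comp hmul
  -- Writing `φ ^ n` as `exp (n log φ)` only needs `φ ≠ 0`, which holds for large `N` since `φ`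
  -- tends to `1`.
  have hone : Tendsto (fun N : ℕ => charFun (μ.map V) (√N)⁻¹) atTop (𝓝 1) := by
    have hm : AEMeasurable V μ := hV.1.aemeasurable
    have : IsProbabilityMeasure (μ.map V) := Measure.isProbabilityMeasure_map hm
    have hc : Continuous (charFun (μ.map V)) := continuous_charFun
    have := (hc.tendsto 0).comp hs
    simpa [Function.comp_def] using this
  have heq : (θ : ℂ) * (-((σ2 / 2 : ℝ) : ℂ)) = -((θ * σ2 / 2 : ℝ) : ℂ) := by push_cast; ring
  rw [heq] at hlim
  refine hlim.congr' ?_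
  filter_upwards [eventually_gt_atTop 0, hone.eventually_ne one_ne_zero] with N hN hne
  have hNc : (N : ℂ) ≠ 0 := by exact_mod_cast hN.ne'
  have h1 : (1 : ℂ) + g N = charFun (μ.map V) (√N)⁻¹ := by simp [hg]
  simp only [Function.comp_apply, h1]
  push_cast
  rw [show (n N : ℂ) / N * (N * Complex.log (charFun (μ.map V) (√N)⁻¹)) =
    n N * Complex.log (charFun (μ.map V) (√N)⁻¹) by field_simp, Complex.exp_nat_mul,
    Complex.exp_log hne]

end CharFun

/-! ### Finite-dimensional central limit theorem -/

section Increments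

/-- The intervals between consecutive `a i` are disjoint, so each inner sum has at most one term.
Indices are grouped by interval; those in none contribute `G 0 = 1`. -/
theorem prod_range_of_monotone {α : Type*} [CommMonoid α] {E : Type*} [AddCommMonoid E]
    {n : ℕ} {a : Fin (n + 1) → ℕ} (ha : Monotone a) (u : Fin n → E) (G : E → α) (hG : G 0 = 1) :
    ∏ k ∈ Finset.range (a (Fin.last n)),
      G (∑ i, if k ∈ Finset.Ico (a i.castSucc) (a i.succ) then u i else 0) =
      ∏ i, G (u i) ^ (a i.succ - a i.castSucc) := by
  have huniq : ∀ (k : ℕ) (i j : Fin n), k ∈ Finset.Ico (a i.castSucc) (a i.succ) →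
      k ∈ Finset.Ico (a j.castSucc) (a j.succ) → i = j := by
    intro k i j hi hj
    simp only [Finset.mem_Ico] at hi hj
    by_contra hne
    rcases lt_or_gt_of_ne hne with h | h
    · have := ha (show i.succ ≤ j.castSucc by simpa [Fin.le_def] using Nat.succ_le_of_lt h)
      omega
    · have := ha (show j.succ ≤ i.castSucc by simpa [Fin.le_def] using Nat.succ_le_of_lt h)
      omega
  have hk : ∀ k, G (∑ i, if k ∈ Finset.Ico (a i.castSucc) (a i.succ) then u i else 0) =
      ∏ i, if k ∈ Finset.Ico (a i.castSucc) (a i.succ) then G (u i) else 1 := by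
    intro k
    by_cases hex : ∃ i, k ∈ Finset.Ico (a (Fin.castSucc i)) (a i.succ)
    · obtain ⟨i, hi⟩ := hex
      rw [Finset.sum_eq_single i, Finset.prod_eq_single i, if_pos hi, if_pos hi]
      · exact fun j _ hj => if_neg fun hj' => hj (huniq k j i hj' hi)
      · simp
      · exact fun j _ hj => if_neg fun hj' => hj (huniq k j i hj' hi)
      · simp
    · push Not at hex
      simp only [hex, if_false]
      simp [hG]
  simp_rw [hk]
  rw [Finset.prod_comm]
  refine Finset.prod_congr rfl fun i _ => ?_
  rw [← Finset.prod_filter]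
  have : (Finset.range (a (Fin.last n))).filter
      (fun k => k ∈ Finset.Ico (a i.castSucc) (a i.succ)) =
      Finset.Ico (a i.castSucc) (a i.succ) := by
    ext k
    have := ha (Fin.le_last i.succ)
    simp only [Finset.mem_filter, Finset.mem_range, Finset.mem_Ico]
    omega
  rw [this, Finset.prod_const, Nat.card_Ico]

theorem sum_inner_increments_eq {d n : ℕ} {a : Fin (n + 1) → ℕ} (ha : Monotone a)
    (u : Fin n → EuclideanSpace ℝ (Fin d)) (y : ℕ → EuclideanSpace ℝ (Fin d)) :
    ∑ i : Fin n, inner ℝ (∑ k ∈ Finset.range (a i.succ), y k -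
      ∑ k ∈ Finset.range (a i.castSucc), y k) (u i) =
    ∑ k ∈ Finset.range (a (Fin.last n)),
      inner ℝ (y k) (∑ i, if k ∈ Finset.Ico (a i.castSucc) (a i.succ) then u i else 0) := by
  simp_rw [inner_sum]
  rw [Finset.sum_comm]
  refine Finset.sum_congr rfl fun i _ => ?_
  have h1 := ha (Fin.castSucc_le_succ i)
  have h2 := ha (Fin.le_last i.succ)
  rw [← Finset.sum_Ico_eq_sub _ h1, sum_inner]
  have : ∀ k, inner ℝ (y k) (if k ∈ Finset.Ico (a i.castSucc) (a i.succ) then u i else 0) =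
      if k ∈ Finset.Ico (a i.castSucc) (a i.succ) then inner ℝ (y k) (u i) else 0 := by
    intro k; split_ifs <;> simp
  simp_rw [this]
  rw [← Finset.sum_filter]
  congr 1
  ext k
  simp only [Finset.mem_filter, Finset.mem_range, Finset.mem_Ico]
  omega

variable {d : ℕ} {Ω : Type*} [MeasurableSpace Ω] {μ : Measure Ω} [IsProbabilityMeasure μ]
  {Y : ℕ → Ω → EuclideanSpace ℝ (Fin d)}

/-- A linear combination of increments of the partial sums is a single sum of independent scalars,
`Y k` being paired with the vector of the interval that contains `k`. Independence of the increments
themselves need not be discussed. -/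
theorem integral_exp_increments_eq (hmeas : ∀ i, Measurable (Y i))
    (hindep : iIndepFun Y μ) (hident : ∀ i, IdentDistrib (Y i) (Y 0) μ μ)
    {n : ℕ} {a : Fin (n + 1) → ℕ} (ha : Monotone a) (u : Fin n → EuclideanSpace ℝ (Fin d))
    (s : ℝ) :
    ∫ ω, Complex.exp ((∑ i : Fin n, inner ℝ (s • (∑ k ∈ Finset.range (a i.succ), Y k ω -
      ∑ k ∈ Finset.range (a i.castSucc), Y k ω)) (u i) : ℝ) * Complex.I) ∂μ =
    ∏ i, charFun (μ.map fun ω => inner ℝ (Y 0 ω) (u i)) s ^ (a i.succ - a i.castSucc) := by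
  set w : ℕ → EuclideanSpace ℝ (Fin d) := fun k =>
    ∑ i, if k ∈ Finset.Ico (a i.castSucc) (a i.succ) then u i else 0 with hw
  have hinner : ∀ x : EuclideanSpace ℝ (Fin d), Measurable fun y : EuclideanSpace ℝ (Fin d) =>
    inner ℝ y x := fun x => by fun_prop
  have hVm : ∀ k, Measurable fun ω => inner ℝ (Y k ω) (w k) := fun k => (hinner _).comp (hmeas k)
  have hV : iIndepFun (fun k ω => inner ℝ (Y k ω) (w k)) μ :=
    hindep.comp (fun k y => inner ℝ y (w k)) fun k => hinner _
  have h1 := (hV.restrict (Finset.range (a (Fin.last n)))).charFun_map_fun_finsetSum_eq_prod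
    fun k _ => (hVm k).aemeasurable
  have h2 := congrFun h1 s
  rw [Finset.prod_apply] at h2
  have h3 : ∀ k, charFun (μ.map fun ω => inner ℝ (Y k ω) (w k)) s =
      charFun (μ.map fun ω => inner ℝ (Y 0 ω) (w k)) s := fun k => by
    have := ((hident k).comp (hinner (w k))).map_eq
    simp only [Function.comp_def] at this
    rw [this]
  simp_rw [h3] at h2
  rw [prod_range_of_monotone ha u
    (fun x => charFun (μ.map fun ω => inner ℝ (Y 0 ω) x) s) (by simp)] at h2
  rw [← h2, charFun_apply, integral_map
    (Finset.measurable_fun_sum _ fun k _ => hVm k).aemeasurable (by fun_prop)]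
  refine integral_congr_ae (Eventually.of_forall fun ω => ?_)
  have h4 := sum_inner_increments_eq ha u (fun k => Y k ω)
  simp only [real_inner_smul_left, ← Finset.mul_sum, h4]
  congr 3

/-- The finite-dimensional central limit theorem for sums of i.i.d. centered vectors. -/
theorem tendsto_integral_exp_increments (hmeas : ∀ i, Measurable (Y i))
    (hindep : iIndepFun Y μ) (hident : ∀ i, IdentDistrib (Y i) (Y 0) μ μ)
    (h2 : MemLp (Y 0) 2 μ) (h0 : ∫ ω, Y 0 ω ∂μ = 0)
    {n : ℕ} {a : ℕ → Fin (n + 1) → ℕ} (ha : ∀ N, Monotone (a N)) {θ : Fin n → ℝ}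
    (hθ : ∀ i : Fin n, Tendsto (fun N : ℕ => ((a N i.succ : ℝ) - a N i.castSucc) / N) atTop
      (𝓝 (θ i))) (u : Fin n → EuclideanSpace ℝ (Fin d)) :
    Tendsto (fun N : ℕ => ∫ ω, Complex.exp ((∑ i : Fin n, inner ℝ ((√N)⁻¹ •
      (∑ k ∈ Finset.range (a N i.succ), Y k ω -
      ∑ k ∈ Finset.range (a N i.castSucc), Y k ω)) (u i) : ℝ) * Complex.I) ∂μ) atTop
      (𝓝 (∏ i, Complex.exp (-(θ i * (∫ ω, inner ℝ (Y 0 ω) (u i) ^ 2 ∂μ) / 2 : ℝ)))) := by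
  simp_rw [fun N => integral_exp_increments_eq hmeas hindep hident (ha N) u (√N)⁻¹]
  refine tendsto_finsetProd _ fun i _ => ?_
  refine tendsto_charFun_inv_sqrt_pow ?_ ?_ ?_
  · exact h2.inner_const (u i)
  · have h3 := integral_inner (𝕜 := ℝ) (h2.integrable (by norm_num)) (u i)
    rw [h0, inner_zero_right] at h3
    simpa [real_inner_comm] using h3
  · refine (hθ i).congr fun N => ?_
    rw [Nat.cast_sub (ha N (Fin.castSucc_le_succ i))]

end Increments

/-! ### Deterministic renewal theory -/

section Renewal

/-- The number of renewals up to time `n`. -/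
def renewalCount (τ : ℕ → ℕ) (n : ℕ) : ℕ := Nat.findGreatest (fun k => τ k ≤ n) n

variable {τ : ℕ → ℕ}

theorem renewalCount_le (n : ℕ) : renewalCount τ n ≤ n := Nat.findGreatest_le n

theorem le_of_renewalCount (h0 : τ 0 = 0) (n : ℕ) : τ (renewalCount τ n) ≤ n :=
  Nat.findGreatest_spec (P := fun k => τ k ≤ n) (Nat.zero_le n) (by simp [h0])

theorem lt_of_renewalCount (hτ : StrictMono τ) (n : ℕ) : n < τ (renewalCount τ n + 1) := by
  by_contra h
  push Not at h
  have h1 : renewalCount τ n + 1 ≤ n := (hτ.le_apply).trans h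
  exact Nat.findGreatest_is_greatest (P := fun k => τ k ≤ n) (Nat.lt_succ_self _) h1 h

theorem renewalCount_mono (hτ : StrictMono τ) (h0 : τ 0 = 0) {m n : ℕ} (h : m ≤ n) :
    renewalCount τ m ≤ renewalCount τ n := by
  have h1 := (le_of_renewalCount h0 m).trans h
  have h2 := h1.trans_lt (lt_of_renewalCount hτ n)
  exact Nat.lt_succ_iff.1 (hτ.lt_iff_lt.1 h2)

/-- Renewals are at least one unit of time apart. This carries a modulus of continuity from the
renewal index over to time. -/
theorem renewalCount_le_add (hτ : StrictMono τ) (h0 : τ 0 = 0) {m n : ℕ} (h : m ≤ n) :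
    renewalCount τ n ≤ renewalCount τ m + (n - m) := by
  rcases le_or_gt (renewalCount τ n) (renewalCount τ m) with h1 | h1
  · omega
  · have h2 := le_of_renewalCount h0 n
    have h3 := lt_of_renewalCount hτ m
    have h4 := hτ.add_le_nat (renewalCount τ n - (renewalCount τ m + 1)) (renewalCount τ m + 1)
    rw [Nat.sub_add_cancel h1] at h4
    omega

theorem tendsto_renewalCount (hτ : StrictMono τ) : Tendsto (renewalCount τ) atTop atTop := by
  refine tendsto_atTop.2 fun k => ?_
  filter_upwards [eventually_ge_atTop (τ k)] with n hn
  exact Nat.lt_succ_iff.1 (hτ.lt_iff_lt.1 (hn.trans_lt (lt_of_renewalCount hτ n)))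

/-- The first block has a law of its own, so the strong law applies to `s (k + 1) - s 1` only. The
shift and the fixed term disappear after division by `k`. -/
theorem tendsto_inv_smul_of_shift {V : Type*} [NormedAddCommGroup V] [NormedSpace ℝ V]
    {s : ℕ → V} {w : V} (h : Tendsto (fun k : ℕ => (k : ℝ)⁻¹ • (s (k + 1) - s 1)) atTop (𝓝 w)) :
    Tendsto (fun k : ℕ => (k : ℝ)⁻¹ • s k) atTop (𝓝 w) := by
  rw [← tendsto_add_atTop_iff_nat 1]
  have hinv : Tendsto (fun k : ℕ => (((k + 1 : ℕ) : ℝ))⁻¹) atTop (𝓝 0) :=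
    (tendsto_add_atTop_iff_nat 1).2 (tendsto_inv_atTop_zero.comp tendsto_natCast_atTop_atTop)
  have hone : Tendsto (fun k : ℕ => 1 - (((k + 1 : ℕ) : ℝ))⁻¹) atTop (𝓝 (1 - 0)) :=
    tendsto_const_nhds.sub hinv
  have := (hone.smul h).add (hinv.smul_const (s 1))
  simp only [sub_zero, one_smul, zero_smul, add_zero] at this
  refine this.congr' ?_
  filter_upwards [eventually_gt_atTop 0] with k hk
  have hk' : (k : ℝ) ≠ 0 := by exact_mod_cast hk.ne'
  have h2 : (1 - (((k + 1 : ℕ) : ℝ))⁻¹) * (k : ℝ)⁻¹ = (((k + 1 : ℕ) : ℝ))⁻¹ := by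
    push_cast; field_simp; ring
  rw [smul_smul, h2, smul_sub, sub_add_cancel]

/-- With `κ` renewals up to time `n` one has `τ κ ≤ n < τ (κ + 1)`, which squeezes `n / κ` towards
`m`. -/
theorem tendsto_renewalCount_div (hτ : StrictMono τ) (h0 : τ 0 = 0) {m : ℝ} (hm : 0 < m)
    (h : Tendsto (fun k : ℕ => (k : ℝ)⁻¹ * (τ k : ℝ)) atTop (𝓝 m)) :
    Tendsto (fun n : ℕ => (n : ℝ)⁻¹ * (renewalCount τ n : ℝ)) atTop (𝓝 m⁻¹) := by
  have hκ := tendsto_renewalCount hτ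
  have hlow := h.comp hκ
  have hup : Tendsto (fun n : ℕ => (renewalCount τ n : ℝ)⁻¹ * (τ (renewalCount τ n + 1) : ℝ))
      atTop (𝓝 m) := by
    have h1 : Tendsto (fun k : ℕ => (k : ℝ)⁻¹ * (τ (k + 1) : ℝ)) atTop (𝓝 m) := by
      have h2 := (tendsto_add_atTop_iff_nat 1).2 h
      have hinv : Tendsto (fun k : ℕ => 1 + (k : ℝ)⁻¹) atTop (𝓝 (1 + 0)) :=
        tendsto_const_nhds.add (tendsto_inv_atTop_zero.comp tendsto_natCast_atTop_atTop)
      have h3 := hinv.mul h2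
      rw [add_zero, one_mul] at h3
      refine h3.congr' ?_
      filter_upwards [eventually_gt_atTop 0] with k hk
      have hk' : (k : ℝ) ≠ 0 := by exact_mod_cast hk.ne'
      push_cast
      field_simp
    exact h1.comp hκ
  have hmid : Tendsto (fun n : ℕ => (renewalCount τ n : ℝ)⁻¹ * (n : ℝ)) atTop (𝓝 m) := by
    refine tendsto_of_tendsto_of_tendsto_of_le_of_le hlow hup (fun n => ?_) fun n => ?_
    · simp only [Function.comp_apply]
      gcongr
      exact le_of_renewalCount h0 n
    · simp only
      gcongr
      exact (lt_of_renewalCount hτ n).le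
  have := hmid.inv₀ hm.ne'
  refine this.congr fun n => ?_
  rw [mul_inv, inv_inv, mul_comm]

theorem norm_sub_le_of_jumps {V : Type*} [NormedAddCommGroup V] {x : ℕ → V} {K : ℝ}
    (hx : ∀ n, ‖x (n + 1) - x n‖ ≤ K) {m n : ℕ} (h : m ≤ n) :
    ‖x n - x m‖ ≤ K * ((n : ℝ) - m) := by
  induction n, h using Nat.le_induction with
  | base => simp
  | succ n hn ih =>
    have : x (n + 1) - x m = (x (n + 1) - x n) + (x n - x m) := by abel
    rw [this]
    refine (norm_add_le _ _).trans ?_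
    push_cast
    linarith [hx n]

/-- Law of large numbers along a sequence with bounded jumps, from the one along renewals. -/
theorem tendsto_inv_smul_of_renewal {V : Type*} [NormedAddCommGroup V] [NormedSpace ℝ V]
    {x : ℕ → V} {K : ℝ} (hx : ∀ n, ‖x (n + 1) - x n‖ ≤ K) (hτ : StrictMono τ) (h0 : τ 0 = 0)
    {m : ℝ} (hm : 0 < m) {w : V}
    (h : Tendsto (fun k : ℕ => (k : ℝ)⁻¹ * (τ k : ℝ)) atTop (𝓝 m))
    (hw : Tendsto (fun k : ℕ => (k : ℝ)⁻¹ • x (τ k)) atTop (𝓝 w)) :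
    Tendsto (fun n : ℕ => (n : ℝ)⁻¹ • x n) atTop (𝓝 (m⁻¹ • w)) := by
  have hκ := tendsto_renewalCount hτ
  have hdiv := tendsto_renewalCount_div hτ h0 hm h
  have hmain := hdiv.smul (hw.comp hκ)
  -- By bounded jumps the error is at most `K (n - τ κ) / n`, written here as `K (1 - (κ / n) (τ κ /
  -- κ))`, whose limit is `K (1 - m⁻¹ m) = 0`.
  have herr0 : Tendsto (fun n : ℕ => K * (1 - (n : ℝ)⁻¹ * (renewalCount τ n : ℝ) *
      ((renewalCount τ n : ℝ)⁻¹ * (τ (renewalCount τ n) : ℝ)))) atTop (𝓝 0) := by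
    have h1 := (tendsto_const_nhds (x := K)).mul
      ((tendsto_const_nhds (x := (1 : ℝ))).sub (hdiv.mul (h.comp hκ)))
    rw [inv_mul_cancel₀ hm.ne', sub_self, mul_zero] at h1
    exact h1
  have hpos : ∀ᶠ n : ℕ in atTop, 0 < renewalCount τ n := hκ.eventually_gt_atTop 0
  have herr : Tendsto (fun n : ℕ => (n : ℝ)⁻¹ • (x n - x (τ (renewalCount τ n)))) atTop
      (𝓝 0) := by
    refine squeeze_zero_norm' ?_ herr0
    filter_upwards [hpos, eventually_gt_atTop 0] with n hn hn0
    have hn' : (renewalCount τ n : ℝ) ≠ 0 := by exact_mod_cast hn.ne'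
    have hn0' : (0 : ℝ) < n := by exact_mod_cast hn0
    have h1 := norm_sub_le_of_jumps hx (le_of_renewalCount h0 n)
    rw [norm_smul, norm_inv, Real.norm_natCast]
    have h2 := mul_le_mul_of_nonneg_left h1 (inv_nonneg.2 hn0'.le)
    refine h2.trans (le_of_eq ?_)
    field_simp
  have := hmain.add herr
  rw [add_zero] at this
  refine this.congr' ?_
  filter_upwards [hpos] with n hn
  have hn' : (renewalCount τ n : ℝ) ≠ 0 := by exact_mod_cast hn.ne'
  simp only [Function.comp_apply]
  rw [smul_smul, mul_assoc, mul_inv_cancel₀ hn', mul_one, ← smul_add, add_sub_cancel]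

/-- A sequence with bounded jumps stays close to its values at renewals. -/
theorem norm_sub_sub_renewal_le {V : Type*} [NormedAddCommGroup V]
    {x : ℕ → V} {K : ℝ} (hK : 0 ≤ K) (hx : ∀ n, ‖x (n + 1) - x n‖ ≤ K) (hτ : StrictMono τ)
    (h0 : τ 0 = 0) (n : ℕ) {l : ℝ} (hl : ∀ k ≤ n, (τ (k + 1) : ℝ) - τ k ≤ l) :
    ‖x n - x 0 - (x (τ (renewalCount τ n + 1)) - x (τ 1))‖ ≤ 2 * K * l := by
  have h1 := norm_sub_le_of_jumps hx (lt_of_renewalCount hτ n).le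
  have h2 := norm_sub_le_of_jumps hx (Nat.zero_le (τ 1))
  have h3 := le_of_renewalCount h0 n
  have h3' : (τ (renewalCount τ n) : ℝ) ≤ n := by exact_mod_cast h3
  have h4 := hl _ (renewalCount_le (τ := τ) n)
  have h5 := hl 0 (Nat.zero_le n)
  rw [h0] at h5
  -- The blocks `1, …, κ` add up to the displacement from `τ 1` to `τ (κ + 1)`. The discrepancy is
  -- block `0` and the part of block `κ` after `n`, each of length at most `l`.
  have h6 : x n - x 0 - (x (τ (renewalCount τ n + 1)) - x (τ 1)) =
      (x (τ 1) - x 0) - (x (τ (renewalCount τ n + 1)) - x n) := by abel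
  rw [h6]
  refine (norm_sub_le _ _).trans ?_
  simp only [Nat.cast_zero, zero_add, sub_zero] at *
  nlinarith

end Renewal

/-! ### Moments from geometric tails -/

section Tails

variable {Ω : Type*} [MeasurableSpace Ω] {μ : Measure Ω} [IsProbabilityMeasure μ]

/-- The moment is the series of `n ^ m` times the probability of `L = n`, and `L = n + 1` has
probability at most `C ρ ^ n`. A polynomial times a geometric sequence is summable; `ρ = 0` is apart
because the index shift divides by `ρ`. -/
theorem integrable_pow_of_geometric_tail {L : Ω → ℕ} (hL : Measurable L) {C ρ : ℝ} (hρ : 0 ≤ ρ)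
    (hρ1 : ρ < 1) (h : ∀ n : ℕ, μ.real {ω | n < L ω} ≤ C * ρ ^ n) (m : ℕ) :
    Integrable (fun ω => (L ω : ℝ) ^ m) μ := by
  have hC : 0 ≤ C := by simpa using measureReal_nonneg.trans (h 0)
  have hmeas : Measurable fun n : ℕ => (n : ℝ) ^ m := measurable_of_countable _
  have hcomp : (fun ω => (L ω : ℝ) ^ m) = (fun n : ℕ => (n : ℝ) ^ m) ∘ L := rfl
  rw [hcomp, ← integrable_map_measure hmeas.aestronglyMeasurable hL.aemeasurable]
  refine ⟨hmeas.aestronglyMeasurable, ?_⟩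
  rw [HasFiniteIntegral, lintegral_countable', tsum_eq_zero_add' ENNReal.summable]
  refine ENNReal.add_lt_top.2 ⟨ENNReal.mul_lt_top enorm_lt_top (measure_lt_top _ _), ?_⟩
  have hsum : Summable fun n : ℕ => C * (((n + 1 : ℕ) : ℝ) ^ m * ρ ^ n) := by
    refine Summable.mul_left C ?_
    rcases hρ.eq_or_lt with h0 | h0
    · refine summable_of_ne_finset_zero (s := {0}) fun n hn => ?_
      rw [← h0, zero_pow (by simpa using hn), mul_zero]
    · have h1 := (summable_nat_add_iff 1).2
        (summable_pow_mul_geometric_of_norm_lt_one m (r := ρ) (by rwa [Real.norm_of_nonneg hρ]))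
      refine (h1.mul_left ρ⁻¹).congr fun n => ?_
      rw [pow_succ ρ n]; field_simp
  refine lt_of_le_of_lt (ENNReal.tsum_le_tsum fun n => ?_) hsum.tsum_ofReal_lt_top
  have h2 : μ.map L {n + 1} ≤ ENNReal.ofReal (C * ρ ^ n) := by
    rw [Measure.map_apply hL (measurableSet_singleton _)]
    refine (measure_mono (t := {ω | n < L ω}) fun ω hω => ?_).trans ?_
    · have : L ω = n + 1 := hω
      change n < L ω
      omega
    · rw [← ENNReal.ofReal_toReal (measure_ne_top μ {ω | n < L ω})]
      exact ENNReal.ofReal_le_ofReal (h n)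
  calc _ ≤ ENNReal.ofReal (((n + 1 : ℕ) : ℝ) ^ m) * ENNReal.ofReal (C * ρ ^ n) := by
        gcongr
        rw [Real.enorm_of_nonneg (by positivity)]
    _ = _ := by
      rw [← ENNReal.ofReal_mul (by positivity)]; congr 1; ring

theorem integrable_rpow_of_geometric_tail {L : Ω → ℕ} (hL : Measurable L) {C ρ : ℝ} (hρ : 0 ≤ ρ)
    (hρ1 : ρ < 1) (h : ∀ n : ℕ, μ.real {ω | n < L ω} ≤ C * ρ ^ n) (q : ℝ) :
    Integrable (fun ω => (L ω : ℝ) ^ q) μ := by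
  have h1 := (integrable_pow_of_geometric_tail hL hρ hρ1 h ⌈q⌉₊).add (integrable_const (1 : ℝ))
  refine h1.mono' ?_ (Eventually.of_forall fun ω => ?_)
  · exact ((measurable_of_countable fun n : ℕ => (n : ℝ) ^ q).comp hL).aestronglyMeasurable
  · rw [Real.norm_of_nonneg (by positivity)]
    simp only [Pi.add_apply]
    rcases Nat.eq_zero_or_pos (L ω) with h0 | h0
    · rw [h0]
      have : ((0 : ℕ) : ℝ) ^ q ≤ 1 := by
        rw [Nat.cast_zero]; exact Real.zero_rpow_le_one q
      have h2 : (0 : ℝ) ≤ ((0 : ℕ) : ℝ) ^ ⌈q⌉₊ := by positivity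
      linarith
    · have hone : (1 : ℝ) ≤ L ω := by exact_mod_cast h0
      have h2 := Real.rpow_le_rpow_of_exponent_le hone (Nat.le_ceil q)
      rw [Real.rpow_natCast] at h2
      linarith

end Tails

/-! ### Block increments and the strong law -/

section Regeneration

variable {d : ℕ} {Ω : Type*} [MeasurableSpace Ω] {μ : Measure Ω}
  {X : ℕ → Ω → EuclideanSpace ℝ (Fin d)} {τ : ℕ → Ω → ℕ}

theorem measurable_eval_random_time {β : Type*} [MeasurableSpace β] {Z : ℕ → Ω → β}
    (hZ : ∀ n, Measurable (Z n)) {s : Ω → ℕ} (hs : Measurable s) :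
    Measurable fun ω => Z (s ω) ω := by
  have h : Measurable fun p : ℕ × Ω => Z p.1 p.2 := measurable_from_prod_countable_right hZ
  exact h.comp (hs.prodMk measurable_id)

theorem measurable_blockLength (hτ : ∀ k, Measurable (τ k)) (k : ℕ) :
    Measurable (blockLength τ k) :=
  (measurable_of_countable fun p : ℕ × ℕ => p.1 - p.2).comp ((hτ (k + 1)).prodMk (hτ k))

theorem measurable_block (hX : ∀ n, Measurable (X n)) (hτ : ∀ k, Measurable (τ k)) (k : ℕ) :
    Measurable (block X τ k) := by
  refine (measurable_blockLength hτ k).prodMk (measurable_pi_lambda _ fun m => ?_)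
  refine (measurable_eval_random_time hX ?_).sub (measurable_eval_random_time hX (hτ k))
  exact (measurable_of_countable fun p : ℕ × ℕ => p.1 + min m p.2).comp
    ((hτ k).prodMk (measurable_blockLength hτ k))

/-- The increment of `X_n - n v` over a block, as a function of the block. -/
def blockIncrement (v : EuclideanSpace ℝ (Fin d)) (p : ℕ × (ℕ → EuclideanSpace ℝ (Fin d))) :
    EuclideanSpace ℝ (Fin d) := p.2 p.1 - (p.1 : ℝ) • v

theorem measurable_blockIncrement (v : EuclideanSpace ℝ (Fin d)) :
    Measurable (blockIncrement v) := by
  have h : Measurable fun p : ℕ × (ℕ → EuclideanSpace ℝ (Fin d)) => p.2 p.1 :=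
    measurable_from_prod_countable_right fun n => measurable_pi_apply n
  have h2 : Measurable fun p : ℕ × (ℕ → EuclideanSpace ℝ (Fin d)) => (p.1 : ℝ) • v :=
    (measurable_of_countable fun n : ℕ => (n : ℝ) • v).comp measurable_fst
  exact h.sub h2

theorem blockIncrement_block {Ω : Type*} {X : ℕ → Ω → EuclideanSpace ℝ (Fin d)}
    {τ : ℕ → Ω → ℕ} (v : EuclideanSpace ℝ (Fin d)) {ω : Ω}
    (hω : StrictMono fun k => τ k ω) (k : ℕ) :
    blockIncrement v (block X τ k ω) =
      centered X v (τ (k + 1) ω) ω - centered X v (τ k ω) ω := by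
  have h : τ k ω ≤ τ (k + 1) ω := (hω (Nat.lt_succ_self k)).le
  simp only [blockIncrement, block, centered, blockLength, min_self, add_tsub_cancel_of_le h,
    Nat.cast_sub h]
  rw [sub_smul]
  abel

theorem sum_blockIncrement {Ω : Type*} {X : ℕ → Ω → EuclideanSpace ℝ (Fin d)}
    {τ : ℕ → Ω → ℕ} (v : EuclideanSpace ℝ (Fin d)) {ω : Ω}
    (hω : StrictMono fun k => τ k ω) (n : ℕ) :
    ∑ i ∈ Finset.range n, blockIncrement v (block X τ (i + 1) ω) =
      centered X v (τ (n + 1) ω) ω - centered X v (τ 1 ω) ω := by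
  simp_rw [blockIncrement_block v hω]
  exact Finset.sum_range_sub (fun i => centered X v (τ (i + 1) ω) ω) n

theorem norm_centered_jump_le {Ω : Type*} {X : ℕ → Ω → EuclideanSpace ℝ (Fin d)}
    {v : EuclideanSpace ℝ (Fin d)} {K : ℝ} {ω : Ω}
    (h : ∀ n, ‖X (n + 1) ω - X n ω‖ ≤ K) (n : ℕ) :
    ‖centered X v (n + 1) ω - centered X v n ω‖ ≤ K + ‖v‖ := by
  have : centered X v (n + 1) ω - centered X v n ω = (X (n + 1) ω - X n ω) - v := by
    simp only [centered]; push_cast; rw [add_smul, one_smul]; abel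
  rw [this]
  exact (norm_sub_le _ _).trans (by linarith [h n])

theorem measurable_centered (hX : ∀ n, Measurable (X n)) (v : EuclideanSpace ℝ (Fin d)) (n : ℕ) :
    Measurable (centered X v n) := (hX n).sub_const _

variable [IsProbabilityMeasure μ]

theorem HasGeometricTails.integrable_pow (h : HasGeometricTails μ τ)
    (hτ : ∀ k, Measurable (τ k)) (k m : ℕ) :
    Integrable (fun ω => (blockLength τ k ω : ℝ) ^ m) μ := by
  obtain ⟨C, ρ, h0, h1, h2⟩ := h
  exact integrable_pow_of_geometric_tail (measurable_blockLength hτ k) h0 h1 (h2 k) m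

theorem HasGeometricTails.hasBlockMoments (h : HasGeometricTails μ τ)
    (hτ : ∀ k, Measurable (τ k)) (q : ℝ) : HasBlockMoments μ τ q := by
  obtain ⟨C, ρ, h0, h1, h2⟩ := h
  exact fun k =>
    integrable_rpow_of_geometric_tail (measurable_blockLength hτ k) h0 h1 (h2 k) q

/-- Blocks have length at least one. Besides a nonzero denominator, this gives a renewal rate of at
most one, which keeps the relevant block indices below `(T + 1) N`. -/
theorem IsRegenerationStructure.one_le_integral (hreg : IsRegenerationStructure μ X τ)
    (htail : HasGeometricTails μ τ) : 1 ≤ ∫ ω, (blockLength τ 1 ω : ℝ) ∂μ := by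
  have hint : Integrable (fun ω => (blockLength τ 1 ω : ℝ)) μ := by
    simpa using htail.integrable_pow hreg.measurable 1 1
  have h : ∫ _ω : Ω, (1 : ℝ) ∂μ ≤ ∫ ω, (blockLength τ 1 ω : ℝ) ∂μ := by
    refine integral_mono_ae (integrable_const _) hint ?_
    filter_upwards [hreg.strictMono] with ω hω
    have : τ 1 ω < τ (1 + 1) ω := hω (by norm_num)
    have h2 : 1 ≤ blockLength τ 1 ω := by
      simp only [blockLength]; omega
    exact_mod_cast h2
  simpa using h

theorem IsRegenerationStructure.ae_norm_blockIncrement_le {μ : Measure Ω}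
    (hreg : IsRegenerationStructure μ X τ)
    {K : ℝ} (hK : ∀ᵐ ω ∂μ, ∀ n, ‖X (n + 1) ω - X n ω‖ ≤ K) (v : EuclideanSpace ℝ (Fin d)) (k : ℕ) :
    ∀ᵐ ω ∂μ, ‖blockIncrement v (block X τ k ω)‖ ≤ (K + ‖v‖) * (blockLength τ k ω : ℝ) := by
  filter_upwards [hreg.strictMono, hK] with ω hω hKω
  have h : τ k ω ≤ τ (k + 1) ω := (hω (Nat.lt_succ_self k)).le
  rw [blockIncrement_block v hω]
  refine (norm_sub_le_of_jumps (x := fun n => centered X v n ω)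
    (fun n => norm_centered_jump_le hKω n) h).trans (le_of_eq ?_)
  simp only [blockLength, Nat.cast_sub h]

/-- Bounded jumps dominate the increment by a multiple of the block length, which has all moments.
-/
theorem IsRegenerationStructure.memLp_blockIncrement (hreg : IsRegenerationStructure μ X τ)
    (hX : ∀ n, Measurable (X n)) (htail : HasGeometricTails μ τ)
    {K : ℝ} (hK : ∀ᵐ ω ∂μ, ∀ n, ‖X (n + 1) ω - X n ω‖ ≤ K) (v : EuclideanSpace ℝ (Fin d)) (k : ℕ) :
    MemLp (fun ω => blockIncrement v (block X τ k ω)) 4 μ := by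
  have hL : MemLp (fun ω => (blockLength τ k ω : ℝ)) 4 μ := by
    have hm : Measurable fun ω => (blockLength τ k ω : ℝ) :=
      (measurable_of_countable fun n : ℕ => (n : ℝ)).comp (measurable_blockLength hreg.measurable k)
    rw [← integrable_norm_rpow_iff hm.aestronglyMeasurable (by norm_num) (by norm_num)]
    refine (htail.integrable_pow hreg.measurable k 4).congr (Eventually.of_forall fun ω => ?_)
    simp only [Real.norm_natCast]
    rw [show (4 : ENNReal).toReal = ((4 : ℕ) : ℝ) by norm_num, Real.rpow_natCast]
  refine (hL.const_mul (K + ‖v‖)).of_le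
    ((measurable_blockIncrement v).comp (measurable_block hX hreg.measurable k)).aestronglyMeasurable
    ?_
  filter_upwards [hreg.ae_norm_blockIncrement_le hK v k] with ω hω
  exact hω.trans (le_abs_self _)

theorem IsRegenerationStructure.iIndepFun_blockIncrement {μ : Measure Ω}
    (hreg : IsRegenerationStructure μ X τ)
    (v : EuclideanSpace ℝ (Fin d)) :
    iIndepFun (fun (i : ℕ) ω => blockIncrement v (block X τ (i + 1) ω)) μ :=
  (hreg.indep.precomp (g := fun i : ℕ => i + 1) (add_left_injective 1)).comp
    (fun _ => blockIncrement v) fun _ => measurable_blockIncrement v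

theorem IsRegenerationStructure.identDistrib_blockIncrement {μ : Measure Ω}
    (hreg : IsRegenerationStructure μ X τ) (v : EuclideanSpace ℝ (Fin d)) (i : ℕ) :
    IdentDistrib (fun ω => blockIncrement v (block X τ (i + 1) ω))
      (fun ω => blockIncrement v (block X τ (0 + 1) ω)) μ μ :=
  (hreg.identDistrib (i + 1) (by omega)).comp (measurable_blockIncrement v)

theorem IsRegenerationStructure.integral_blockIncrement_zero {μ : Measure Ω}
    (hreg : IsRegenerationStructure μ X τ) :
    ∫ ω, blockIncrement 0 (block X τ 1 ω) ∂μ = ∫ ω, (X (τ 2 ω) ω - X (τ 1 ω) ω) ∂μ := by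
  refine integral_congr_ae ?_
  filter_upwards [hreg.strictMono] with ω hω
  rw [blockIncrement_block 0 hω]
  simp [centered]

/-- This is what the definition of the speed achieves: subtracting the length times `v` cancels the
mean displacement of a block. -/
theorem IsRegenerationStructure.integral_blockIncrement_speed
    (hreg : IsRegenerationStructure μ X τ)
    (hX : ∀ n, Measurable (X n)) (htail : HasGeometricTails μ τ)
    {K : ℝ} (hK : ∀ᵐ ω ∂μ, ∀ n, ‖X (n + 1) ω - X n ω‖ ≤ K) :
    ∫ ω, blockIncrement (speed μ X τ) (block X τ 1 ω) ∂μ = 0 := by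
  have hm := hreg.one_le_integral htail
  have hint : Integrable (fun ω => (blockLength τ 1 ω : ℝ)) μ := by
    simpa using htail.integrable_pow hreg.measurable 1 1
  have h1 : ∀ ω, blockIncrement (speed μ X τ) (block X τ 1 ω) =
      blockIncrement 0 (block X τ 1 ω) - (blockLength τ 1 ω : ℝ) • speed μ X τ := fun ω => by
    simp [blockIncrement, block]
  simp_rw [h1]
  rw [integral_sub ((hreg.memLp_blockIncrement hX htail hK 0 1).integrable (by norm_num))
    (hint.smul_const _), integral_smul_const, hreg.integral_blockIncrement_zero, speed, smul_smul,
    mul_inv_cancel₀ (by positivity), one_smul, sub_self]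

/-- The law of large numbers for the renewal times. -/
theorem IsRegenerationStructure.tendsto_time_div (hreg : IsRegenerationStructure μ X τ)
    (htail : HasGeometricTails μ τ) :
    ∀ᵐ ω ∂μ, Tendsto (fun k : ℕ => (k : ℝ)⁻¹ * (τ k ω : ℝ)) atTop
      (𝓝 (∫ ω, (blockLength τ 1 ω : ℝ) ∂μ)) := by
  have hmeas : Measurable fun p : ℕ × (ℕ → EuclideanSpace ℝ (Fin d)) => (p.1 : ℝ) :=
    (measurable_of_countable fun n : ℕ => (n : ℝ)).comp measurable_fst
  have hindep : iIndepFun (fun (i : ℕ) ω => (blockLength τ (i + 1) ω : ℝ)) μ :=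
    (hreg.indep.precomp (g := fun i : ℕ => i + 1) (add_left_injective 1)).comp
      (fun _ p => (p.1 : ℝ)) fun _ => hmeas
  have hident : ∀ i, IdentDistrib (fun ω => (blockLength τ (i + 1) ω : ℝ))
      (fun ω => (blockLength τ (0 + 1) ω : ℝ)) μ μ := fun i =>
    (hreg.identDistrib (i + 1) (by omega)).comp hmeas
  have hint : Integrable (fun ω => (blockLength τ (0 + 1) ω : ℝ)) μ := by
    simpa using htail.integrable_pow hreg.measurable 1 1
  have h := strong_law_ae (fun (i : ℕ) ω => (blockLength τ (i + 1) ω : ℝ)) hint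
    (fun i j hij => hindep.indepFun hij) hident
  filter_upwards [h, hreg.strictMono] with ω hω hmono
  refine tendsto_inv_smul_of_shift (s := fun k => (τ k ω : ℝ)) (hω.congr fun k => ?_)
  congr 1
  have h2 : ∀ i, (blockLength τ (i + 1) ω : ℝ) = (τ (i + 1 + 1) ω : ℝ) - τ (i + 1) ω := fun i => by
    rw [blockLength, Nat.cast_sub (hmono (Nat.lt_succ_self _)).le]
  simp_rw [h2]
  exact Finset.sum_range_sub (fun i => (τ (i + 1) ω : ℝ)) k

/-- The strong law of large numbers for a process with a regeneration structure. -/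
theorem IsRegenerationStructure.tendsto_inv_smul (hreg : IsRegenerationStructure μ X τ)
    (hX : ∀ n, Measurable (X n)) (htail : HasGeometricTails μ τ)
    {K : ℝ} (hK : ∀ᵐ ω ∂μ, ∀ n, ‖X (n + 1) ω - X n ω‖ ≤ K) :
    ∀ᵐ ω ∂μ, Tendsto (fun n : ℕ => (n : ℝ)⁻¹ • X n ω) atTop (𝓝 (speed μ X τ)) := by
  have hm := hreg.one_le_integral htail
  have h := strong_law_ae (fun (i : ℕ) ω => blockIncrement 0 (block X τ (i + 1) ω))
    ((hreg.memLp_blockIncrement hX htail hK 0 (0 + 1)).integrable (by norm_num))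
    (fun i j hij => (hreg.iIndepFun_blockIncrement 0).indepFun hij)
    (hreg.identDistrib_blockIncrement 0)
  rw [zero_add, hreg.integral_blockIncrement_zero] at h
  filter_upwards [h, hreg.strictMono, hreg.zero, hK, hreg.tendsto_time_div htail]
    with ω hω hmono hzero hKω htime
  refine tendsto_inv_smul_of_renewal hKω hmono hzero (by positivity) htime ?_
  refine tendsto_inv_smul_of_shift (s := fun k => X (τ k ω) ω) (hω.congr fun k => ?_)
  rw [sum_blockIncrement 0 hmono]
  simp [centered]

end Regeneration

/-! ### Linear interpolation -/

section LinInterp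

variable {d : ℕ}

theorem linInterp_mem_of_convex {s : Set (EuclideanSpace ℝ (Fin d))} (hs : Convex ℝ s)
    {x : ℕ → EuclideanSpace ℝ (Fin d)} {u : ℝ} (hu : 0 ≤ u) (h0 : x ⌊u⌋₊ ∈ s)
    (h1 : x (⌊u⌋₊ + 1) ∈ s) : linInterp x u ∈ s :=
  hs.add_smul_sub_mem h0 h1
    ⟨sub_nonneg.2 (Nat.floor_le hu), by linarith [Nat.lt_floor_add_one u]⟩

theorem norm_linInterp_sub_le {x : ℕ → EuclideanSpace ℝ (Fin d)} {u : ℝ} (hu : 0 ≤ u)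
    {y : EuclideanSpace ℝ (Fin d)} {B : ℝ} (h0 : ‖x ⌊u⌋₊ - y‖ ≤ B)
    (h1 : ‖x (⌊u⌋₊ + 1) - y‖ ≤ B) : ‖linInterp x u - y‖ ≤ B := by
  have := linInterp_mem_of_convex (convex_closedBall y B) (x := x) hu
    (by rwa [mem_closedBall_iff_norm]) (by rwa [mem_closedBall_iff_norm])
  rwa [mem_closedBall_iff_norm] at this

/-- The modulus of continuity of a linear interpolation. -/
theorem norm_linInterp_sub_linInterp_le {x : ℕ → EuclideanSpace ℝ (Fin d)} {u v B : ℝ}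
    (hu : 0 ≤ u) (huv : u ≤ v)
    (h : ∀ i j : ℕ, i ≤ j → (j : ℝ) ≤ v + 1 → (j : ℝ) ≤ i + (v - u + 2) → ‖x j - x i‖ ≤ B) :
    ‖linInterp x v - linInterp x u‖ ≤ B := by
  have hv := hu.trans huv
  have h1 := Nat.floor_le hu
  have h2 := Nat.floor_le hv
  have h3 := Nat.lt_floor_add_one u
  have h4 : ⌊u⌋₊ ≤ ⌊v⌋₊ := Nat.floor_mono huv
  have h4' : (⌊u⌋₊ : ℝ) ≤ ⌊v⌋₊ := by exact_mod_cast h4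
  -- Interpolated values lie on segments between neighbouring integer times, so four pairs suffice.
  -- Their order can be reversed when `u` and `v` share a cell.
  have key : ∀ i j : ℕ, (i = ⌊u⌋₊ ∨ i = ⌊u⌋₊ + 1) → (j = ⌊v⌋₊ ∨ j = ⌊v⌋₊ + 1) →
      ‖x j - x i‖ ≤ B := by
    intro i j hi hj
    rcases le_total i j with hij | hij
    · refine h i j hij ?_ ?_
      · rcases hj with rfl | rfl <;> push_cast <;> linarith
      · rcases hj with rfl | rfl <;> rcases hi with rfl | rfl <;> push_cast <;> linarith
    · rw [norm_sub_rev]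
      refine h j i hij ?_ ?_
      · rcases hi with rfl | rfl <;> push_cast <;> linarith
      · rcases hj with rfl | rfl <;> rcases hi with rfl | rfl <;> push_cast <;> linarith
  refine norm_linInterp_sub_le hv ?_ ?_ <;> rw [norm_sub_rev]
  · refine norm_linInterp_sub_le hu ?_ ?_ <;> rw [norm_sub_rev] <;> exact key _ _ (by simp) (by simp)
  · refine norm_linInterp_sub_le hu ?_ ?_ <;> rw [norm_sub_rev] <;> exact key _ _ (by simp) (by simp)

theorem linInterp_sub_const (x : ℕ → EuclideanSpace ℝ (Fin d)) (y : EuclideanSpace ℝ (Fin d))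
    (u : ℝ) : linInterp (fun n => x n - y) u = linInterp x u - y := by
  simp only [linInterp, sub_sub_sub_cancel_right]
  abel

theorem measurable_rescaledPath {Ω : Type*} [MeasurableSpace Ω] {T : ℝ} (hT : 0 ≤ T)
    {Z : ℕ → Ω → EuclideanSpace ℝ (Fin d)} (hZ : ∀ n, Measurable (Z n)) (N : ℕ) :
    Measurable fun ω => rescaledPath T N (fun n => Z n ω) := by
  refine measurable_pathSpace_of_eval hT fun t => ?_
  simp only [rescaledPath, linInterp, ContinuousMap.coe_mk]
  have h : Measurable fun ω => Z (⌊(N : ℝ) * t⌋₊ + 1) ω - Z ⌊(N : ℝ) * t⌋₊ ω := (hZ _).sub (hZ _)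
  exact ((hZ _).add (h.const_smul ((N : ℝ) * t - (⌊(N : ℝ) * t⌋₊ : ℝ)))).const_smul (√(N : ℝ))⁻¹

end LinInterp

/-! ### Replacing a process by one close in probability -/

section CharFunComparison

variable {Ω : Type*} [MeasurableSpace Ω] {μ : Measure Ω} [IsProbabilityMeasure μ]

theorem norm_exp_mul_I_sub_le (a b : ℝ) :
    ‖Complex.exp (a * Complex.I) - Complex.exp (b * Complex.I)‖ ≤ |a - b| := by
  have h : Complex.exp (a * Complex.I) - Complex.exp (b * Complex.I) =
      Complex.exp (b * Complex.I) * (Complex.exp (Complex.I * (a - b : ℝ)) - 1) := by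
    rw [mul_sub, ← Complex.exp_add]; push_cast; ring_nf
  rw [h, norm_mul, Complex.norm_exp_ofReal_mul_I, one_mul]
  exact Real.norm_exp_I_mul_ofReal_sub_one_le

/-- Slutsky's argument: `x ↦ exp (i x)` is 1-Lipschitz and of modulus one, so the integrands differ
by at most `ε / 4` where `A` and `B` are close and by at most `2` elsewhere. -/
theorem tendsto_integral_exp_of_sub {A B : ℕ → Ω → ℝ} (hA : ∀ N, Measurable (A N))
    (hB : ∀ N, Measurable (B N))
    (h : ∀ ε > 0, ∀ η > 0, ∀ᶠ N in atTop, μ.real {ω | ε < |A N ω - B N ω|} ≤ η) {c : ℂ}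
    (hc : Tendsto (fun N => ∫ ω, Complex.exp ((B N ω : ℝ) * Complex.I) ∂μ) atTop (𝓝 c)) :
    Tendsto (fun N => ∫ ω, Complex.exp ((A N ω : ℝ) * Complex.I) ∂μ) atTop (𝓝 c) := by
  have hint : ∀ {F : Ω → ℝ}, Measurable F →
      Integrable (fun ω => Complex.exp ((F ω : ℝ) * Complex.I)) μ := by
    intro F hF
    refine (integrable_const (1 : ℝ)).mono' (by fun_prop) (Eventually.of_forall fun ω => ?_)
    rw [Complex.norm_exp_ofReal_mul_I]
  have hdiff : Tendsto (fun N => ∫ ω, Complex.exp ((A N ω : ℝ) * Complex.I) ∂μ -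
      ∫ ω, Complex.exp ((B N ω : ℝ) * Complex.I) ∂μ) atTop (𝓝 0) := by
    rw [Metric.tendsto_nhds]
    intro ε hε
    filter_upwards [h (ε / 4) (by positivity) (ε / 4) (by positivity)] with N hN
    rw [dist_zero_right, ← integral_sub (hint (hA N)) (hint (hB N))]
    set D := {ω | ε / 4 < |A N ω - B N ω|} with hD
    have hDm : MeasurableSet D :=
      measurableSet_lt measurable_const (((hA N).sub (hB N)).norm)
    have hbound : ∀ ω, ‖Complex.exp ((A N ω : ℝ) * Complex.I) -
        Complex.exp ((B N ω : ℝ) * Complex.I)‖ ≤ ε / 4 + D.indicator (fun _ => (2 : ℝ)) ω := by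
      intro ω
      by_cases hω : ω ∈ D
      · rw [Set.indicator_of_mem hω]
        refine (norm_sub_le _ _).trans ?_
        rw [Complex.norm_exp_ofReal_mul_I, Complex.norm_exp_ofReal_mul_I]
        linarith
      · rw [Set.indicator_of_notMem hω, add_zero]
        exact (norm_exp_mul_I_sub_le _ _).trans (not_lt.1 hω)
    have hi : Integrable (fun ω => ε / 4 + D.indicator (fun _ => (2 : ℝ)) ω) μ :=
      (integrable_const _).add ((integrable_const _).indicator hDm)
    refine (norm_integral_le_of_norm_le hi (Eventually.of_forall hbound)).trans_lt ?_
    rw [integral_add (integrable_const _) ((integrable_const _).indicator hDm),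
      integral_indicator_const _ hDm]
    simp only [integral_const, probReal_univ, smul_eq_mul, one_mul]
    linarith
  have := hdiff.add hc
  simpa using this

end CharFunComparison

/-! ### The invariance principle under regeneration -/

section Invariance

variable {d : ℕ} {Ω : Type*} [MeasurableSpace Ω] {μ : Measure Ω} [IsProbabilityMeasure μ]
  {X : ℕ → Ω → EuclideanSpace ℝ (Fin d)} {τ : ℕ → Ω → ℕ}

/-- Blocks are negligible on the diffusive scale. -/
theorem IsRegenerationStructure.eventually_measureReal_blockLength_gt_le
    (hreg : IsRegenerationStructure μ X τ) (htail : HasGeometricTails μ τ) {A ε η : ℝ}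
    (hA : 0 ≤ A) (hε : 0 < ε) (hη : 0 < η) :
    ∀ᶠ N : ℕ in atTop,
      μ.real {ω | ∃ k : ℕ, (k : ℝ) ≤ A * N ∧ ε * √N < (blockLength τ k ω : ℝ)} ≤ η := by
  -- Block `0` has its own law, so the sum of two fourth moments bounds them all. Markov's
  -- inequality at level `ε √N` then makes the union bound of order `N · N⁻²`.
  set B : ℝ := ∫ ω, (blockLength τ 0 ω : ℝ) ^ 4 ∂μ + ∫ ω, (blockLength τ 1 ω : ℝ) ^ 4 ∂μ
  have hB0 : 0 ≤ ∫ ω, (blockLength τ 0 ω : ℝ) ^ 4 ∂μ := integral_nonneg fun ω => by positivity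
  have hB1 : 0 ≤ ∫ ω, (blockLength τ 1 ω : ℝ) ^ 4 ∂μ := integral_nonneg fun ω => by positivity
  have hB : ∀ k, ∫ ω, (blockLength τ k ω : ℝ) ^ 4 ∂μ ≤ B := by
    intro k
    rcases Nat.eq_zero_or_pos k with rfl | hk
    · linarith
    · have hm : Measurable fun p : ℕ × (ℕ → EuclideanSpace ℝ (Fin d)) => (p.1 : ℝ) ^ 4 :=
        (measurable_of_countable fun n : ℕ => (n : ℝ) ^ 4).comp measurable_fst
      have := ((hreg.identDistrib k hk).comp hm).integral_eq
      simp only [Function.comp_def, block] at this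
      linarith
  have hmarkov : ∀ (k : ℕ) (l : ℝ), 0 < l →
      μ.real {ω | l < (blockLength τ k ω : ℝ)} ≤ B / l ^ 4 := by
    intro k l hl
    have h1 := mul_meas_ge_le_integral_of_nonneg (μ := μ)
      (f := fun ω => (blockLength τ k ω : ℝ) ^ 4) (Eventually.of_forall fun ω => by positivity)
      (htail.integrable_pow hreg.measurable k 4) (l ^ 4)
    rw [le_div_iff₀ (by positivity), mul_comm]
    refine le_trans ?_ (h1.trans (hB k))
    refine mul_le_mul_of_nonneg_left (measureReal_mono fun ω hω => ?_) (by positivity)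
    exact pow_le_pow_left₀ hl.le (le_of_lt hω) 4
  have hlim : Tendsto (fun N : ℕ => B * (A + 1) / ε ^ 4 * (N : ℝ)⁻¹) atTop (𝓝 0) := by
    have := (tendsto_inv_atTop_zero.comp (tendsto_natCast_atTop_atTop (R := ℝ))).const_mul
      (B * (A + 1) / ε ^ 4)
    simpa using this
  filter_upwards [hlim.eventually_le_const hη, eventually_gt_atTop 0] with N hN hN0
  have hN1 : (1 : ℝ) ≤ N := by exact_mod_cast hN0
  have hN0' : (0 : ℝ) < N := by linarith
  have hsub : {ω | ∃ k : ℕ, (k : ℝ) ≤ A * N ∧ ε * √N < (blockLength τ k ω : ℝ)} ⊆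
      ⋃ k ∈ Finset.range (⌊A * N⌋₊ + 1), {ω | ε * √N < (blockLength τ k ω : ℝ)} := by
    rintro ω ⟨k, hk, hω⟩
    simp only [Set.mem_iUnion]
    exact ⟨k, Finset.mem_range.2 (Nat.lt_succ_of_le (Nat.le_floor hk)), hω⟩
  have hsq : √(N : ℝ) ^ 4 = (N : ℝ) ^ 2 := by
    rw [show (4 : ℕ) = 2 * 2 by norm_num, pow_mul, Real.sq_sqrt hN0'.le]
  calc _ ≤ _ := measureReal_mono hsub (measure_ne_top _ _)
    _ ≤ ∑ k ∈ Finset.range (⌊A * N⌋₊ + 1), μ.real {ω | ε * √N < (blockLength τ k ω : ℝ)} :=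
      measureReal_biUnion_finset_le _ _
    _ ≤ ∑ k ∈ Finset.range (⌊A * N⌋₊ + 1), B / (ε * √N) ^ 4 :=
      Finset.sum_le_sum fun k _ => hmarkov k _ (by positivity)
    _ ≤ (A * N + N) * (B / (ε * √N) ^ 4) := by
      rw [Finset.sum_const, Finset.card_range, nsmul_eq_mul]
      push_cast
      gcongr
      exact Nat.floor_le (by positivity)
    _ = B * (A + 1) / ε ^ 4 * (N : ℝ)⁻¹ := by
      rw [mul_pow, hsq]; field_simp
    _ ≤ η := hN

theorem measurable_renewalCount (hτ : ∀ k, Measurable (τ k)) (n : ℕ) :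
    Measurable fun ω => renewalCount (fun k => τ k ω) n :=
  measurable_findGreatest fun k _ => measurableSet_le (hτ k) measurable_const

/-- The number of renewals up to time `N t` is asymptotic to `N t / E[τ_2 - τ_1]`. -/
theorem IsRegenerationStructure.eventually_measureReal_renewalCount_gt_le
    (hreg : IsRegenerationStructure μ X τ) (htail : HasGeometricTails μ τ) {t : ℝ} (ht : 0 ≤ t)
    {δ η : ℝ} (hδ : 0 < δ) (hη : 0 < η) :
    ∀ᶠ N : ℕ in atTop, μ.real {ω | δ * N < |(renewalCount (fun k => τ k ω) ⌊N * t⌋₊ : ℝ) -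
      (∫ ω, (blockLength τ 1 ω : ℝ) ∂μ)⁻¹ * (N * t)|} ≤ η := by
  set m := ∫ ω, (blockLength τ 1 ω : ℝ) ∂μ
  have hm : 1 ≤ m := hreg.one_le_integral htail
  have hae : ∀ᵐ ω ∂μ, Tendsto (fun N : ℕ => (N : ℝ)⁻¹ *
      (renewalCount (fun k => τ k ω) ⌊N * t⌋₊ : ℝ)) atTop (𝓝 (t * m⁻¹)) := by
    filter_upwards [hreg.strictMono, hreg.zero, hreg.tendsto_time_div htail] with ω h1 h2 h3
    rcases ht.eq_or_lt with rfl | ht'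
    · simp [renewalCount]
    · have h4 := tendsto_renewalCount_div h1 h2 (by positivity : 0 < m) h3
      have hfl : Tendsto (fun N : ℕ => ⌊(N : ℝ) * t⌋₊) atTop atTop :=
        tendsto_nat_floor_atTop.comp (tendsto_natCast_atTop_atTop.atTop_mul_const ht')
      have h5 : Tendsto (fun N : ℕ => (⌊t * (N : ℝ)⌋₊ : ℝ) / N) atTop (𝓝 t) :=
        (tendsto_nat_floor_mul_div_atTop ht).comp tendsto_natCast_atTop_atTop
      refine (h5.mul (h4.comp hfl)).congr' ?_
      filter_upwards [hfl.eventually_gt_atTop 0] with N hN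
      have hN' : (⌊(N : ℝ) * t⌋₊ : ℝ) ≠ 0 := by exact_mod_cast hN.ne'
      simp only [Function.comp_apply]
      rw [mul_comm t]
      field_simp
  have hmeas : TendstoInMeasure μ (fun (N : ℕ) ω => (N : ℝ)⁻¹ *
      (renewalCount (fun k => τ k ω) ⌊N * t⌋₊ : ℝ)) atTop (fun _ => t * m⁻¹) := by
    refine tendstoInMeasure_of_tendsto_ae (fun N => ?_) hae
    exact (((measurable_of_countable fun n : ℕ => (n : ℝ)).comp
      (measurable_renewalCount hreg.measurable _)).const_mul _).aestronglyMeasurable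
  rw [tendstoInMeasure_iff_measureReal_dist] at hmeas
  filter_upwards [(hmeas δ hδ).eventually_le_const hη, eventually_gt_atTop 0] with N hN hN0
  have hN0' : (0 : ℝ) < N := by exact_mod_cast hN0
  refine (measureReal_mono fun ω hω => ?_).trans hN
  simp only [Set.mem_ofPred_eq, Real.dist_eq] at hω ⊢
  have : (N : ℝ)⁻¹ * (renewalCount (fun k => τ k ω) ⌊N * t⌋₊ : ℝ) - t * m⁻¹ =
      (N : ℝ)⁻¹ * ((renewalCount (fun k => τ k ω) ⌊N * t⌋₊ : ℝ) - m⁻¹ * (N * t)) := by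
    field_simp
  rw [this, abs_mul, abs_of_pos (inv_pos.2 hN0'), inv_mul_eq_div, le_div_iff₀ hN0']
  exact hω.le

/-- The centered process is close to the sum of the block increments. -/
theorem norm_centered_sub_sum_blockIncrement_le {Ω : Type*}
    {X : ℕ → Ω → EuclideanSpace ℝ (Fin d)} {τ : ℕ → Ω → ℕ} {v : EuclideanSpace ℝ (Fin d)} {K : ℝ}
    (hK0 : 0 ≤ K) {ω : Ω} (hω : StrictMono fun k => τ k ω) (h0 : τ 0 ω = 0)
    (hK : ∀ n, ‖X (n + 1) ω - X n ω‖ ≤ K) (n : ℕ) {l : ℝ}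
    (hl : ∀ k ≤ n, (blockLength τ k ω : ℝ) ≤ l) :
    ‖centered X v n ω - centered X v 0 ω -
      ∑ i ∈ Finset.range (renewalCount (fun k => τ k ω) n),
        blockIncrement v (block X τ (i + 1) ω)‖ ≤ 2 * (K + ‖v‖) * l := by
  rw [sum_blockIncrement v hω]
  refine norm_sub_sub_renewal_le (x := fun n => centered X v n ω) (τ := fun k => τ k ω)
    (by positivity) (fun n => norm_centered_jump_le hK n) hω h0 n fun k hk => ?_
  have := hl k hk
  rwa [blockLength, Nat.cast_sub (hω (Nat.lt_succ_self k)).le] at this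

/-- At integer times the process is a sum of block increments up to boundary terms of the size of a
block, and between times `i ≤ j` there are at most `j - i` renewals. So the modulus of the i.i.d.
sums controls that of the path. -/
theorem IsRegenerationStructure.exists_eventually_modulus_le
    (hreg : IsRegenerationStructure μ X τ) (hX : ∀ n, Measurable (X n))
    (htail : HasGeometricTails μ τ) {K : ℝ} (hK0 : 0 ≤ K)
    (hK : ∀ᵐ ω ∂μ, ∀ n, ‖X (n + 1) ω - X n ω‖ ≤ K)
    {T : ℝ} (hT : 0 ≤ T) {ε η : ℝ} (hε : 0 < ε) (hη : 0 < η) :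
    ∃ δ > 0, ∀ᶠ N : ℕ in atTop, μ.real {ω | ∃ s t, dist s t ≤ δ ∧
      ε < dist (rescaledPath T N (fun n => centered X (speed μ X τ) n ω -
          centered X (speed μ X τ) 0 ω) s)
        (rescaledPath T N (fun n => centered X (speed μ X τ) n ω -
          centered X (speed μ X τ) 0 ω) t)} ≤ η := by
  set v := speed μ X τ with hv
  -- Each endpoint costs `2 (K + ‖v‖) l √N`, the two together at most `ε √N / 4`; the i.i.d. sum
  -- costs another `ε √N / 4`.
  set l := ε / (16 * (K + ‖v‖ + 1)) with hl
  have hlpos : 0 < l := by positivity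
  have hlε : 4 * (K + ‖v‖) * l ≤ ε / 4 := by
    rw [hl, mul_div_assoc', div_le_div_iff₀ (by positivity) (by norm_num)]
    nlinarith [norm_nonneg v]
  have hYm : ∀ i : ℕ, Measurable fun ω => blockIncrement v (block X τ (i + 1) ω) := fun i =>
    (measurable_blockIncrement v).comp (measurable_block hX hreg.measurable _)
  obtain ⟨δ, hδ, hmod⟩ := eventually_measureReal_modulus_sum_gt_le hYm
    (hreg.iIndepFun_blockIncrement v) (hreg.identDistrib_blockIncrement v)
    (hreg.memLp_blockIncrement hX htail hK v 1) (hreg.integral_blockIncrement_speed hX htail hK)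
    (A := T + 1) (ε := ε / 4) (η := η / 2) (by positivity) (by positivity) (by positivity)
  have hblk := hreg.eventually_measureReal_blockLength_gt_le htail (A := T + 1) (ε := l)
    (η := η / 2) (by positivity) hlpos (by positivity)
  -- This absorbs the two units that interpolation adds to the distance of the indices.
  have hlarge : ∀ᶠ N : ℕ in atTop, 2 ≤ δ / 2 * N :=
    (tendsto_natCast_atTop_atTop.const_mul_atTop (by positivity)).eventually_ge_atTop 2
  refine ⟨δ / 2, by positivity, ?_⟩
  filter_upwards [hmod, hblk, hlarge, eventually_gt_atTop 0] with N hN1 hN2 hN3 hN0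
  have hN0' : (1 : ℝ) ≤ N := by exact_mod_cast hN0
  have hsqrt : 0 < √(N : ℝ) := Real.sqrt_pos.2 (by linarith)
  set B₁ := {ω | ∃ a b : ℕ, a ≤ b ∧ (b : ℝ) ≤ (T + 1) * N ∧ (b : ℝ) ≤ a + δ * N ∧
      ε / 4 * √N < ‖∑ i ∈ Finset.range b, blockIncrement v (block X τ (i + 1) ω) -
        ∑ i ∈ Finset.range a, blockIncrement v (block X τ (i + 1) ω)‖}
  set B₂ := {ω | ∃ k : ℕ, (k : ℝ) ≤ (T + 1) * N ∧ l * √N < (blockLength τ k ω : ℝ)}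
  set B := {ω | ∃ s t, dist s t ≤ δ / 2 ∧
      ε < dist (rescaledPath T N (fun n => centered X v n ω - centered X v 0 ω) s)
        (rescaledPath T N (fun n => centered X v n ω - centered X v 0 ω) t)}
  have hsub : B ≤ᵐ[μ] (B₁ ∪ B₂ : Set Ω) := by
    filter_upwards [hreg.strictMono, hreg.zero, hK] with ω hmono hzero hKω hωB
    by_contra hcon
    obtain ⟨hc1, hc2⟩ := not_or.1 hcon
    replace hc1 : ∀ a b : ℕ, a ≤ b → (b : ℝ) ≤ (T + 1) * N → (b : ℝ) ≤ a + δ * N →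
      ‖∑ i ∈ Finset.range b, blockIncrement v (block X τ (i + 1) ω) -
        ∑ i ∈ Finset.range a, blockIncrement v (block X τ (i + 1) ω)‖ ≤ ε / 4 * √N := by
      intro a b h1 h2 h3
      by_contra h4
      exact hc1 ⟨a, b, h1, h2, h3, not_le.1 h4⟩
    replace hc2 : ∀ k : ℕ, (k : ℝ) ≤ (T + 1) * N → (blockLength τ k ω : ℝ) ≤ l * √N := by
      intro k h1
      by_contra h4
      exact hc2 ⟨k, h1, not_le.1 h4⟩
    have key : ∀ s t : Set.Icc (0 : ℝ) T, s ≤ t → dist s t ≤ δ / 2 →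
        dist (rescaledPath T N (fun n => centered X v n ω - centered X v 0 ω) s)
          (rescaledPath T N (fun n => centered X v n ω - centered X v 0 ω) t) ≤ ε := by
      intro s t hst hdist
      have hst' : (s : ℝ) ≤ t := hst
      have hd : (t : ℝ) - s ≤ δ / 2 := by
        rw [dist_comm, Subtype.dist_eq, Real.dist_eq, abs_of_nonneg (by linarith)] at hdist
        exact hdist
      have hlin := norm_linInterp_sub_linInterp_le
        (x := fun n => centered X v n ω - centered X v 0 ω) (u := N * s) (v := N * t)
        (B := ε / 2 * √N) (mul_nonneg (by positivity) s.2.1)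
        (mul_le_mul_of_nonneg_left hst' (by positivity)) (by
          intro i j hij hj hij2
          have hjT : (j : ℝ) ≤ (T + 1) * N := by
            have := mul_le_mul_of_nonneg_left t.2.2 (by positivity : (0 : ℝ) ≤ N)
            linarith
          have hij' : (i : ℝ) ≤ j := by exact_mod_cast hij
          have hjδ : (j : ℝ) ≤ i + δ * N := by
            have := mul_le_mul_of_nonneg_left hd (by positivity : (0 : ℝ) ≤ N)
            nlinarith
          have hbj := norm_centered_sub_sum_blockIncrement_le (v := v) hK0 hmono hzero hKω j
            (l := l * √N) fun k hk => hc2 k (le_trans (by exact_mod_cast hk) hjT)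
          have hbi := norm_centered_sub_sum_blockIncrement_le (v := v) hK0 hmono hzero hKω i
            (l := l * √N) fun k hk => hc2 k (le_trans (by exact_mod_cast hk.trans hij) hjT)
          have hκ := renewalCount_le_add hmono hzero hij
          have hS := hc1 _ _ (renewalCount_mono hmono hzero hij)
            (le_trans (by exact_mod_cast renewalCount_le j) hjT) (by
              have : (renewalCount (fun k => τ k ω) j : ℝ) ≤
                  renewalCount (fun k => τ k ω) i + ((j : ℝ) - i) := by
                rw [← Nat.cast_sub hij]; exact_mod_cast hκ
              linarith)
          set Sj := ∑ i ∈ Finset.range (renewalCount (fun k => τ k ω) j),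
            blockIncrement v (block X τ (i + 1) ω)
          set Si := ∑ k ∈ Finset.range (renewalCount (fun k => τ k ω) i),
            blockIncrement v (block X τ (k + 1) ω)
          set xj := centered X v j ω - centered X v 0 ω
          set xi := centered X v i ω - centered X v 0 ω
          have h1 : xj - xi = (xj - Sj) - (xi - Si) + (Sj - Si) := by abel
          rw [h1]
          refine (norm_add_le _ _).trans ((add_le_add (norm_sub_le _ _) le_rfl).trans ?_)
          have h2 := mul_le_mul_of_nonneg_right hlε hsqrt.le
          nlinarith)
      rw [dist_comm, dist_eq_norm]
      simp only [rescaledPath, ContinuousMap.coe_mk]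
      rw [← smul_sub, norm_smul, norm_inv, Real.norm_of_nonneg hsqrt.le, inv_mul_le_iff₀ hsqrt]
      nlinarith
    obtain ⟨s, t, hst, hgt⟩ := hωB
    rcases le_total s t with h | h
    · exact absurd (key s t h hst) (not_le.2 hgt)
    · rw [dist_comm] at hst hgt
      exact absurd (key t s h hst) (not_le.2 hgt)
  calc μ.real B ≤ μ.real (B₁ ∪ B₂) :=
        ENNReal.toReal_mono (measure_ne_top _ _) (measure_mono_ae hsub)
    _ ≤ μ.real B₁ + μ.real B₂ := measureReal_union_le _ _
    _ ≤ η := by linarith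

/-- The random number of renewals up to time `N t` is replaced by a deterministic one. The two
differ by `o(N)` in probability, and by the modulus of the i.i.d. sums this changes the sum by
`o(√N)` only. -/
theorem IsRegenerationStructure.eventually_rescaledPath_sub_le
    (hreg : IsRegenerationStructure μ X τ) (hX : ∀ n, Measurable (X n))
    (htail : HasGeometricTails μ τ) {K : ℝ} (hK0 : 0 ≤ K)
    (hK : ∀ᵐ ω ∂μ, ∀ n, ‖X (n + 1) ω - X n ω‖ ≤ K)
    {T : ℝ} (hT : 0 ≤ T) (t : Set.Icc (0 : ℝ) T) {ε η : ℝ} (hε : 0 < ε) (hη : 0 < η) :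
    ∀ᶠ N : ℕ in atTop, μ.real {ω | ε < ‖rescaledPath T N (fun n =>
      centered X (speed μ X τ) n ω - centered X (speed μ X τ) 0 ω) t - (√N)⁻¹ •
        ∑ i ∈ Finset.range ⌊(∫ ω, (blockLength τ 1 ω : ℝ) ∂μ)⁻¹ * (N * t)⌋₊,
          blockIncrement (speed μ X τ) (block X τ (i + 1) ω)‖} ≤ η := by
  set v := speed μ X τ with hv
  set m := ∫ ω, (blockLength τ 1 ω : ℝ) ∂μ
  have hm : 1 ≤ m := hreg.one_le_integral htail
  have hm1 : m⁻¹ ≤ 1 := inv_le_one_of_one_le₀ hm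
  have hm0 : 0 < m⁻¹ := by positivity
  set l := ε / (16 * (K + ‖v‖ + 1)) with hl
  have hlpos : 0 < l := by positivity
  have hlε : 4 * (K + ‖v‖) * l ≤ ε / 4 := by
    rw [hl, mul_div_assoc', div_le_div_iff₀ (by positivity) (by norm_num)]
    nlinarith [norm_nonneg v]
  have hYm : ∀ i : ℕ, Measurable fun ω => blockIncrement v (block X τ (i + 1) ω) := fun i =>
    (measurable_blockIncrement v).comp (measurable_block hX hreg.measurable _)
  obtain ⟨δ, hδ, hmod⟩ := eventually_measureReal_modulus_sum_gt_le hYm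
    (hreg.iIndepFun_blockIncrement v) (hreg.identDistrib_blockIncrement v)
    (hreg.memLp_blockIncrement hX htail hK v 1) (hreg.integral_blockIncrement_speed hX htail hK)
    (A := T + 1) (ε := ε / 4) (η := η / 3) (by positivity) (by positivity) (by positivity)
  have hblk := hreg.eventually_measureReal_blockLength_gt_le htail (A := T + 1) (ε := l)
    (η := η / 3) (by positivity) hlpos (by positivity)
  have hren := hreg.eventually_measureReal_renewalCount_gt_le htail t.2.1 (δ := δ / 2)
    (η := η / 3) (by positivity) (by positivity)
  have hlarge : ∀ᶠ N : ℕ in atTop, 2 ≤ δ / 2 * N :=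
    (tendsto_natCast_atTop_atTop.const_mul_atTop (by positivity)).eventually_ge_atTop 2
  filter_upwards [hmod, hblk, hren, hlarge, eventually_gt_atTop 0] with N hN1 hN2 hN4 hN3 hN0
  have hN0' : (1 : ℝ) ≤ N := by exact_mod_cast hN0
  have hsqrt : 0 < √(N : ℝ) := Real.sqrt_pos.2 (by linarith)
  set B₁ := {ω | ∃ a b : ℕ, a ≤ b ∧ (b : ℝ) ≤ (T + 1) * N ∧ (b : ℝ) ≤ a + δ * N ∧
      ε / 4 * √N < ‖∑ i ∈ Finset.range b, blockIncrement v (block X τ (i + 1) ω) -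
        ∑ i ∈ Finset.range a, blockIncrement v (block X τ (i + 1) ω)‖}
  set B₂ := {ω | ∃ k : ℕ, (k : ℝ) ≤ (T + 1) * N ∧ l * √N < (blockLength τ k ω : ℝ)}
  set B₃ := {ω | δ / 2 * N < |(renewalCount (fun k => τ k ω) ⌊N * (t : ℝ)⌋₊ : ℝ) -
      m⁻¹ * (N * t)|}
  set q := ⌊m⁻¹ * (N * (t : ℝ))⌋₊ with hq
  set B := {ω | ε < ‖rescaledPath T N (fun n => centered X v n ω - centered X v 0 ω) t -
    (√N)⁻¹ • ∑ i ∈ Finset.range q, blockIncrement v (block X τ (i + 1) ω)‖}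
  have hNt0 : 0 ≤ (N : ℝ) * t := mul_nonneg (by positivity) t.2.1
  have hNtT : (N : ℝ) * t ≤ N * T := mul_le_mul_of_nonneg_left t.2.2 (by positivity)
  have hq1 : (q : ℝ) ≤ m⁻¹ * (N * t) := Nat.floor_le (by positivity)
  have hq2 : m⁻¹ * (N * t) < q + 1 := Nat.lt_floor_add_one _
  have hq3 : (q : ℝ) ≤ (T + 1) * N := by nlinarith
  have hsub : B ≤ᵐ[μ] (B₁ ∪ (B₂ ∪ B₃) : Set Ω) := by
    filter_upwards [hreg.strictMono, hreg.zero, hK] with ω hmono hzero hKω hωB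
    by_contra hcon
    obtain ⟨hc1, hc23⟩ := not_or.1 hcon
    obtain ⟨hc2, hc3⟩ := not_or.1 hc23
    replace hc1 : ∀ a b : ℕ, a ≤ b → (b : ℝ) ≤ (T + 1) * N → (b : ℝ) ≤ a + δ * N →
      ‖∑ i ∈ Finset.range b, blockIncrement v (block X τ (i + 1) ω) -
        ∑ i ∈ Finset.range a, blockIncrement v (block X τ (i + 1) ω)‖ ≤ ε / 4 * √N := by
      intro a b h1 h2 h3
      by_contra h4
      exact hc1 ⟨a, b, h1, h2, h3, not_le.1 h4⟩
    replace hc2 : ∀ k : ℕ, (k : ℝ) ≤ (T + 1) * N → (blockLength τ k ω : ℝ) ≤ l * √N := by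
      intro k h1
      by_contra h4
      exact hc2 ⟨k, h1, not_le.1 h4⟩
    replace hc3 : |(renewalCount (fun k => τ k ω) ⌊N * (t : ℝ)⌋₊ : ℝ) - m⁻¹ * (N * t)| ≤
      δ / 2 * N := not_lt.1 hc3
    rw [abs_le] at hc3
    set n := ⌊N * (t : ℝ)⌋₊ with hn
    have hnle : (n : ℝ) ≤ N * t := Nat.floor_le hNt0
    have key : ∀ i : ℕ, (i = n ∨ i = n + 1) →
        ‖(centered X v i ω - centered X v 0 ω) -
          ∑ i ∈ Finset.range q, blockIncrement v (block X τ (i + 1) ω)‖ ≤ ε / 2 * √N := by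
      intro i hi
      have hiT : (i : ℝ) ≤ (T + 1) * N := by
        rcases hi with rfl | rfl <;> push_cast <;> nlinarith
      have hni : n ≤ i := by omega
      have hbi := norm_centered_sub_sum_blockIncrement_le (v := v) hK0 hmono hzero hKω i
        (l := l * √N) fun k hk => hc2 k (le_trans (by exact_mod_cast hk) hiT)
      have hκ1 : (renewalCount (fun k => τ k ω) n : ℝ) ≤ renewalCount (fun k => τ k ω) i := by
        exact_mod_cast renewalCount_mono hmono hzero hni
      have hκ2 : (renewalCount (fun k => τ k ω) i : ℝ) ≤ renewalCount (fun k => τ k ω) n + 1 := by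
        have := renewalCount_le_add hmono hzero hni
        have h1 : renewalCount (fun k => τ k ω) i ≤ renewalCount (fun k => τ k ω) n + 1 := by omega
        exact_mod_cast h1
      have hκi : (renewalCount (fun k => τ k ω) i : ℝ) ≤ (T + 1) * N :=
        le_trans (by exact_mod_cast renewalCount_le i) hiT
      have hS : ‖∑ j ∈ Finset.range (renewalCount (fun k => τ k ω) i),
          blockIncrement v (block X τ (j + 1) ω) -
          ∑ i ∈ Finset.range q, blockIncrement v (block X τ (i + 1) ω)‖ ≤ ε / 4 * √N := by
        rcases le_total (renewalCount (fun k => τ k ω) i) q with h | h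
        · rw [norm_sub_rev]
          exact hc1 _ _ h hq3 (by linarith [hc3.1])
        · exact hc1 _ _ h hκi (by linarith [hc3.2])
      set Si := ∑ k ∈ Finset.range (renewalCount (fun k => τ k ω) i),
        blockIncrement v (block X τ (k + 1) ω)
      set Sq := ∑ i ∈ Finset.range q, blockIncrement v (block X τ (i + 1) ω)
      set xi := centered X v i ω - centered X v 0 ω
      have h1 : xi - Sq = (xi - Si) + (Si - Sq) := by abel
      rw [h1]
      refine (norm_add_le _ _).trans ?_
      have h2 := mul_le_mul_of_nonneg_right hlε hsqrt.le
      have h3 : 0 ≤ (K + ‖v‖) * (l * √N) := by positivity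
      nlinarith
    have hlin := norm_linInterp_sub_le
      (x := fun n => centered X v n ω - centered X v 0 ω) hNt0 (key n (Or.inl rfl))
      (key (n + 1) (Or.inr rfl))
    refine absurd hωB (not_lt.2 ?_)
    simp only [rescaledPath, ContinuousMap.coe_mk]
    rw [← smul_sub, norm_smul, norm_inv, Real.norm_of_nonneg hsqrt.le, inv_mul_le_iff₀ hsqrt]
    nlinarith
  calc μ.real B ≤ μ.real (B₁ ∪ (B₂ ∪ B₃)) :=
        ENNReal.toReal_mono (measure_ne_top _ _) (measure_mono_ae hsub)
    _ ≤ μ.real B₁ + (μ.real B₂ + μ.real B₃) :=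
      (measureReal_union_le _ _).trans (by gcongr; exact measureReal_union_le _ _)
    _ ≤ η := by linarith

theorem IsRegenerationStructure.blockCovariance_apply {μ : Measure Ω}
    (hreg : IsRegenerationStructure μ X τ)
    (v : EuclideanSpace ℝ (Fin d)) (i j : Fin d) :
    blockCovariance μ (centered X v) τ i j = (∫ ω, (blockLength τ 1 ω : ℝ) ∂μ)⁻¹ *
      ∫ ω, blockIncrement v (block X τ 1 ω) i * blockIncrement v (block X τ 1 ω) j ∂μ := by
  simp only [blockCovariance, Matrix.of_apply]
  rw [div_eq_inv_mul]
  congr 1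
  refine integral_congr_ae ?_
  filter_upwards [hreg.strictMono] with ω hω
  rw [blockIncrement_block v hω]

/-- The quadratic form of the covariance matrix. -/
theorem IsRegenerationStructure.dotProduct_blockCovariance
    (hreg : IsRegenerationStructure μ X τ) (hX : ∀ n, Measurable (X n))
    (htail : HasGeometricTails μ τ) {K : ℝ}
    (hK : ∀ᵐ ω ∂μ, ∀ n, ‖X (n + 1) ω - X n ω‖ ≤ K) (v u : EuclideanSpace ℝ (Fin d)) :
    u.ofLp ⬝ᵥ (blockCovariance μ (centered X v) τ).mulVec u.ofLp =
      (∫ ω, (blockLength τ 1 ω : ℝ) ∂μ)⁻¹ *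
        ∫ ω, inner ℝ (blockIncrement v (block X τ 1 ω)) u ^ 2 ∂μ := by
  set Y := fun ω => blockIncrement v (block X τ 1 ω) with hY
  have hYL : MemLp Y 4 μ := hreg.memLp_blockIncrement hX htail hK v 1
  have hY2 : ∀ i, MemLp (fun ω => Y ω i) 2 μ := fun i =>
    (hYL.coord i).mono_exponent (by norm_num)
  have hint : ∀ i j, Integrable (fun ω => Y ω i * Y ω j) μ := fun i j =>
    (hY2 i).integrable_mul (hY2 j)
  have hsq : ∀ ω, inner ℝ (Y ω) u ^ 2 = ∑ i, ∑ j, u i * u j * (Y ω i * Y ω j) := by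
    intro ω
    rw [PiLp.inner_apply, sq, Finset.sum_mul_sum]
    refine Finset.sum_congr rfl fun i _ => Finset.sum_congr rfl fun j _ => ?_
    simp only [RCLike.inner_apply, conj_trivial]
    ring
  change _ = _ * ∫ ω, inner ℝ (Y ω) u ^ 2 ∂μ
  simp_rw [hsq]
  rw [integral_finsetSum _ fun i _ => integrable_finsetSum _ fun j _ => (hint i j).const_mul _,
    Finset.mul_sum]
  simp only [dotProduct, Matrix.mulVec, Finset.mul_sum]
  refine Finset.sum_congr rfl fun i _ => ?_
  rw [integral_finsetSum _ fun j _ => (hint i j).const_mul _, Finset.mul_sum]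
  refine Finset.sum_congr rfl fun j _ => ?_
  rw [hreg.blockCovariance_apply, integral_const_mul]
  ring

theorem IsRegenerationStructure.posSemidef_blockCovariance
    (hreg : IsRegenerationStructure μ X τ) (hX : ∀ n, Measurable (X n))
    (htail : HasGeometricTails μ τ) {K : ℝ}
    (hK : ∀ᵐ ω ∂μ, ∀ n, ‖X (n + 1) ω - X n ω‖ ≤ K) (v : EuclideanSpace ℝ (Fin d)) :
    (blockCovariance μ (centered X v) τ).PosSemidef := by
  refine Matrix.PosSemidef.of_dotProduct_mulVec_nonneg ?_ fun u => ?_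
  · ext i j
    simp only [Matrix.conjTranspose_apply, star_trivial, hreg.blockCovariance_apply, mul_comm]
  · have := hreg.dotProduct_blockCovariance hX htail hK v (WithLp.toLp 2 u)
    simp only [star_trivial] at this ⊢
    rw [this]
    exact mul_nonneg (inv_nonneg.2 (integral_nonneg fun ω => by positivity))
      (integral_nonneg fun ω => by positivity)

theorem rescaledPath_sub_const {T : ℝ} (N : ℕ) (x : ℕ → EuclideanSpace ℝ (Fin d))
    (y : EuclideanSpace ℝ (Fin d)) (t : Set.Icc (0 : ℝ) T) :
    rescaledPath T N (fun n => x n - y) t = rescaledPath T N x t - (√N)⁻¹ • y := by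
  simp only [rescaledPath, ContinuousMap.coe_mk, linInterp_sub_const, smul_sub]

/-- The invariance principle for a process with bounded jumps and a regeneration structure
with geometric tails. -/
theorem IsRegenerationStructure.invariancePrinciple
    (hreg : IsRegenerationStructure μ X τ) (hX : ∀ n, Measurable (X n))
    (htail : HasGeometricTails μ τ) {K : ℝ} (hK0 : 0 ≤ K)
    (hK : ∀ᵐ ω ∂μ, ∀ n, ‖X (n + 1) ω - X n ω‖ ≤ K) :
    InvariancePrinciple μ (centered X (speed μ X τ))
      (blockCovariance μ (centered X (speed μ X τ)) τ) := by
  intro T hTpos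
  have hT := hTpos.le
  set v := speed μ X τ with hv
  set m := ∫ ω, (blockLength τ 1 ω : ℝ) ∂μ with hmdef
  have hm : 1 ≤ m := hreg.one_le_integral htail
  have hm0 : 0 < m⁻¹ := by positivity
  have hZm : ∀ n, Measurable fun ω => centered X v n ω - centered X v 0 ω := fun n =>
    (measurable_centered hX v n).sub (measurable_centered hX v 0)
  have hYm : ∀ i : ℕ, Measurable fun ω => blockIncrement v (block X τ (i + 1) ω) := fun i =>
    (measurable_blockIncrement v).comp (measurable_block hX hreg.measurable _)
  have hpath : ∀ N, Measurable fun ω =>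
      rescaledPath T N (fun n => centered X v n ω - centered X v 0 ω) := fun N =>
    measurable_rescaledPath hT hZm N
  -- The initial law is arbitrary, so the criterion is applied to the path shifted to start at `0`.
  -- The shift, of size `N ^ (-1/2)`, is restored at the end by Slutsky's theorem.
  obtain ⟨W, hW, hBrown, hconv⟩ := exists_tendstoInDistribution_brownian hT
    (hreg.posSemidef_blockCovariance hX htail hK v) μ
    (fun N ω => rescaledPath T N (fun n => centered X v n ω - centered X v 0 ω)) hpath
    (fun N ω => by simp [rescaledPath, linInterp])
    (by
      intro n t ht u
      let a : ℕ → Fin (n + 1) → ℕ := fun N i => ⌊m⁻¹ * (N * (t i : ℝ))⌋₊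
      have ha : ∀ N, Monotone (a N) := fun N i j hij => by
        have hij' : (t i : ℝ) ≤ t j := ht hij
        exact Nat.floor_mono (by gcongr)
      have hlim : ∀ i, Tendsto (fun N : ℕ => (a N i : ℝ) / N) atTop (𝓝 (m⁻¹ * t i)) := by
        intro i
        have h1 := (tendsto_nat_floor_mul_div_atTop
          (R := ℝ) (mul_nonneg hm0.le (t i).2.1)).comp (tendsto_natCast_atTop_atTop (R := ℝ))
        refine h1.congr fun N => ?_
        simp only [Function.comp_apply, a]
        rw [mul_assoc, mul_comm (t i : ℝ)]
      have hθ : ∀ i : Fin n, Tendsto (fun N : ℕ => ((a N i.succ : ℝ) - a N i.castSucc) / N) atTop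
          (𝓝 (m⁻¹ * (t i.succ - t i.castSucc))) := by
        intro i
        have h1 := (hlim i.succ).sub (hlim i.castSucc)
        rw [← mul_sub] at h1
        exact h1.congr fun N => by rw [sub_div]
      have hclt := tendsto_integral_exp_increments hYm (hreg.iIndepFun_blockIncrement v)
        (hreg.identDistrib_blockIncrement v)
        ((hreg.memLp_blockIncrement hX htail hK v 1).mono_exponent (by norm_num))
        (hreg.integral_blockIncrement_speed hX htail hK) ha hθ u
      have hval : ∀ i : Fin n, (t i.succ - t i.castSucc : ℝ) *
          ((u i).ofLp ⬝ᵥ (blockCovariance μ (centered X v) τ).mulVec (u i).ofLp) =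
          m⁻¹ * (t i.succ - t i.castSucc) *
            ∫ ω, inner ℝ (blockIncrement v (block X τ (0 + 1) ω)) (u i) ^ 2 ∂μ := by
        intro i
        rw [hreg.dotProduct_blockCovariance hX htail hK]
        ring
      simp_rw [hval]
      refine tendsto_integral_exp_of_sub (fun N => ?_) (fun N => ?_) ?_ hclt
      · refine Finset.measurable_fun_sum _ fun i _ => ?_
        have h1 : Measurable fun ω =>
            rescaledPath T N (fun n => centered X v n ω - centered X v 0 ω) (t i.succ) -
            rescaledPath T N (fun n => centered X v n ω - centered X v 0 ω) (t i.castSucc) :=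
          ((measurable_pathSpace_eval _).comp (hpath N)).sub
            ((measurable_pathSpace_eval _).comp (hpath N))
        fun_prop
      · refine Finset.measurable_fun_sum _ fun i _ => ?_
        have h1 : ∀ b : ℕ, Measurable fun ω => ∑ k ∈ Finset.range b,
            blockIncrement v (block X τ (k + 1) ω) := fun b =>
          Finset.measurable_fun_sum _ fun k _ => hYm k
        have h2 := (h1 (a N i.succ)).sub (h1 (a N i.castSucc))
        fun_prop
      · intro ε hε η hη
        set U := ∑ i, ‖u i‖ with hU
        have hU0 : 0 ≤ U := Finset.sum_nonneg fun i _ => norm_nonneg _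
        -- Each increment involves two times, so the errors add up to at most `2 ε' U ≤ ε`. The `n +
        -- 1` times share the probability `η`.
        set ε' := ε / (2 * U + 1) with hε'
        have hε'pos : 0 < ε' := by positivity
        have hev : ∀ᶠ N : ℕ in atTop, ∀ i, μ.real {ω | ε' < ‖rescaledPath T N (fun n =>
            centered X v n ω - centered X v 0 ω) (t i) - (√N)⁻¹ •
              ∑ k ∈ Finset.range (a N i), blockIncrement v (block X τ (k + 1) ω)‖} ≤
              η / (n + 1) :=
          eventually_all.2 fun i => hreg.eventually_rescaledPath_sub_le hX htail hK0 hK hT (t i)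
            hε'pos (by positivity)
        filter_upwards [hev] with N hN
        have hsub : {ω | ε < |(∑ i : Fin n, inner ℝ
            (rescaledPath T N (fun n => centered X v n ω - centered X v 0 ω) (t i.succ) -
            rescaledPath T N (fun n => centered X v n ω - centered X v 0 ω) (t i.castSucc)) (u i)) -
            ∑ i : Fin n, inner ℝ ((√N)⁻¹ • (∑ k ∈ Finset.range (a N i.succ),
              blockIncrement v (block X τ (k + 1) ω) -
              ∑ k ∈ Finset.range (a N i.castSucc), blockIncrement v (block X τ (k + 1) ω))) (u i)|} ⊆
            ⋃ i, {ω | ε' < ‖rescaledPath T N (fun n =>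
            centered X v n ω - centered X v 0 ω) (t i) - (√N)⁻¹ •
              ∑ k ∈ Finset.range (a N i), blockIncrement v (block X τ (k + 1) ω)‖} := by
          intro ω hω
          by_contra hcon
          simp only [Set.mem_iUnion, Set.mem_ofPred_eq, not_exists, not_lt] at hcon
          rw [Set.mem_ofPred_eq] at hω
          refine absurd hω (not_lt.2 ?_)
          rw [← Finset.sum_sub_distrib]
          refine (Finset.abs_sum_le_sum_abs _ _).trans ?_
          have hterm : ∀ i : Fin n, |inner ℝ
            (rescaledPath T N (fun n => centered X v n ω - centered X v 0 ω) (t i.succ) -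
            rescaledPath T N (fun n => centered X v n ω - centered X v 0 ω) (t i.castSucc)) (u i) -
            inner ℝ ((√N)⁻¹ • (∑ k ∈ Finset.range (a N i.succ),
              blockIncrement v (block X τ (k + 1) ω) -
              ∑ k ∈ Finset.range (a N i.castSucc), blockIncrement v (block X τ (k + 1) ω))) (u i)| ≤
              2 * ε' * ‖u i‖ := by
            intro i
            rw [← inner_sub_left]
            refine (abs_real_inner_le_norm _ _).trans ?_
            gcongr
            rw [smul_sub, sub_sub_sub_comm]
            refine (norm_sub_le _ _).trans ?_
            linarith [hcon i.succ, hcon i.castSucc]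
          refine (Finset.sum_le_sum fun i _ => hterm i).trans ?_
          rw [← Finset.mul_sum, ← hU, hε', mul_assoc, div_mul_eq_mul_div, ← mul_div_assoc,
            div_le_iff₀ (by positivity)]
          nlinarith
        refine (measureReal_mono hsub).trans ((measureReal_iUnion_fintype_le _).trans
          ((Finset.sum_le_sum fun i _ => hN i).trans ?_))
        rw [Finset.sum_const, Finset.card_univ, Fintype.card_fin, nsmul_eq_mul]
        push_cast
        rw [mul_div_cancel₀ _ (by positivity)])
    (by
      intro ε hε η hη
      rcases eq_or_ne η ⊤ with rfl | hηtop
      · exact ⟨1, one_pos, Eventually.of_forall fun N => le_top⟩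
      obtain ⟨δ, hδ, h⟩ := hreg.exists_eventually_modulus_le hX htail hK0 hK hT hε
        (ENNReal.toReal_pos hη.ne' hηtop)
      refine ⟨δ, hδ, h.mono fun N hN => ?_⟩
      exact (ENNReal.toReal_le_toReal (measure_ne_top _ _) hηtop).1 hN)
  refine ⟨W, hW, hBrown, ?_⟩
  refine tendstoInDistribution_of_tendstoInMeasure_sub _ _ hconv ?_ fun N =>
    (measurable_rescaledPath hT (measurable_centered hX v) N).aemeasurable
  have hdiff : ∀ N ω, rescaledPath T N (fun n => centered X v n ω) -
      rescaledPath T N (fun n => centered X v n ω - centered X v 0 ω) =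
      ContinuousMap.const _ ((√N)⁻¹ • centered X v 0 ω) := by
    intro N ω
    ext1 t
    rw [ContinuousMap.sub_apply, rescaledPath_sub_const, sub_sub_cancel, ContinuousMap.const_apply]
  refine tendstoInMeasure_of_tendsto_ae (fun N => ?_) (Eventually.of_forall fun ω => ?_)
  · exact ((measurable_rescaledPath hT (measurable_centered hX v) N).sub
      (hpath N)).aestronglyMeasurable
  · have hs : Tendsto (fun N : ℕ => (√(N : ℝ))⁻¹) atTop (𝓝 0) :=
      tendsto_inv_atTop_zero.comp (Real.tendsto_sqrt_atTop.comp tendsto_natCast_atTop_atTop)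
    have h1 := hs.smul_const (centered X v 0 ω)
    rw [zero_smul] at h1
    simp only [Pi.sub_apply, Pi.zero_apply, hdiff]
    have hc : Continuous (ContinuousMap.const (Set.Icc (0 : ℝ) T) :
      EuclideanSpace ℝ (Fin d) → PathSpace d T) := ContinuousMap.continuous_const'
    exact (hc.tendsto 0).comp h1

/-- A process with bounded jumps and a regeneration structure with geometric tails satisfies the
conditions of the rough invariance principle. -/
theorem IsRegenerationStructure.roughInvarianceConditions
    (hreg : IsRegenerationStructure μ X τ) (hX : ∀ n, Measurable (X n))
    (htail : HasGeometricTails μ τ)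
    (hjump : ∃ K : ℝ, ∀ᵐ ω ∂μ, ∀ n, ‖X (n + 1) ω - X n ω‖ ≤ K) :
    RoughInvarianceConditions μ X τ := by
  obtain ⟨K, hK⟩ := hjump
  have hK' : ∀ᵐ ω ∂μ, ∀ n, ‖X (n + 1) ω - X n ω‖ ≤ max K 0 :=
    hK.mono fun ω h n => (h n).trans (le_max_left _ _)
  exact ⟨hX, ⟨K, hK⟩, hreg, hreg.tendsto_inv_smul hX htail hK,
    hreg.invariancePrinciple hX htail (le_max_right _ _) hK',
    ⟨4, le_rfl, htail.hasBlockMoments hreg.measurable _⟩⟩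

end Invariance

/-! ### The Markov property of a hidden Markov walk -/

section History

variable {d : ℕ} {S Ω : Type*} {R : ℕ → Ω → S} {X : ℕ → Ω → EuclideanSpace ℝ (Fin d)}

/-- The event that the hidden chain follows `r` up to time `n` and the first `n` increments of the
walk lie in the sets `A i`. -/
def walkCylinder (R : ℕ → Ω → S) (X : ℕ → Ω → EuclideanSpace ℝ (Fin d)) (n : ℕ) (r : ℕ → S)
    (A : ℕ → Set (EuclideanSpace ℝ (Fin d))) : Set Ω :=
  {ω | (∀ i ≤ n, R i ω = r i) ∧ ∀ i < n, X (i + 1) ω - X i ω ∈ A i}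

/-- The σ-algebra generated by the hidden chain up to time `n` and the first `n` increments of
the walk. -/
abbrev walkHistory (R : ℕ → Ω → S) (X : ℕ → Ω → EuclideanSpace ℝ (Fin d)) (n : ℕ) :
    MeasurableSpace Ω :=
  MeasurableSpace.generateFrom
    {E | ∃ r A, (∀ i, MeasurableSet (A i)) ∧ E = walkCylinder R X n r A}

/-- Cylinders that meet prescribe the same states up to time `n`, so only the sets of steps have to
be intersected. -/
theorem isPiSystem_walkCylinder (n : ℕ) :
    IsPiSystem {E : Set Ω | ∃ r A, (∀ i, MeasurableSet (A i)) ∧ E = walkCylinder R X n r A} := by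
  rintro _ ⟨r, A, hA, rfl⟩ _ ⟨r', A', hA', rfl⟩ ⟨ω₀, h, h'⟩
  refine ⟨r, fun i => A i ∩ A' i, fun i => (hA i).inter (hA' i), ?_⟩
  ext ω
  constructor
  · rintro ⟨h1, h2⟩
    exact ⟨h1.1, fun i hi => ⟨h1.2 i hi, h2.2 i hi⟩⟩
  · rintro ⟨h1, h2⟩
    refine ⟨⟨h1, fun i hi => (h2 i hi).1⟩, fun i hi => ?_, fun i hi => (h2 i hi).2⟩
    rw [h1 i hi, ← h.1 i hi, h'.1 i hi]

theorem walkCylinder_eq (n : ℕ) (r : ℕ → S) (A : ℕ → Set (EuclideanSpace ℝ (Fin d))) :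
    walkCylinder R X n r A = (⋂ i ∈ Set.Iic n, {ω | R i ω = r i}) ∩
      ⋂ i ∈ Set.Iio n, {ω | X (i + 1) ω - X i ω ∈ A i} := by
  ext ω; simp [walkCylinder]

theorem walkCylinder_succ (n : ℕ) (r : ℕ → S) (A : ℕ → Set (EuclideanSpace ℝ (Fin d))) :
    walkCylinder R X (n + 1) r A = walkCylinder R X n r A ∩ {ω | R (n + 1) ω = r (n + 1)} ∩
      {ω | X (n + 1) ω - X n ω ∈ A n} := by
  ext ω
  constructor
  · rintro ⟨h1, h2⟩
    exact ⟨⟨⟨fun i hi => h1 i (by omega), fun i hi => h2 i (by omega)⟩, h1 _ le_rfl⟩,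
      h2 n (by omega)⟩
  · rintro ⟨⟨⟨h1, h2⟩, h3⟩, h4⟩
    refine ⟨fun i hi => ?_, fun i hi => ?_⟩
    · rcases Nat.le_succ_iff.1 hi with hi | rfl
      · exact h1 i hi
      · exact h3
    · rcases Nat.lt_succ_iff_lt_or_eq.1 hi with hi | rfl
      · exact h2 i hi
      · exact h4

theorem IsHiddenMarkovWalk.measureReal_walkCylinder_succ [MeasurableSpace Ω]
    {μ : Measure Ω} {P : S → S → ℝ} {ν : S → S → Measure (EuclideanSpace ℝ (Fin d))}
    (h : IsHiddenMarkovWalk μ P ν R X) (n : ℕ) (r : ℕ → S)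
    {A : ℕ → Set (EuclideanSpace ℝ (Fin d))} (hA : ∀ i, MeasurableSet (A i)) :
    μ.real (walkCylinder R X (n + 1) r A) = μ.real (walkCylinder R X n r A) *
      (P (r n) (r (n + 1)) * (ν (r n) (r (n + 1))).real (A n)) := by
  have h1 := h.law_increments (n + 1) r A hA
  have h2 := h.law_increments n r A hA
  rw [h.hidden_chain.law, Finset.prod_range_succ, Finset.prod_range_succ] at h1
  rw [h.hidden_chain.law] at h2
  rw [walkCylinder, walkCylinder, h1, h2]
  ring

theorem IsHiddenMarkovWalk.walkHistory_le [MeasurableSpace Ω] {μ : Measure Ω}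
    {P : S → S → ℝ} {ν : S → S → Measure (EuclideanSpace ℝ (Fin d))}
    (h : IsHiddenMarkovWalk μ P ν R X) (n : ℕ) :
    walkHistory R X n ≤ ‹MeasurableSpace Ω› := by
  refine MeasurableSpace.generateFrom_le ?_
  rintro _ ⟨r, A, hA, rfl⟩
  rw [walkCylinder_eq]
  refine MeasurableSet.inter ?_ ?_
  · exact MeasurableSet.biInter (Set.to_countable _) fun i _ => h.hidden_chain.measurable i _
  · exact MeasurableSet.biInter (Set.to_countable _) fun i _ =>
      ((h.measurable (i + 1)).sub (h.measurable i)) (hA i)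

variable [Countable S]

/-- A countable union of cylinders over the paths of the chain up to time `n`; `min j n` extends
such a path to all indices. -/
theorem measurableSet_walkHistory_chain {i n : ℕ} (hi : i ≤ n) (s : S) :
    MeasurableSet[walkHistory R X n] {ω | R i ω = s} := by
  have : {ω | R i ω = s} = ⋃ (r : Fin (n + 1) → S) (_ : r ⟨i, by omega⟩ = s),
      walkCylinder R X n (fun j => r ⟨min j n, by omega⟩) fun _ => Set.univ := by
    ext ω
    simp only [Set.mem_ofPred_eq, Set.mem_iUnion, exists_prop]
    constructor
    · intro h
      refine ⟨fun j => R j ω, h, fun j hj => ?_, fun _ _ => Set.mem_univ _⟩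
      simp [min_eq_left hj]
    · rintro ⟨r, hr, h⟩
      have := h.1 i hi
      simp only [min_eq_left hi] at this
      rw [this, hr]
  rw [this]
  refine MeasurableSet.iUnion fun r => MeasurableSet.iUnion fun _ => ?_
  exact MeasurableSpace.measurableSet_generateFrom ⟨_, _, fun _ => MeasurableSet.univ, rfl⟩

theorem measurableSet_walkHistory_increment {i n : ℕ} (hi : i < n)
    {B : Set (EuclideanSpace ℝ (Fin d))} (hB : MeasurableSet B) :
    MeasurableSet[walkHistory R X n] {ω | X (i + 1) ω - X i ω ∈ B} := by
  classical
  have : {ω | X (i + 1) ω - X i ω ∈ B} = ⋃ (r : Fin (n + 1) → S),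
      walkCylinder R X n (fun j => r ⟨min j n, by omega⟩)
        fun j => if j = i then B else Set.univ := by
    ext ω
    simp only [Set.mem_ofPred_eq, Set.mem_iUnion]
    constructor
    · intro h
      refine ⟨fun j => R j ω, fun j hj => ?_, fun j hj => ?_⟩
      · simp [min_eq_left hj]
      · by_cases hji : j = i
        · subst hji; simpa using h
        · simp [hji]
    · rintro ⟨r, h⟩
      simpa using h.2 i hi
  rw [this]
  refine MeasurableSet.iUnion fun r => ?_
  refine MeasurableSpace.measurableSet_generateFrom ⟨_, _, fun j => ?_, rfl⟩
  by_cases hji : j = i <;> simp [hji, hB]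

theorem measurable_walkHistory_increment {i n : ℕ} (hi : i < n) :
    Measurable[walkHistory R X n] fun ω => X (i + 1) ω - X i ω :=
  fun _ hB => measurableSet_walkHistory_increment hi hB

theorem walkHistory_mono {m n : ℕ} (h : m ≤ n) : walkHistory R X m ≤ walkHistory R X n := by
  refine MeasurableSpace.generateFrom_le ?_
  rintro _ ⟨r, A, hA, rfl⟩
  rw [walkCylinder_eq]
  refine MeasurableSet.inter ?_ ?_
  · exact MeasurableSet.biInter (Set.to_countable _) fun i hi =>
      measurableSet_walkHistory_chain (le_trans hi h) _
  · exact MeasurableSet.biInter (Set.to_countable _) fun i hi =>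
      measurableSet_walkHistory_increment (lt_of_lt_of_le hi h) (hA i)

variable [MeasurableSpace Ω] {μ : Measure Ω} {P : S → S → ℝ}
  {ν : S → S → Measure (EuclideanSpace ℝ (Fin d))} [IsProbabilityMeasure μ]

/-- The Markov property of a hidden Markov walk. -/
theorem IsHiddenMarkovWalk.measure_inter_step [∀ r r', IsProbabilityMeasure (ν r r')]
    (hP : ∀ x y, 0 ≤ P x y)
    (h : IsHiddenMarkovWalk μ P ν R X) {n : ℕ} {E : Set Ω}
    (hE : MeasurableSet[walkHistory R X n] E) (s s' : S) {B : Set (EuclideanSpace ℝ (Fin d))}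
    (hB : MeasurableSet B) :
    μ ((E ∩ {ω | R n ω = s}) ∩ {ω | R (n + 1) ω = s' ∧ X (n + 1) ω - X n ω ∈ B}) =
      μ (E ∩ {ω | R n ω = s}) * (ENNReal.ofReal (P s s') * ν s s' B) := by
  classical
  have hle := h.walkHistory_le n
  set D := {ω | R n ω = s}
  have hD : MeasurableSet D := h.hidden_chain.measurable n s
  set F := {ω | R (n + 1) ω = s' ∧ X (n + 1) ω - X n ω ∈ B}
  have hF : MeasurableSet F := (h.hidden_chain.measurable (n + 1) s').inter
    (((h.measurable (n + 1)).sub (h.measurable n)) hB)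
  set c := ENNReal.ofReal (P s s') * ν s s' B
  have hcyl : ∀ (r : ℕ → S) (A : ℕ → Set (EuclideanSpace ℝ (Fin d))),
      (∀ i, MeasurableSet (A i)) →
      μ (walkCylinder R X n r A ∩ (D ∩ F)) = c * μ (walkCylinder R X n r A ∩ D) := by
    intro r A hA
    by_cases hr : r n = s
    · have e1 : walkCylinder R X n r A ∩ D = walkCylinder R X n r A := by
        refine Set.inter_eq_left.2 fun ω hω => ?_
        change R n ω = s
        rw [hω.1 n le_rfl, hr]
      -- A cylinder followed by one prescribed step is a cylinder of length `n + 1`, whose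
      -- probability has exactly one factor more.
      set r' := Function.update r (n + 1) s'
      set A' := Function.update A n B
      have hA' : ∀ i, MeasurableSet (A' i) := fun i => by
        by_cases hi : i = n
        · subst hi; simpa [A'] using hB
        · simpa [A', hi] using hA i
      have hr' : ∀ i ≤ n, r' i = r i := fun i hi => by
        simp [r', Function.update_of_ne (show i ≠ n + 1 by omega)]
      have hAi : ∀ i < n, A' i = A i := fun i hi => by
        simp [A', Function.update_of_ne (show i ≠ n by omega)]
      have e2 : walkCylinder R X n r A ∩ (D ∩ F) = walkCylinder R X (n + 1) r' A' := by
        ext ω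
        constructor
        · rintro ⟨⟨h1, h2⟩, -, h3, h4⟩
          refine ⟨fun i hi => ?_, fun i hi => ?_⟩
          · rcases Nat.le_succ_iff.1 hi with hi | rfl
            · rw [hr' i hi, h1 i hi]
            · simpa [r'] using h3
          · rcases Nat.lt_succ_iff_lt_or_eq.1 hi with hi | rfl
            · rw [hAi i hi]; exact h2 i hi
            · simpa [A'] using h4
        · rintro ⟨h1, h2⟩
          have h3 : ∀ i ≤ n, R i ω = r i := fun i hi => by
            rw [← hr' i hi]; exact h1 i (by omega)
          refine ⟨⟨h3, fun i hi => ?_⟩, ?_, ?_, ?_⟩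
          · rw [← hAi i hi]; exact h2 i (by omega)
          · change R n ω = s
            rw [h3 n le_rfl, hr]
          · simpa [r'] using h1 (n + 1) le_rfl
          · simpa [A'] using h2 n (by omega)
      have e3 : walkCylinder R X n r' A' = walkCylinder R X n r A := by
        ext ω
        refine and_congr (forall₂_congr fun i hi => ?_) (forall₂_congr fun i hi => ?_)
        · rw [hr' i hi]
        · rw [hAi i hi]
      have h5 := h.measureReal_walkCylinder_succ n r' hA'
      rw [e3, hr' n le_rfl, hr] at h5
      simp only [r', A', Function.update_self] at h5
      rw [e1, e2]
      rw [← ENNReal.toReal_eq_toReal_iff' (measure_ne_top _ _)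
        (ENNReal.mul_ne_top (ENNReal.mul_ne_top ENNReal.ofReal_ne_top (measure_ne_top _ _))
          (measure_ne_top _ _)), ENNReal.toReal_mul, ENNReal.toReal_mul,
        ENNReal.toReal_ofReal (hP _ _)]
      rw [measureReal_def] at h5
      rw [h5, measureReal_def, measureReal_def]
      ring
    · have e1 : walkCylinder R X n r A ∩ D = ∅ := by
        refine Set.eq_empty_of_forall_notMem fun ω hω => hr ?_
        rw [← hω.1.1 n le_rfl]
        exact hω.2
      rw [← Set.inter_assoc, e1]
      simp
  -- The identity on cylinders extends to every past event: both measures, trimmed to the history,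
  -- agree on a generating π-system, and the cylinders without conditions on the steps form a
  -- countable cover of finite mass.
  have hmeas : (μ.restrict (D ∩ F)).trim hle = (c • μ.restrict D).trim hle := by
    refine @Measure.ext_of_generateFrom_of_cover_subset Ω (walkHistory R X n) _ _ _
      (Set.range fun r : Fin (n + 1) → S =>
        walkCylinder R X n (fun j => r ⟨min j n, by omega⟩) fun _ => Set.univ)
      rfl (isPiSystem_walkCylinder n) ?_ (Set.countable_range _) ?_ ?_ ?_
    · rintro _ ⟨r, rfl⟩
      exact ⟨_, _, fun _ => MeasurableSet.univ, rfl⟩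
    · refine Set.eq_univ_of_forall fun ω => ⟨_, ⟨fun j => R j ω, rfl⟩, fun j hj => ?_, ?_⟩
      · simp [min_eq_left hj]
      · simp
    · rintro _ ⟨r, rfl⟩
      have : IsFiniteMeasure ((μ.restrict (D ∩ F)).trim hle) := isFiniteMeasure_trim hle
      exact measure_ne_top _ _
    · rintro _ ⟨r, A, hA, rfl⟩
      have hm : MeasurableSet[walkHistory R X n] (walkCylinder R X n r A) :=
        MeasurableSpace.measurableSet_generateFrom ⟨r, A, hA, rfl⟩
      rw [trim_measurableSet_eq hle hm, trim_measurableSet_eq hle hm, Measure.smul_apply,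
        Measure.restrict_apply (hle _ hm), Measure.restrict_apply (hle _ hm), hcyl r A hA,
        smul_eq_mul]
  have := congrArg (fun m : @Measure Ω (walkHistory R X n) => m E) hmeas
  beta_reduce at this
  rw [trim_measurableSet_eq hle hE, trim_measurableSet_eq hle hE, Measure.smul_apply,
    Measure.restrict_apply (hle _ hE), Measure.restrict_apply (hle _ hE), smul_eq_mul,
    ← Set.inter_assoc] at this
  rw [this, mul_comm]

end History

/-! ### Excursions away from a state and geometric tails -/

section Excursions

variable {d : ℕ} {S Ω : Type*} {R : ℕ → Ω → S} {X : ℕ → Ω → EuclideanSpace ℝ (Fin d)} {e : S}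

/-- The event that the chain, observed from time `n` on, comes to `e` for the first time after
`l + 1` steps, the increments of the walk on the way lying in the sets `A i`. -/
def excursion (R : ℕ → Ω → S) (X : ℕ → Ω → EuclideanSpace ℝ (Fin d)) (e : S) (n l : ℕ)
    (A : ℕ → Set (EuclideanSpace ℝ (Fin d))) : Set Ω :=
  {ω | (∀ i < l, R (n + i + 1) ω ≠ e) ∧ R (n + l + 1) ω = e ∧
    ∀ i ≤ l, X (n + i + 1) ω - X (n + i) ω ∈ A i}

/-- The event that the chain does not visit `e` at the times `n + 1, …, n + l`. -/
def avoids (R : ℕ → Ω → S) (e : S) (n l : ℕ) : Set Ω :=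
  {ω | ∀ i < l, R (n + i + 1) ω ≠ e}

theorem excursion_succ (n l : ℕ) (A : ℕ → Set (EuclideanSpace ℝ (Fin d))) :
    excursion R X e n (l + 1) A = {ω | X (n + 1) ω - X n ω ∈ A 0} ∩ {ω | R (n + 1) ω ≠ e} ∩
      excursion R X e (n + 1) l (fun i => A (i + 1)) := by
  ext ω
  have h : ∀ i, n + (i + 1) = n + 1 + i := fun i => by omega
  constructor
  · rintro ⟨h1, h2, h3⟩
    refine ⟨⟨by simpa using h3 0 (by omega), by simpa using h1 0 (by omega)⟩, fun i hi => ?_, ?_,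
      fun i hi => ?_⟩
    · rw [← h]; exact h1 (i + 1) (by omega)
    · rw [← h]; exact h2
    · rw [← h]; exact h3 (i + 1) (by omega)
  · rintro ⟨⟨h1, h2⟩, h3, h4, h5⟩
    refine ⟨fun i hi => ?_, by rw [h]; exact h4, fun i hi => ?_⟩
    · rcases i with _ | i
      · simpa using h2
      · rw [h]; exact h3 i (by omega)
    · rcases i with _ | i
      · simpa using h1
      · rw [h]; exact h5 i (by omega)

theorem avoids_add (n a b : ℕ) : avoids R e n (a + b) = avoids R e n a ∩ avoids R e (n + a) b := by
  ext ω
  constructor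
  · intro h
    refine ⟨fun i hi => h i (by omega), fun i hi => ?_⟩
    simpa only [add_assoc] using h (a + i) (by omega)
  · rintro ⟨h1, h2⟩ i hi
    rcases lt_or_ge i a with hia | hia
    · exact h1 i hia
    · have := h2 (i - a) (by omega)
      rwa [show n + a + (i - a) + 1 = n + i + 1 by omega] at this

theorem avoids_anti (n : ℕ) {a b : ℕ} (h : a ≤ b) : avoids R e n b ⊆ avoids R e n a :=
  fun _ hω i hi => hω i (by omega)

theorem avoids_eq (n l : ℕ) : avoids R e n l = ⋂ i ∈ Set.Iio l, {ω | R (n + i + 1) ω = e}ᶜ := by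
  ext ω; simp [avoids]

theorem measurableSet_walkHistory_avoids [Finite S] {n l m : ℕ} (h : n + l ≤ m) :
    MeasurableSet[walkHistory R X m] (avoids R e n l) := by
  rw [avoids_eq]
  refine MeasurableSet.biInter (Set.to_countable _) fun i hi => ?_
  have hi' : i < l := hi
  exact (measurableSet_walkHistory_chain (by omega) e).compl

theorem excursion_eq (n l : ℕ) (A : ℕ → Set (EuclideanSpace ℝ (Fin d))) :
    excursion R X e n l A = avoids R e n l ∩ {ω | R (n + l + 1) ω = e} ∩
      ⋂ i ∈ Set.Iic l, {ω | X (n + i + 1) ω - X (n + i) ω ∈ A i} := by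
  ext ω; simp [excursion, avoids, and_assoc]

theorem measurableSet_walkHistory_excursion [Finite S] {n l m : ℕ} (h : n + l + 1 ≤ m)
    {A : ℕ → Set (EuclideanSpace ℝ (Fin d))} (hA : ∀ i, MeasurableSet (A i)) :
    MeasurableSet[walkHistory R X m] (excursion R X e n l A) := by
  rw [excursion_eq]
  refine ((measurableSet_walkHistory_avoids (by omega)).inter
    (measurableSet_walkHistory_chain h e)).inter
      (MeasurableSet.biInter (Set.to_countable _) fun i hi => ?_)
  have hi' : i ≤ l := hi
  exact measurableSet_walkHistory_increment (by omega) (hA i)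

variable [MeasurableSpace Ω] {μ : Measure Ω} {P : S → S → ℝ}

theorem IsMarkovChain.tsum_measure_inter [Countable S] (h : IsMarkovChain μ P R) (n : ℕ)
    {E : Set Ω} (hE : MeasurableSet E) : ∑' s, μ (E ∩ {ω | R n ω = s}) = μ E := by
  have hd : Pairwise (Function.onFun Disjoint fun s => E ∩ {ω | R n ω = s}) := fun s t hst =>
    Set.disjoint_left.2 fun ω h1 h2 => hst (h1.2.symm.trans h2.2)
  rw [← measure_iUnion hd fun s => hE.inter (h.measurable n s)]
  congr 1
  ext ω
  simp

theorem IsMarkovChain.sum_measure_inter [Fintype S] (h : IsMarkovChain μ P R) (n : ℕ) {E : Set Ω}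
    (hE : MeasurableSet E) : ∑ s, μ (E ∩ {ω | R n ω = s}) = μ E := by
  rw [← h.tsum_measure_inter n hE, tsum_fintype]

variable {ν : S → S → Measure (EuclideanSpace ℝ (Fin d))} [IsProbabilityMeasure μ]
  [∀ r r', IsProbabilityMeasure (ν r r')]

/-- The law of an excursion, conditionally on the past, depends on the present state only. -/
theorem IsHiddenMarkovWalk.exists_measure_inter_excursion [Finite S] (hP : ∀ x y, 0 ≤ P x y)
    (h : IsHiddenMarkovWalk μ P ν R X) (e : S) (l : ℕ)
    (A : ℕ → Set (EuclideanSpace ℝ (Fin d))) (hA : ∀ i, MeasurableSet (A i)) :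
    ∃ q : S → ENNReal, ∀ (n : ℕ) (E : Set Ω), MeasurableSet[walkHistory R X n] E → ∀ s,
      μ (E ∩ {ω | R n ω = s} ∩ excursion R X e n l A) = μ (E ∩ {ω | R n ω = s}) * q s := by
  classical
  have := Fintype.ofFinite S
  induction l generalizing A with
  | zero =>
    refine ⟨fun s => ENNReal.ofReal (P s e) * ν s e (A 0), fun n E hE s => ?_⟩
    rw [← h.measure_inter_step hP hE s e (hA 0)]
    congr 2
    ext ω
    simp [excursion]
  | succ l ih =>
    obtain ⟨q, hq⟩ := ih (fun i => A (i + 1)) fun i => hA _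
    -- First-step decomposition: move to some `s' ≠ e` with a step in `A 0`, then make a shorter
    -- excursion from time `n + 1`. The first step is added to the past event, which is why the
    -- claim is made for all of them.
    refine ⟨fun s => ∑ s', ENNReal.ofReal (P s s') * ν s s' (A 0) *
      (if s' = e then 0 else q s'), fun n E hE s => ?_⟩
    set F : Set Ω := E ∩ {ω | R n ω = s} ∩ {ω | X (n + 1) ω - X n ω ∈ A 0}
    have hF : MeasurableSet[walkHistory R X (n + 1)] F :=
      ((walkHistory_mono (Nat.le_succ n) _ hE).inter
        (measurableSet_walkHistory_chain (Nat.le_succ n) s)).inter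
        (measurableSet_walkHistory_increment (Nat.lt_succ_self n) (hA 0))
    have hm : MeasurableSet (E ∩ {ω | R n ω = s} ∩ excursion R X e n (l + 1) A) :=
      h.walkHistory_le (n + (l + 1) + 1) _
        (((walkHistory_mono (by omega) _ hE).inter
          (measurableSet_walkHistory_chain (by omega) s)).inter
          (measurableSet_walkHistory_excursion le_rfl hA))
    rw [← h.hidden_chain.sum_measure_inter (n + 1) hm, Finset.mul_sum]
    refine Finset.sum_congr rfl fun s' _ => ?_
    have hstep := h.measure_inter_step hP hE s s' (hA 0)
    have hFs : E ∩ {ω | R n ω = s} ∩ {ω | R (n + 1) ω = s' ∧ X (n + 1) ω - X n ω ∈ A 0} =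
        F ∩ {ω | R (n + 1) ω = s'} := by
      ext ω
      simp only [F, Set.mem_inter_iff, Set.mem_ofPred_eq]
      tauto
    rw [hFs] at hstep
    rw [excursion_succ]
    by_cases hs : s' = e
    · rw [if_pos hs, mul_zero, mul_zero]
      convert measure_empty (μ := μ)
      ext ω
      simp only [Set.mem_inter_iff, Set.mem_ofPred_eq, Set.mem_empty_iff_false, iff_false]
      rintro ⟨⟨-, ⟨-, h1⟩, -⟩, h2⟩
      exact h1 (h2.trans hs)
    · rw [if_neg hs, ← mul_assoc, ← hstep, ← hq (n + 1) F hF s']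
      congr 1
      ext ω
      simp only [F, Set.mem_inter_iff, Set.mem_ofPred_eq]
      constructor
      · tauto
      · rintro ⟨⟨⟨h1, h2⟩, h3⟩, h4⟩
        exact ⟨⟨h1, ⟨h2, fun h5 => hs (h3.symm.trans h5)⟩, h4⟩, h3⟩

theorem IsHiddenMarkovWalk.measureReal_inter_next [Finite S] (hP : ∀ x y, 0 ≤ P x y)
    (h : IsHiddenMarkovWalk μ P ν R X) {n : ℕ} {E : Set Ω}
    (hE : MeasurableSet[walkHistory R X n] E) (s s' : S) :
    μ.real (E ∩ {ω | R n ω = s} ∩ {ω | R (n + 1) ω = s'}) =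
      P s s' * μ.real (E ∩ {ω | R n ω = s}) := by
  have := h.measure_inter_step hP hE s s' MeasurableSet.univ
  simp only [Set.mem_univ, and_true, measure_univ, mul_one] at this
  rw [measureReal_def, this, ENNReal.toReal_mul, ENNReal.toReal_ofReal (hP _ _), mul_comm,
    measureReal_def]

/-- Induction along a path of possible transitions from `s` to `e`. The constant is the product of
their probabilities, hence independent of the time and of the past event. -/
theorem IsHiddenMarkovWalk.exists_le_measureReal_hit [Finite S] (hP : ∀ x y, 0 ≤ P x y)
    (h : IsHiddenMarkovWalk μ P ν R X) {s e : S}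
    (hse : Relation.ReflTransGen (fun a b => 0 < P a b) s e) :
    ∃ (l : ℕ) (c : ℝ), 0 < c ∧ ∀ (n : ℕ) (E : Set Ω), MeasurableSet[walkHistory R X n] E →
      c * μ.real (E ∩ {ω | R n ω = s}) ≤
        μ.real (E ∩ {ω | R n ω = s} ∩ {ω | ∃ i ≤ l, R (n + i) ω = e}) := by
  induction hse using Relation.ReflTransGen.head_induction_on with
  | refl =>
    refine ⟨0, 1, one_pos, fun n E hE => ?_⟩
    rw [one_mul]
    refine measureReal_mono fun ω hω => ⟨hω, 0, le_rfl, hω.2⟩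
  | @head a b hab _ ih =>
    obtain ⟨l, c, hc, ih⟩ := ih
    refine ⟨l + 1, c * P a b, mul_pos hc hab, fun n E hE => ?_⟩
    have h1 := ih (n + 1) (E ∩ {ω | R n ω = a}) ((walkHistory_mono (Nat.le_succ n) _ hE).inter
      (measurableSet_walkHistory_chain (Nat.le_succ n) a))
    rw [h.measureReal_inter_next hP hE, ← mul_assoc] at h1
    refine h1.trans (measureReal_mono ?_)
    rintro ω ⟨⟨h2, h3⟩, i, hi, h4⟩
    exact ⟨h2, i + 1, by omega, by rw [← h4]; congr 1; omega⟩

/-- From each state, `e` is reached within some number of steps with positive probability; finitely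
many states allow a common number of steps and a common lower bound. -/
theorem IsHiddenMarkovWalk.exists_measureReal_avoids_le [Finite S] (hP : IsTransitionMatrix P)
    (hirr : IsIrreducibleChain P) (h : IsHiddenMarkovWalk μ P ν R X) (e : S) :
    ∃ (m : ℕ) (θ : ℝ), 0 < m ∧ 0 < θ ∧ θ < 1 ∧
      ∀ (n : ℕ) (E : Set Ω), MeasurableSet[walkHistory R X n] E →
        μ.real (E ∩ avoids R e n m) ≤ θ * μ.real E := by
  classical
  have := Fintype.ofFinite S
  have key : ∀ s : S, ∃ (l : ℕ) (c : ℝ), 0 < c ∧ ∀ (n : ℕ) (E : Set Ω),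
      MeasurableSet[walkHistory R X n] E → c * μ.real (E ∩ {ω | R n ω = s}) ≤
        μ.real (E ∩ {ω | R n ω = s} ∩ (avoids R e n l)ᶜ) := by
    intro s
    -- A step is made before the hitting estimate is used, because the visit has to come strictly
    -- after time `n`, also when `s = e`.
    obtain ⟨s', hs'⟩ : ∃ s', 0 < P s s' := by
      by_contra! hcon
      have h0 : P s = fun _ => 0 := funext fun t => le_antisymm (hcon t) (hP.nonneg s t)
      have h1 := hP.hasSum_one s
      rw [h0] at h1
      exact zero_ne_one (hasSum_zero.unique h1)
    obtain ⟨l, c, hc, hl⟩ := h.exists_le_measureReal_hit hP.nonneg (hirr s' e)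
    refine ⟨l + 1, c * P s s', mul_pos hc hs', fun n E hE => ?_⟩
    have h1 := hl (n + 1) (E ∩ {ω | R n ω = s}) ((walkHistory_mono (Nat.le_succ n) _ hE).inter
      (measurableSet_walkHistory_chain (Nat.le_succ n) s))
    rw [h.measureReal_inter_next hP.nonneg hE, ← mul_assoc] at h1
    refine h1.trans (measureReal_mono ?_)
    rintro ω ⟨⟨h2, h3⟩, i, hi, h4⟩
    refine ⟨h2, fun h5 => h5 i (by omega) ?_⟩
    rw [← h4]; congr 1; omega
  choose l c hc hl using key
  have : Nonempty S := ⟨e⟩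
  obtain ⟨s₀, hs₀⟩ := Finite.exists_min c
  obtain ⟨s₁, hs₁⟩ := Finite.exists_max l
  -- The cap at `1 / 2` keeps `θ = 1 - δ` positive, so that it can be inverted later.
  set δ := min (c s₀) (1 / 2)
  have hδ : 0 < δ := lt_min (hc _) (by norm_num)
  have hδ' : δ ≤ 1 / 2 := min_le_right _ _
  refine ⟨l s₁ + 1, 1 - δ, Nat.succ_pos _, by linarith, by linarith, fun n E hE => ?_⟩
  have hEm := h.walkHistory_le n _ hE
  have hU : MeasurableSet (avoids R e n (l s₁ + 1)) :=
    h.walkHistory_le (n + (l s₁ + 1)) _ (measurableSet_walkHistory_avoids le_rfl)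
  have hsum : ∀ F : Set Ω, MeasurableSet F → ∑ s, μ.real (F ∩ {ω | R n ω = s}) = μ.real F := by
    intro F hF
    rw [measureReal_def, ← h.hidden_chain.sum_measure_inter n hF,
      ENNReal.toReal_sum fun _ _ => measure_ne_top _ _]
    rfl
  rw [← hsum _ (hEm.inter hU), ← hsum _ hEm, Finset.mul_sum]
  refine Finset.sum_le_sum fun s _ => ?_
  have h1 := hl s n E hE
  have h2 : μ.real (E ∩ {ω | R n ω = s} ∩ (avoids R e n (l s))ᶜ) ≤
      μ.real ((E ∩ {ω | R n ω = s}) \ avoids R e n (l s₁ + 1)) :=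
    measureReal_mono fun ω hω => ⟨hω.1, fun h3 =>
      hω.2 (avoids_anti n ((hs₁ s).trans (Nat.le_succ _)) h3)⟩
  have h3 := measureReal_inter_add_sdiff (μ := μ) (s := E ∩ {ω | R n ω = s}) hU
  have h4 : E ∩ avoids R e n (l s₁ + 1) ∩ {ω | R n ω = s} =
      E ∩ {ω | R n ω = s} ∩ avoids R e n (l s₁ + 1) := Set.inter_right_comm _ _ _
  rw [h4]
  have h5 : δ * μ.real (E ∩ {ω | R n ω = s}) ≤ c s * μ.real (E ∩ {ω | R n ω = s}) :=
    mul_le_mul_of_nonneg_right ((min_le_left _ _).trans (hs₀ s)) measureReal_nonneg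
  linarith

/-- The time it takes an irreducible finite chain to come to a given state has a geometric tail,
conditionally on the past. -/
theorem IsHiddenMarkovWalk.exists_measureReal_avoids_le_geometric [Finite S]
    (hP : IsTransitionMatrix P) (hirr : IsIrreducibleChain P) (h : IsHiddenMarkovWalk μ P ν R X)
    (e : S) : ∃ C ρ : ℝ, 0 ≤ C ∧ 0 ≤ ρ ∧ ρ < 1 ∧
      ∀ (n l : ℕ) (E : Set Ω), MeasurableSet[walkHistory R X n] E →
        μ.real (E ∩ avoids R e n l) ≤ C * ρ ^ l * μ.real E := by
  obtain ⟨m, θ, hm, hθ, hθ1, hle⟩ := h.exists_measureReal_avoids_le hP hirr e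
  have hiter : ∀ (j n : ℕ) (E : Set Ω), MeasurableSet[walkHistory R X n] E →
      μ.real (E ∩ avoids R e n (j * m)) ≤ θ ^ j * μ.real E := by
    intro j n E hE
    induction j with
    | zero => simpa using measureReal_mono (μ := μ) Set.inter_subset_left
    | succ j ih =>
      rw [Nat.succ_mul, avoids_add, ← Set.inter_assoc]
      refine (hle (n + j * m) _ ((walkHistory_mono (by omega) _ hE).inter
        (measurableSet_walkHistory_avoids le_rfl))).trans ?_
      rw [pow_succ' θ j, mul_assoc]
      exact mul_le_mul_of_nonneg_left ih hθ.le
  have hpow : (θ ^ ((m : ℝ)⁻¹)) ^ m = θ := Real.rpow_inv_natCast_pow hθ.le hm.ne'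
  set ρ : ℝ := θ ^ ((m : ℝ)⁻¹)
  have hρ0 : 0 ≤ ρ := Real.rpow_nonneg hθ.le _
  have hρ1 : ρ < 1 := Real.rpow_lt_one hθ.le hθ1 (by positivity)
  -- `ρ` is the `m`-th root of `θ`; the factor `θ⁻¹` pays for rounding `l / m` down.
  refine ⟨θ⁻¹, ρ, by positivity, hρ0, hρ1, fun n l E hE => ?_⟩
  have h1 : μ.real (E ∩ avoids R e n l) ≤ θ ^ (l / m) * μ.real E :=
    (measureReal_mono (Set.inter_subset_inter_right _
      (avoids_anti n (Nat.div_mul_le_self l m)))).trans (hiter (l / m) n E hE)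
  refine h1.trans (mul_le_mul_of_nonneg_right ?_ measureReal_nonneg)
  have h2 : l ≤ m * (l / m + 1) := (Nat.lt_mul_div_succ l hm).le
  have h3 : ρ ^ (m * (l / m + 1)) ≤ ρ ^ l := pow_le_pow_of_le_one hρ0 hρ1.le h2
  rw [pow_mul, hpow, pow_succ'] at h3
  calc θ ^ (l / m) = θ⁻¹ * (θ * θ ^ (l / m)) := by field_simp
    _ ≤ θ⁻¹ * ρ ^ l := mul_le_mul_of_nonneg_left h3 (by positivity)

end Excursions

/-! ### Visit times and the past before a visit -/

section VisitTimes

variable {d : ℕ} {S Ω : Type*} {R : ℕ → Ω → S} {X : ℕ → Ω → EuclideanSpace ℝ (Fin d)} {e : S}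

/-- A positive value excludes the convention `sInf ∅ = 0`, so the infimum is attained, and its
minimality says that `e` is avoided before. -/
theorem visitTime_succ_eq_iff {k a : ℕ} {ω : Ω} (h : visitTime R e k ω = a) (l : ℕ) :
    visitTime R e (k + 1) ω = a + l + 1 ↔ ω ∈ avoids R e a l ∧ R (a + l + 1) ω = e := by
  rw [visitTime, h]
  constructor
  · intro h1
    have h2 : (a + l + 1) ∈ {j | a < j ∧ R j ω = e} := by
      rw [← h1]
      exact Nat.sInf_mem (Nat.nonempty_of_pos_sInf (by omega))
    refine ⟨fun i hi h3 => ?_, h2.2⟩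
    have h4 : sInf {j | a < j ∧ R j ω = e} ≤ a + i + 1 := Nat.sInf_le ⟨by omega, h3⟩
    omega
  · rintro ⟨h1, h2⟩
    refine le_antisymm (Nat.sInf_le ⟨by omega, h2⟩) (le_csInf ⟨_, by omega, h2⟩ ?_)
    rintro j ⟨h3, h4⟩
    by_contra! h5
    refine h1 (j - a - 1) (by omega) ?_
    rwa [show a + (j - a - 1) + 1 = j by omega]

theorem visitTime_lt_of_exists {ω : Ω} (h : ∀ a, ∃ l, R (a + l + 1) ω = e) :
    StrictMono fun k => visitTime R e k ω := by
  refine strictMono_nat_of_lt_succ fun k => ?_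
  obtain ⟨l, hl⟩ := h (visitTime R e k ω)
  have : sInf {j | visitTime R e k ω < j ∧ R j ω = e} ∈ {j | visitTime R e k ω < j ∧ R j ω = e} :=
    Nat.sInf_mem ⟨_, by omega, hl⟩
  exact this.1

theorem visitTime_lt_of_pos {k : ℕ} {ω : Ω} (h : 0 < visitTime R e (k + 1) ω) :
    visitTime R e k ω < visitTime R e (k + 1) ω := by
  rw [visitTime] at h
  exact (Nat.sInf_mem (Nat.nonempty_of_pos_sInf h)).1

/-- Only positive values are decomposed: for a time of index `k + 1` the value `0` can only come
from `sInf ∅`, and measurability there follows by taking complements. -/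
theorem preimage_visitTime_succ (k n : ℕ) :
    visitTime R e (k + 1) ⁻¹' {n + 1} = ⋃ (a : ℕ) (l : ℕ) (_ : a + l = n),
      visitTime R e k ⁻¹' {a} ∩ (avoids R e a l ∩ {ω | R (a + l + 1) ω = e}) := by
  ext ω
  simp only [Set.mem_preimage, Set.mem_singleton_iff, Set.mem_iUnion, exists_prop,
    Set.mem_inter_iff, Set.mem_ofPred_eq]
  constructor
  · intro h
    have h1 := visitTime_lt_of_pos (R := R) (e := e) (k := k) (ω := ω) (by omega)
    refine ⟨visitTime R e k ω, n - visitTime R e k ω, by omega, rfl,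
      (visitTime_succ_eq_iff rfl _).1 (by omega)⟩
  · rintro ⟨a, l, hal, h1, h2⟩
    rw [(visitTime_succ_eq_iff h1 l).2 h2, hal]

/-- The event that the first `k` visits to `e` take place, the last one of them at time `n`. -/
def visitEvent (R : ℕ → Ω → S) (e : S) (k n : ℕ) : Set Ω :=
  {ω | visitTime R e k ω = n ∧ ∀ j < k, visitTime R e j ω < visitTime R e (j + 1) ω}

/-- Decomposition by the time `a` of the previous visit and the number `l` of times in between. It
allows induction on `k` with fixed times only. -/
theorem visitEvent_succ (k n : ℕ) :
    visitEvent R e (k + 1) n = ⋃ (a : ℕ) (l : ℕ) (_ : a + l + 1 = n),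
      visitEvent R e k a ∩ (avoids R e a l ∩ {ω | R (a + l + 1) ω = e}) := by
  ext ω
  simp only [Set.mem_iUnion, exists_prop, Set.mem_inter_iff, Set.mem_ofPred_eq]
  constructor
  · rintro ⟨h, h'⟩
    have h1 := h' k (Nat.lt_succ_self k)
    refine ⟨visitTime R e k ω, n - visitTime R e k ω - 1, by omega,
      ⟨rfl, fun j hj => h' j (by omega)⟩, (visitTime_succ_eq_iff rfl _).1 (by omega)⟩
  · rintro ⟨a, l, hal, h1, h2⟩
    have h3 := (visitTime_succ_eq_iff h1.1 l).2 h2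
    refine ⟨h3.trans hal, fun j hj => ?_⟩
    rcases Nat.lt_succ_iff_lt_or_eq.1 hj with hj | rfl
    · exact h1.2 j hj
    · rw [h3, h1.1]; omega

/-- For `k = 0` this may fail, time `0` being a start and not a visit; this is why the first block
may have a different law. -/
theorem visitEvent_subset_of_pos {k : ℕ} (hk : 1 ≤ k) (n : ℕ) :
    visitEvent R e k n ⊆ {ω | R n ω = e} := by
  obtain ⟨k, rfl⟩ : ∃ j, k = j + 1 := ⟨k - 1, by omega⟩
  rw [visitEvent_succ]
  refine Set.iUnion_subset fun a => Set.iUnion_subset fun l => Set.iUnion_subset fun h => ?_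
  rintro ω ⟨-, -, h1⟩
  rw [← h]; exact h1

theorem disjoint_visitEvent (k : ℕ) :
    Pairwise (Function.onFun Disjoint fun n => visitEvent R e k n) := fun _ _ hmn =>
  Set.disjoint_left.2 fun _ h1 h2 => hmn (h1.1.symm.trans h2.1)

/-- The increments of the walk between two consecutive visits, preceded by their number, and
continued by `0`. -/
def blockSteps (X : ℕ → Ω → EuclideanSpace ℝ (Fin d)) (τ : ℕ → Ω → ℕ) (k : ℕ) (ω : Ω) :
    ℕ × (ℕ → EuclideanSpace ℝ (Fin d)) :=
  (blockLength τ k ω,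
    fun i => if i < blockLength τ k ω then X (τ k ω + i + 1) ω - X (τ k ω + i) ω else 0)

/-- The path with given steps. -/
def pathOfSteps (p : ℕ × (ℕ → EuclideanSpace ℝ (Fin d))) : ℕ × (ℕ → EuclideanSpace ℝ (Fin d)) :=
  (p.1, fun m => ∑ i ∈ Finset.range m, p.2 i)

theorem measurable_pathOfSteps : Measurable (pathOfSteps (d := d)) := by
  refine measurable_fst.prodMk (measurable_pi_lambda _ fun m => ?_)
  exact Finset.measurable_fun_sum _ fun i _ => (measurable_pi_apply i).comp measurable_snd

theorem pathOfSteps_blockSteps (X : ℕ → Ω → EuclideanSpace ℝ (Fin d)) (τ : ℕ → Ω → ℕ) (k : ℕ) :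
    pathOfSteps ∘ blockSteps X τ k = block X τ k := by
  funext ω
  refine Prod.ext rfl (funext fun m => ?_)
  simp only [Function.comp, pathOfSteps, blockSteps, block]
  induction m with
  | zero => simp
  | succ m ih =>
    rw [Finset.sum_range_succ, ih]
    split_ifs with h
    · rw [min_eq_left h.le, min_eq_left (Nat.succ_le_of_lt h), Nat.add_succ]
      abel
    · rw [min_eq_right (not_lt.1 h), min_eq_right (by omega), add_zero]

section Measurability

variable [MeasurableSpace Ω]

theorem measurable_blockSteps {τ : ℕ → Ω → ℕ} (hX : ∀ n, Measurable (X n))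
    (hτ : ∀ k, Measurable (τ k)) (k : ℕ) : Measurable (blockSteps X τ k) := by
  have hL := measurable_blockLength hτ k
  refine hL.prodMk (measurable_pi_lambda _ fun i => ?_)
  refine Measurable.ite (measurableSet_lt measurable_const hL) (Measurable.sub ?_ ?_)
    measurable_const
  · exact measurable_eval_random_time (Z := fun n => X (n + i + 1)) (fun n => hX _) (hτ k)
  · exact measurable_eval_random_time (Z := fun n => X (n + i)) (fun n => hX _) (hτ k)

theorem measurable_visitTime (hR : ∀ n, MeasurableSet {ω | R n ω = e}) (k : ℕ) :
    Measurable (visitTime R e k) := by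
  induction k with
  | zero => exact measurable_const
  | succ k ih =>
    have hU : ∀ a l, MeasurableSet (avoids R e a l) := fun a l => by
      rw [avoids_eq]
      exact MeasurableSet.biInter (Set.to_countable _) fun i _ => (hR _).compl
    have hpos : ∀ n, MeasurableSet (visitTime R e (k + 1) ⁻¹' {n + 1}) := fun n => by
      rw [preimage_visitTime_succ]
      exact MeasurableSet.iUnion fun a => MeasurableSet.iUnion fun l => MeasurableSet.iUnion
        fun _ => (ih (measurableSet_singleton a)).inter ((hU a l).inter (hR _))
    refine measurable_to_countable' fun n => ?_
    rcases n with _ | n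
    · have : visitTime R e (k + 1) ⁻¹' {0} = (⋃ n, visitTime R e (k + 1) ⁻¹' {n + 1})ᶜ := by
        ext ω
        simp only [Set.mem_preimage, Set.mem_singleton_iff, Set.mem_compl_iff, Set.mem_iUnion,
          not_exists]
        constructor
        · intro h n; omega
        · intro h
          by_contra h0
          exact h (visitTime R e (k + 1) ω - 1) (by omega)
      rw [this]
      exact (MeasurableSet.iUnion hpos).compl
    · exact hpos n

end Measurability

section Past

/-- The event `E` is determined by the history up to the `k`-th visit to `e`. -/
def IsVisitPast (R : ℕ → Ω → S) (X : ℕ → Ω → EuclideanSpace ℝ (Fin d)) (e : S) (k : ℕ)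
    (E : Set Ω) : Prop :=
  ∀ n, MeasurableSet[walkHistory R X n] (E ∩ visitEvent R e k n)

theorem IsVisitPast.inter {k : ℕ} {E F : Set Ω} (hE : IsVisitPast R X e k E)
    (hF : IsVisitPast R X e k F) : IsVisitPast R X e k (E ∩ F) := fun n => by
  rw [Set.inter_inter_distrib_right]; exact (hE n).inter (hF n)

variable [Finite S]

theorem measurableSet_walkHistory_visitEvent (k n : ℕ) :
    MeasurableSet[walkHistory R X n] (visitEvent R e k n) := by
  induction k generalizing n with
  | zero =>
    by_cases h : 0 = n
    · subst h
      convert @MeasurableSet.univ _ (walkHistory R X 0)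
      ext ω; simp [visitEvent, visitTime]
    · convert @MeasurableSet.empty _ (walkHistory R X n)
      ext ω; simp [visitEvent, visitTime, h]
  | succ k ih =>
    rw [visitEvent_succ]
    refine MeasurableSet.iUnion fun a => MeasurableSet.iUnion fun l => MeasurableSet.iUnion
      fun h => ?_
    exact (walkHistory_mono (by omega) _ (ih a)).inter
      ((measurableSet_walkHistory_avoids (by omega)).inter
        (measurableSet_walkHistory_chain (by omega) e))

theorem IsVisitPast.univ (k : ℕ) : IsVisitPast R X e k Set.univ := fun n => by
  rw [Set.univ_inter]; exact measurableSet_walkHistory_visitEvent k n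

theorem IsVisitPast.succ {k : ℕ} {E : Set Ω} (hE : IsVisitPast R X e k E) :
    IsVisitPast R X e (k + 1) E := fun n => by
  simp only [visitEvent_succ, Set.inter_iUnion, ← Set.inter_assoc]
  refine MeasurableSet.iUnion fun a => MeasurableSet.iUnion fun l => MeasurableSet.iUnion
      fun h => ?_
  exact ((walkHistory_mono (by omega) _ (hE a)).inter
    (measurableSet_walkHistory_avoids (by omega))).inter
      (measurableSet_walkHistory_chain (by omega) e)

theorem IsVisitPast.mono {k k' : ℕ} (h : k ≤ k') {E : Set Ω} (hE : IsVisitPast R X e k E) :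
    IsVisitPast R X e k' E := Nat.le_induction hE (fun _ _ => IsVisitPast.succ) k' h

/-- Once the times `a` and `n` of two consecutive visits are fixed, the block is an explicit
function of the increments between them, all known at time `n`. -/
theorem isVisitPast_blockSteps (k : ℕ) {D : Set (ℕ × (ℕ → EuclideanSpace ℝ (Fin d)))}
    (hD : MeasurableSet D) :
    IsVisitPast R X e (k + 1) (blockSteps X (visitTime R e) k ⁻¹' D) := fun n => by
  have : blockSteps X (visitTime R e) k ⁻¹' D ∩ visitEvent R e (k + 1) n =
      ⋃ (a : ℕ) (l : ℕ) (_ : a + l + 1 = n), ((fun ω => (l + 1, fun i =>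
        if i < l + 1 then X (a + i + 1) ω - X (a + i) ω else 0)) ⁻¹' D) ∩
        (visitEvent R e k a ∩ (avoids R e a l ∩ {ω | R (a + l + 1) ω = e})) := by
    simp only [visitEvent_succ, Set.inter_iUnion]
    refine Set.iUnion_congr fun a => Set.iUnion_congr fun l => Set.iUnion_congr fun h => ?_
    ext ω
    refine and_congr_left fun h1 => ?_
    have h2 := (visitTime_succ_eq_iff h1.1.1 l).2 h1.2
    have h3 : blockLength (visitTime R e) k ω = l + 1 := by
      rw [blockLength, h2, h1.1.1]; omega
    simp only [Set.mem_preimage, blockSteps, h3, h1.1.1]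
  rw [this]
  refine MeasurableSet.iUnion fun a => MeasurableSet.iUnion fun l => MeasurableSet.iUnion
      fun h => MeasurableSet.inter ?_ ?_
  · let : MeasurableSpace Ω := walkHistory R X n
    refine (measurable_const.prodMk (measurable_pi_lambda _ fun i => ?_)) hD
    split_ifs with hi
    · exact measurable_walkHistory_increment (by omega)
    · exact measurable_const
  · exact (walkHistory_mono (by omega) _ (measurableSet_walkHistory_visitEvent k a)).inter
      ((measurableSet_walkHistory_avoids (by omega)).inter
        (measurableSet_walkHistory_chain (by omega) e))

end Past

end VisitTimes

/-! ### Regeneration at the visits to a state -/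

section Regeneration

variable {d : ℕ}

/-- The sets of sequences of steps of given length with the steps in given sets. -/
def stepRectangles (d : ℕ) : Set (Set (ℕ × (ℕ → EuclideanSpace ℝ (Fin d)))) :=
  {D | ∃ (l : ℕ) (A : ℕ → Set (EuclideanSpace ℝ (Fin d))), (∀ i, MeasurableSet (A i)) ∧
    D = {l} ×ˢ Set.univ.pi A}

theorem measurableSet_of_mem_stepRectangles {D : Set (ℕ × (ℕ → EuclideanSpace ℝ (Fin d)))}
    (hD : D ∈ stepRectangles d) : MeasurableSet D := by
  obtain ⟨l, A, hA, rfl⟩ := hD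
  exact (measurableSet_singleton l).prod (MeasurableSet.univ_pi hA)

theorem isPiSystem_stepRectangles : IsPiSystem (stepRectangles d) := by
  rintro _ ⟨l, A, hA, rfl⟩ _ ⟨l', A', hA', rfl⟩ ⟨p, h1, h2⟩
  have hl : l' = l := h2.1.symm.trans h1.1
  refine ⟨l, fun i => A i ∩ A' i, fun i => (hA i).inter (hA' i), ?_⟩
  rw [hl, ← Set.prod_inter, ← Set.pi_inter_distrib]

theorem generateFrom_stepRectangles :
    (Prod.instMeasurableSpace : MeasurableSpace (ℕ × (ℕ → EuclideanSpace ℝ (Fin d)))) =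
      MeasurableSpace.generateFrom (stepRectangles d) := by
  classical
  refine le_antisymm ?_ (MeasurableSpace.generateFrom_le ?_)
  · refine sup_le (measurable_iff_comap_le.1 ?_) (measurable_iff_comap_le.1 ?_)
    · refine @measurable_to_countable' _ _ _ _ (MeasurableSpace.generateFrom (stepRectangles d))
        _ fun l => ?_
      refine MeasurableSpace.measurableSet_generateFrom
        ⟨l, fun _ => Set.univ, fun _ => MeasurableSet.univ, ?_⟩
      ext p; simp
    · refine @measurable_pi_lambda _ _ _ (MeasurableSpace.generateFrom (stepRectangles d)) _ _
        fun i B hB => ?_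
      have : (fun p : ℕ × (ℕ → EuclideanSpace ℝ (Fin d)) => p.2 i) ⁻¹' B =
          ⋃ l : ℕ, {l} ×ˢ Set.univ.pi fun j => if j = i then B else Set.univ := by
        ext p
        simp only [Set.mem_preimage, Set.mem_iUnion, Set.mem_prod, Set.mem_singleton_iff,
          exists_eq_left', Set.mem_pi, Set.mem_univ, forall_true_left]
        constructor
        · intro h j
          split_ifs with hj
          · rw [hj]; exact h
          · trivial
        · intro h
          simpa using h i
      rw [this]
      refine MeasurableSet.iUnion fun l =>
        MeasurableSpace.measurableSet_generateFrom ⟨l, _, fun j => ?_, rfl⟩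
      split_ifs
      · exact hB
      · exact MeasurableSet.univ
  · exact fun D hD => measurableSet_of_mem_stepRectangles hD

variable {S Ω : Type*} {R : ℕ → Ω → S} {X : ℕ → Ω → EuclideanSpace ℝ (Fin d)} {e : S} [Finite S]
  [MeasurableSpace Ω] {μ : Measure Ω} {P : S → S → ℝ}
  {ν : S → S → Measure (EuclideanSpace ℝ (Fin d))} [IsProbabilityMeasure μ]
  [∀ r r', IsProbabilityMeasure (ν r r')]

/-- The probability of avoiding `e` for `l` steps tends to `0` with `l`. -/
theorem IsHiddenMarkovWalk.ae_exists_visit (hP : IsTransitionMatrix P)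
    (hirr : IsIrreducibleChain P) (h : IsHiddenMarkovWalk μ P ν R X) (e : S) :
    ∀ᵐ ω ∂μ, ∀ a, ∃ l, R (a + l + 1) ω = e := by
  obtain ⟨C, ρ, -, hρ0, hρ1, hle⟩ := h.exists_measureReal_avoids_le_geometric hP hirr e
  refine ae_all_iff.2 fun a => ?_
  rw [ae_iff, ← measureReal_eq_zero_iff]
  have h1 : ∀ l, μ.real {ω | ¬ ∃ l, R (a + l + 1) ω = e} ≤ C * ρ ^ l := fun l => by
    have h2 := hle a l Set.univ MeasurableSet.univ
    rw [Set.univ_inter, probReal_univ, mul_one] at h2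
    refine (measureReal_mono fun ω hω => ?_).trans h2
    exact fun i _ hi => hω ⟨i, hi⟩
  have h3 : Tendsto (fun l : ℕ => C * ρ ^ l) atTop (𝓝 (C * 0)) :=
    (tendsto_pow_atTop_nhds_zero_of_lt_one hρ0 hρ1).const_mul C
  rw [mul_zero] at h3
  exact le_antisymm (ge_of_tendsto' h3 h1) measureReal_nonneg

theorem IsHiddenMarkovWalk.ae_strictMono_visitTime (hP : IsTransitionMatrix P)
    (hirr : IsIrreducibleChain P) (h : IsHiddenMarkovWalk μ P ν R X) (e : S) :
    ∀ᵐ ω ∂μ, StrictMono fun k => visitTime R e k ω :=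
  (h.ae_exists_visit hP hirr e).mono fun _ => visitTime_lt_of_exists

/-- Splitting by the almost surely finite time of the `k`-th visit replaces the strong Markov
property: statements at a random time become sums of statements at fixed times. -/
theorem IsHiddenMarkovWalk.tsum_measure_inter_visitEvent (hP : IsTransitionMatrix P)
    (hirr : IsIrreducibleChain P) (h : IsHiddenMarkovWalk μ P ν R X) (e : S) (k : ℕ) {E : Set Ω}
    (hE : MeasurableSet E) : ∑' n, μ (E ∩ visitEvent R e k n) = μ E := by
  rw [← measure_iUnion (fun m n hmn => ((disjoint_visitEvent k hmn).mono
    Set.inter_subset_right Set.inter_subset_right)) fun n => hE.inter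
      (h.walkHistory_le n _ (measurableSet_walkHistory_visitEvent k n))]
  refine measure_congr ?_
  filter_upwards [h.ae_strictMono_visitTime hP hirr e] with ω hω
  refine propext ⟨fun h1 => ?_, fun h1 => ?_⟩
  · obtain ⟨n, hn⟩ := Set.mem_iUnion.1 h1
    exact hn.1
  · exact Set.mem_iUnion.2 ⟨visitTime R e k ω, h1, rfl, fun j _ => hω (Nat.lt_succ_self j)⟩

/-- When the `k`-th visit is at time `n`, a long block means that `e` is avoided from `n` on. The
estimate given the past is uniform in `n`, so summing over `n` gives the same constants for all `k`,
the first block included. -/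
theorem IsHiddenMarkovWalk.hasGeometricTails (hP : IsTransitionMatrix P)
    (hirr : IsIrreducibleChain P) (h : IsHiddenMarkovWalk μ P ν R X) (e : S) :
    HasGeometricTails μ (visitTime R e) := by
  obtain ⟨C, ρ, hC, hρ0, hρ1, hle⟩ := h.exists_measureReal_avoids_le_geometric hP hirr e
  refine ⟨C, ρ, hρ0, hρ1, fun k N => ?_⟩
  have hG : ∀ n, MeasurableSet[walkHistory R X n] (visitEvent R e k n) :=
    measurableSet_walkHistory_visitEvent k
  have hbound : 0 ≤ C * ρ ^ N := by positivity
  have hlt : MeasurableSet {ω | N < blockLength (visitTime R e) k ω} :=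
    measurableSet_lt measurable_const
      (measurable_blockLength (measurable_visitTime fun n => h.hidden_chain.measurable n e) k)
  rw [measureReal_def, ← h.tsum_measure_inter_visitEvent hP hirr e k hlt]
  refine ENNReal.toReal_le_of_le_ofReal hbound ?_
  calc ∑' n, μ ({ω | N < blockLength (visitTime R e) k ω} ∩ visitEvent R e k n)
      ≤ ∑' n, ENNReal.ofReal (C * ρ ^ N) * μ (Set.univ ∩ visitEvent R e k n) := by
        refine ENNReal.tsum_le_tsum fun n => ?_
        have h1 : {ω | N < blockLength (visitTime R e) k ω} ∩ visitEvent R e k n ⊆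
            visitEvent R e k n ∩ avoids R e n N := by
          rintro ω ⟨h1, h2⟩
          refine ⟨h2, ?_⟩
          have h3 : N < visitTime R e (k + 1) ω - visitTime R e k ω := h1
          rw [h2.1] at h3
          refine avoids_anti n ?_ ((visitTime_succ_eq_iff h2.1
            (visitTime R e (k + 1) ω - n - 1)).1 (by omega)).1
          omega
        refine (measure_mono h1).trans ?_
        have h4 := hle n N _ (hG n)
        rw [Set.univ_inter, ← ofReal_measureReal, ← ofReal_measureReal,
          ← ENNReal.ofReal_mul hbound]
        exact ENNReal.ofReal_le_ofReal h4
    _ = ENNReal.ofReal (C * ρ ^ N) := by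
        rw [ENNReal.tsum_mul_left, h.tsum_measure_inter_visitEvent hP hirr e k MeasurableSet.univ,
          measure_univ, mul_one]

/-- The law of the steps between two visits, conditionally on the past, does not depend on the
past nor on the number of the visit. -/
theorem IsHiddenMarkovWalk.exists_measure_inter_blockSteps (hP : IsTransitionMatrix P)
    (hirr : IsIrreducibleChain P) (h : IsHiddenMarkovWalk μ P ν R X) (e : S)
    {D : Set (ℕ × (ℕ → EuclideanSpace ℝ (Fin d)))} (hD : D ∈ stepRectangles d) :
    ∃ q : ENNReal, ∀ k, 1 ≤ k → ∀ E : Set Ω, MeasurableSet E → IsVisitPast R X e k E →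
      μ (E ∩ blockSteps X (visitTime R e) k ⁻¹' D) = μ E * q := by
  obtain ⟨l, A, hA, rfl⟩ := hD
  have hτ := measurable_visitTime fun n => h.hidden_chain.measurable n e
  -- Blocks of length zero have probability zero, as visit times increase strictly almost surely.
  rcases l with _ | l
  · refine ⟨0, fun k _ E _ _ => ?_⟩
    rw [mul_zero]
    refine measure_mono_null Set.inter_subset_right ?_
    refine measure_mono_null ?_ (ae_iff.1 (h.ae_strictMono_visitTime hP hirr e))
    intro ω hω hmono
    have h1 : blockLength (visitTime R e) k ω = 0 := hω.1
    have h2 := hmono (Nat.lt_succ_self k)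
    simp only [blockLength, Nat.succ_eq_add_one] at h1 h2
    omega
  -- Beyond the end of the block the recorded steps are `0`: either the later sets impose nothing,
  -- or the event is empty and `q = 0`.
  by_cases h0 : ∀ i, l < i → (0 : EuclideanSpace ℝ (Fin d)) ∈ A i
  · obtain ⟨q, hq⟩ := h.exists_measure_inter_excursion hP.nonneg e l A hA
    refine ⟨q e, fun k hk E hE hEk => ?_⟩
    have hm : MeasurableSet (E ∩ blockSteps X (visitTime R e) k ⁻¹' ({l + 1} ×ˢ Set.univ.pi A)) :=
      hE.inter (measurable_blockSteps h.measurable hτ k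
        ((measurableSet_singleton _).prod (MeasurableSet.univ_pi hA)))
    rw [← h.tsum_measure_inter_visitEvent hP hirr e k hm,
      ← h.tsum_measure_inter_visitEvent hP hirr e k hE, ← ENNReal.tsum_mul_right]
    refine tsum_congr fun n => ?_
    have hR : E ∩ visitEvent R e k n ∩ {ω | R n ω = e} = E ∩ visitEvent R e k n :=
      Set.inter_eq_left.2 fun ω hω => visitEvent_subset_of_pos hk n hω.2
    have hq' := hq n _ (hEk n) e
    rw [hR] at hq'
    rw [← hq', Set.inter_right_comm]
    congr 1
    ext ω
    refine and_congr_right fun hω => ?_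
    have hn : visitTime R e k ω = n := hω.2.1
    have hL : blockLength (visitTime R e) k ω = l + 1 ↔ ω ∈ avoids R e n l ∧
        R (n + l + 1) ω = e := by
      rw [← visitTime_succ_eq_iff hn, blockLength, hn]; omega
    simp only [Set.mem_preimage, Set.mem_prod, Set.mem_singleton_iff, Set.mem_pi, Set.mem_univ,
      forall_true_left, blockSteps, hn]
    constructor
    · rintro ⟨h1, h2⟩
      refine ⟨(hL.1 h1).1, (hL.1 h1).2, fun i hi => ?_⟩
      have := h2 i
      rwa [if_pos (by omega)] at this
    · rintro ⟨h1, h2, h3⟩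
      have h4 := hL.2 ⟨h1, h2⟩
      refine ⟨h4, fun i => ?_⟩
      rw [h4]
      split_ifs with hi
      · exact h3 i (by omega)
      · exact h0 i (by omega)
  · push Not at h0
    obtain ⟨i, hi, h0⟩ := h0
    refine ⟨0, fun k _ E _ _ => ?_⟩
    rw [mul_zero]
    convert measure_empty (μ := μ)
    refine Set.eq_empty_of_forall_notMem fun ω hω => h0 ?_
    have h1 : blockLength (visitTime R e) k ω = l + 1 := hω.2.1
    have h2 := hω.2.2 i (Set.mem_univ i)
    simp only [blockSteps, h1] at h2
    rwa [if_neg (by omega)] at h2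

/-- On rectangles the factor `q` is the same for `E` and for the whole space, so it is the
probability of the rectangle; a π-system argument extends this to all `D`. -/
theorem IsHiddenMarkovWalk.measure_inter_blockSteps (hP : IsTransitionMatrix P)
    (hirr : IsIrreducibleChain P) (h : IsHiddenMarkovWalk μ P ν R X) (e : S) {k : ℕ} (hk : 1 ≤ k)
    {E : Set Ω} (hE : MeasurableSet E) (hEk : IsVisitPast R X e k E)
    {D : Set (ℕ × (ℕ → EuclideanSpace ℝ (Fin d)))} (hD : MeasurableSet D) :
    μ (E ∩ blockSteps X (visitTime R e) k ⁻¹' D) =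
      μ E * μ (blockSteps X (visitTime R e) k ⁻¹' D) := by
  have hτ := measurable_visitTime fun n => h.hidden_chain.measurable n e
  have hm := measurable_blockSteps h.measurable hτ k
  have key : (μ.restrict E).map (blockSteps X (visitTime R e) k) =
      μ E • μ.map (blockSteps X (visitTime R e) k) := by
    refine ext_of_generate_finite _ generateFrom_stepRectangles isPiSystem_stepRectangles
      (fun D hD => ?_) ?_
    · have hDm : MeasurableSet D := measurableSet_of_mem_stepRectangles hD
      obtain ⟨q, hq⟩ := h.exists_measure_inter_blockSteps hP hirr e hD
      have h1 := hq k hk _ MeasurableSet.univ (IsVisitPast.univ k)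
      rw [measure_univ, one_mul, Set.univ_inter] at h1
      rw [Measure.smul_apply, Measure.map_apply hm hDm, Measure.map_apply hm hDm,
        Measure.restrict_apply (hm hDm), h1, Set.inter_comm, hq k hk E hE hEk, smul_eq_mul]
    · rw [Measure.smul_apply, Measure.map_apply hm MeasurableSet.univ,
        Measure.map_apply hm MeasurableSet.univ]
      simp
  have := congrArg (fun m => m D) key
  beta_reduce at this
  rwa [Measure.smul_apply, Measure.map_apply hm hD, Measure.map_apply hm hD,
    Measure.restrict_apply (hm hD), smul_eq_mul, Set.inter_comm] at this

theorem IsHiddenMarkovWalk.identDistrib_blockSteps (hP : IsTransitionMatrix P)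
    (hirr : IsIrreducibleChain P) (h : IsHiddenMarkovWalk μ P ν R X) (e : S) {k : ℕ} (hk : 1 ≤ k) :
    IdentDistrib (blockSteps X (visitTime R e) k) (blockSteps X (visitTime R e) 1) μ μ := by
  have hτ := measurable_visitTime fun n => h.hidden_chain.measurable n e
  have hm := measurable_blockSteps h.measurable hτ
  refine ⟨(hm k).aemeasurable, (hm 1).aemeasurable, ?_⟩
  refine ext_of_generate_finite _ generateFrom_stepRectangles isPiSystem_stepRectangles
    (fun D hD => ?_) ?_
  · have hDm : MeasurableSet D := measurableSet_of_mem_stepRectangles hD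
    obtain ⟨q, hq⟩ := h.exists_measure_inter_blockSteps hP hirr e hD
    have h1 := hq k hk _ MeasurableSet.univ (IsVisitPast.univ k)
    have h2 := hq 1 le_rfl _ MeasurableSet.univ (IsVisitPast.univ 1)
    rw [Set.univ_inter] at h1 h2
    rw [Measure.map_apply (hm k) hDm, Measure.map_apply (hm 1) hDm, h1, h2]
  · rw [Measure.map_apply (hm k) MeasurableSet.univ, Measure.map_apply (hm 1) MeasurableSet.univ]
    simp

theorem IsHiddenMarkovWalk.iIndepFun_blockSteps (hP : IsTransitionMatrix P)
    (hirr : IsIrreducibleChain P) (h : IsHiddenMarkovWalk μ P ν R X) (e : S) :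
    iIndepFun (fun k => blockSteps X (visitTime R e) k) μ := by
  have hτ := measurable_visitTime fun n => h.hidden_chain.measurable n e
  have hm := measurable_blockSteps h.measurable hτ
  rw [iIndepFun_iff_measure_inter_preimage_eq_mul]
  intro s
  -- Blocks are added in increasing order, so that the earlier ones belong to the past of the new
  -- one. Block `0` can only be added to the empty set, so nothing about its law is needed.
  induction s using Finset.induction_on_max with
  | empty => simp
  | insert a s hs ih =>
    intro D hD
    have ha : a ∉ s := fun h1 => lt_irrefl _ (hs a h1)
    have hDs : ∀ i ∈ s, MeasurableSet (D i) := fun i hi => hD i (Finset.mem_insert_of_mem hi)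
    rw [Finset.prod_insert ha, ← ih hDs, Finset.set_biInter_insert, Set.inter_comm, mul_comm]
    rcases Nat.eq_zero_or_pos a with rfl | hpos
    · have : s = ∅ := Finset.eq_empty_of_forall_notMem fun i hi => by simpa using hs i hi
      simp [this]
    · refine h.measure_inter_blockSteps hP hirr e hpos
        (Finset.measurableSet_biInter s fun i hi => hm i (hDs i hi)) ?_
        (hD a (Finset.mem_insert_self a s))
      have hpast : ∀ t ⊆ s, IsVisitPast R X e a
          (⋂ i ∈ t, blockSteps X (visitTime R e) i ⁻¹' D i) := by
        intro t
        induction t using Finset.induction_on with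
        | empty => intro _; simpa using IsVisitPast.univ a
        | insert j t hj iht =>
          intro hjt
          rw [Finset.set_biInter_insert]
          have hjs : j ∈ s := hjt (Finset.mem_insert_self j t)
          exact ((isVisitPast_blockSteps j (hDs j hjs)).mono (hs j hjs)).inter
            (iht ((Finset.subset_insert j t).trans hjt))
      exact hpast s subset_rfl

theorem IsHiddenMarkovWalk.isRegenerationStructure (hP : IsTransitionMatrix P)
    (hirr : IsIrreducibleChain P) (h : IsHiddenMarkovWalk μ P ν R X) (e : S) :
    IsRegenerationStructure μ X (visitTime R e) where
  measurable := measurable_visitTime fun n => h.hidden_chain.measurable n e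
  zero := ae_of_all _ fun _ => rfl
  strictMono := h.ae_strictMono_visitTime hP hirr e
  indep := by
    have := (h.iIndepFun_blockSteps hP hirr e).comp (fun _ => pathOfSteps)
      fun _ => measurable_pathOfSteps
    simpa only [pathOfSteps_blockSteps] using this
  identDistrib k hk := by
    have := (h.identDistrib_blockSteps hP hirr e hk).comp measurable_pathOfSteps
    simpa only [pathOfSteps_blockSteps] using this

theorem IsHiddenMarkovWalk.ae_norm_jump_le (hP : ∀ x y, 0 ≤ P x y)
    (h : IsHiddenMarkovWalk μ P ν R X) {K : ℝ}
    (hK : ∀ r r', 0 < P r r' → ∀ᵐ x ∂ν r r', ‖x‖ ≤ K) :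
    ∀ᵐ ω ∂μ, ∀ n, ‖X (n + 1) ω - X n ω‖ ≤ K := by
  refine ae_all_iff.2 fun n => ?_
  rw [ae_iff]
  have hB : MeasurableSet {x : EuclideanSpace ℝ (Fin d) | ¬ ‖x‖ ≤ K} :=
    (measurableSet_le measurable_norm measurable_const).compl
  have hcover : {ω | ¬ ‖X (n + 1) ω - X n ω‖ ≤ K} ⊆ ⋃ (s : S) (s' : S),
      Set.univ ∩ {ω | R n ω = s} ∩
        {ω | R (n + 1) ω = s' ∧ X (n + 1) ω - X n ω ∈ {x | ¬ ‖x‖ ≤ K}} := fun ω hω =>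
    Set.mem_iUnion.2 ⟨R n ω, Set.mem_iUnion.2 ⟨R (n + 1) ω, ⟨trivial, rfl⟩, rfl, hω⟩⟩
  refine measure_mono_null hcover (measure_iUnion_null fun s => measure_iUnion_null fun s' => ?_)
  rw [h.measure_inter_step hP MeasurableSet.univ s s' hB]
  rcases (hP s s').eq_or_lt with h0 | h0
  · simp [← h0]
  · rw [ae_iff.1 (hK s s' h0)]
    simp

theorem IsHiddenMarkovWalk.roughInvarianceConditions (hP : IsTransitionMatrix P)
    (hirr : IsIrreducibleChain P) (h : IsHiddenMarkovWalk μ P ν R X) {K : ℝ}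
    (hK : ∀ r r', 0 < P r r' → ∀ᵐ x ∂ν r r', ‖x‖ ≤ K) (e : S) :
    RoughInvarianceConditions μ X (visitTime R e) :=
  (h.isRegenerationStructure hP hirr e).roughInvarianceConditions h.measurable
    (h.hasGeometricTails hP hirr e) ⟨K, h.ae_norm_jump_le hP.nonneg hK⟩

end Regeneration

/-! ### Periodic graphs as hidden Markov walks -/

section PeriodicGraphs

variable {d : ℕ} {Λ : Submodule ℤ (EuclideanSpace ℝ (Fin d))} {V : Type*} [AddAction Λ V]
  {G : PeriodicGraph Λ V} {P : V → V → ℝ}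

theorem latticeClass_vadd (γ : Λ) (x : V) : latticeClass Λ (γ +ᵥ x) = latticeClass Λ x :=
  AddAction.orbitRel.Quotient.quotient_vadd_eq

theorem latticeClass_out (r : AddAction.orbitRel.Quotient Λ V) : latticeClass Λ r.out = r :=
  Quotient.out_eq r

theorem exists_vadd_eq_of_latticeClass_eq {x y : V} (h : latticeClass Λ x = latticeClass Λ y) :
    ∃ γ : Λ, γ +ᵥ y = x := by
  have h1 : (AddAction.orbitRel Λ V) x y := Quotient.exact h
  exact AddAction.mem_orbit_iff.1 (AddAction.orbitRel_apply.1 h1)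

/-- There are finitely many orbits, and the lattice is countable because it is discrete and
separable. Countability permits summing over the present vertex. -/
theorem PeriodicGraph.countable [DiscreteTopology Λ] (G : PeriodicGraph Λ V) : Countable V := by
  have hΛ : Countable Λ := TopologicalSpace.separableSpace_iff_countable.1 inferInstance
  have := G.finite_quotient
  have hsurj : Function.Surjective
      fun p : Λ × AddAction.orbitRel.Quotient Λ V => p.1 +ᵥ p.2.out := fun x => by
    obtain ⟨γ, hγ⟩ := exists_vadd_eq_of_latticeClass_eq (latticeClass_out (latticeClass Λ x)).symm
    exact ⟨(γ, latticeClass Λ x), hγ⟩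
  exact hsurj.countable

open Classical in
/-- The law of the displacement of a jump from `x`, restricted to the jumps into the class `r`. -/
noncomputable def PeriodicGraph.jumpMeasure (G : PeriodicGraph Λ V) (P : V → V → ℝ) (x : V)
    (r : AddAction.orbitRel.Quotient Λ V) : Measure (EuclideanSpace ℝ (Fin d)) :=
  Measure.sum fun y : V =>
    (if latticeClass Λ y = r then ENNReal.ofReal (P x y) else 0) • Measure.dirac (G.pos y - G.pos x)

/-- The transition matrix of the chain on the classes modulo the lattice. -/
noncomputable def PeriodicGraph.quotientMatrix (G : PeriodicGraph Λ V) (P : V → V → ℝ)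
    (r r' : AddAction.orbitRel.Quotient Λ V) : ℝ :=
  (G.jumpMeasure P r.out r').real Set.univ

open Classical in
/-- The law of the displacement of a jump from the class `r` to the class `r'`. -/
noncomputable def PeriodicGraph.jumpLaw (G : PeriodicGraph Λ V) (P : V → V → ℝ)
    (r r' : AddAction.orbitRel.Quotient Λ V) : Measure (EuclideanSpace ℝ (Fin d)) :=
  if G.jumpMeasure P r.out r' Set.univ = 0 then Measure.dirac 0
  else (G.jumpMeasure P r.out r' Set.univ)⁻¹ • G.jumpMeasure P r.out r'

open Classical in
theorem PeriodicGraph.jumpMeasure_apply (G : PeriodicGraph Λ V) (P : V → V → ℝ) (x : V)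
    (r : AddAction.orbitRel.Quotient Λ V) {B : Set (EuclideanSpace ℝ (Fin d))}
    (hB : MeasurableSet B) :
    G.jumpMeasure P x r B = ∑' y, (if latticeClass Λ y = r then ENNReal.ofReal (P x y) else 0) *
      Measure.dirac (G.pos y - G.pos x) B := by
  rw [jumpMeasure, Measure.sum_apply _ hB]
  rfl

/-- Translating both endpoints changes neither the class of the target, nor the transition
probability, nor the displacement; reindex the sum by this translation. -/
theorem PeriodicGraph.IsTransition.jumpMeasure_vadd (hG : G.IsTransition P) (γ : Λ) (x : V)
    (r : AddAction.orbitRel.Quotient Λ V) :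
    G.jumpMeasure P (γ +ᵥ x) r = G.jumpMeasure P x r := by
  classical
  ext B hB
  rw [G.jumpMeasure_apply P _ r hB, G.jumpMeasure_apply P _ r hB,
    ← (AddAction.toPerm γ).tsum_eq]
  refine tsum_congr fun y => ?_
  rw [AddAction.toPerm_apply, latticeClass_vadd, hG.vadd, G.pos_vadd, G.pos_vadd,
    add_sub_add_left_eq_sub]

theorem PeriodicGraph.IsTransition.jumpMeasure_eq (hG : G.IsTransition P) {x : V}
    {r : AddAction.orbitRel.Quotient Λ V} (hx : latticeClass Λ x = r)
    (r' : AddAction.orbitRel.Quotient Λ V) :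
    G.jumpMeasure P x r' = G.jumpMeasure P r.out r' := by
  obtain ⟨γ, rfl⟩ := exists_vadd_eq_of_latticeClass_eq (hx.trans (latticeClass_out r).symm)
  exact hG.jumpMeasure_vadd γ _ r'

theorem IsTransitionMatrix.tsum_ofReal {S : Type*} {P : S → S → ℝ} (hP : IsTransitionMatrix P)
    (x : S) : ∑' y, ENNReal.ofReal (P x y) = 1 := by
  rw [← ENNReal.ofReal_tsum_of_nonneg (hP.nonneg x) (hP.hasSum_one x).summable,
    (hP.hasSum_one x).tsum_eq, ENNReal.ofReal_one]

theorem PeriodicGraph.IsTransition.tsum_jumpMeasure_univ (hG : G.IsTransition P) (x : V) :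
    ∑' r, G.jumpMeasure P x r Set.univ = 1 := by
  classical
  simp only [G.jumpMeasure_apply P x _ MeasurableSet.univ, measure_univ, mul_one]
  rw [ENNReal.tsum_comm, ← hG.isTransitionMatrix.tsum_ofReal x]
  refine tsum_congr fun y => ?_
  simp only [eq_comm (a := latticeClass Λ y)]
  exact tsum_ite_eq _ fun _ => ENNReal.ofReal (P x y)

theorem PeriodicGraph.IsTransition.jumpMeasure_univ_le (hG : G.IsTransition P) (x : V)
    (r : AddAction.orbitRel.Quotient Λ V) : G.jumpMeasure P x r Set.univ ≤ 1 := by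
  rw [← hG.tsum_jumpMeasure_univ x]
  exact ENNReal.le_tsum r

theorem PeriodicGraph.IsTransition.jumpMeasure_univ_ne_top (hG : G.IsTransition P) (x : V)
    (r : AddAction.orbitRel.Quotient Λ V) : G.jumpMeasure P x r Set.univ ≠ ⊤ :=
  ((hG.jumpMeasure_univ_le x r).trans_lt ENNReal.one_lt_top).ne

theorem PeriodicGraph.IsTransition.isProbabilityMeasure_jumpLaw (hG : G.IsTransition P)
    (r r' : AddAction.orbitRel.Quotient Λ V) : IsProbabilityMeasure (G.jumpLaw P r r') := by
  rw [jumpLaw]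
  split_ifs with h
  · infer_instance
  · exact ⟨by rw [Measure.smul_apply, smul_eq_mul,
      ENNReal.inv_mul_cancel h (hG.jumpMeasure_univ_ne_top _ _)]⟩

/-- The normalization cancels; where the mass is zero, the arbitrary Dirac law is multiplied by
zero. -/
theorem PeriodicGraph.IsTransition.quotientMatrix_mul_jumpLaw (hG : G.IsTransition P)
    (r r' : AddAction.orbitRel.Quotient Λ V) (B : Set (EuclideanSpace ℝ (Fin d))) :
    G.quotientMatrix P r r' * (G.jumpLaw P r r').real B = (G.jumpMeasure P r.out r').real B := by
  have htop := hG.jumpMeasure_univ_ne_top r.out r'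
  rw [quotientMatrix, jumpLaw]
  split_ifs with h
  · have h1 : G.jumpMeasure P r.out r' B = 0 := measure_mono_null (Set.subset_univ B) h
    simp [measureReal_def, h, h1]
  · simp only [measureReal_def]
    rw [Measure.smul_apply, smul_eq_mul, ← ENNReal.toReal_mul, ← mul_assoc,
      ENNReal.mul_inv_cancel h htop, one_mul]

theorem PeriodicGraph.IsTransition.isTransitionMatrix_quotientMatrix (hG : G.IsTransition P) :
    IsTransitionMatrix (G.quotientMatrix P) where
  nonneg _ _ := measureReal_nonneg
  hasSum_one r := by
    have := G.finite_quotient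
    have := Fintype.ofFinite (AddAction.orbitRel.Quotient Λ V)
    have h1 := hG.tsum_jumpMeasure_univ r.out
    rw [tsum_fintype] at h1
    have h2 : ∑ r', G.quotientMatrix P r r' = 1 := by
      simp only [quotientMatrix, measureReal_def]
      rw [← ENNReal.toReal_sum fun _ _ => hG.jumpMeasure_univ_ne_top _ _, h1, ENNReal.toReal_one]
    rw [← h2]
    exact hasSum_fintype _

theorem PeriodicGraph.IsTransition.quotientMatrix_pos (hG : G.IsTransition P) {x y : V}
    (h : 0 < P x y) : 0 < G.quotientMatrix P (latticeClass Λ x) (latticeClass Λ y) := by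
  classical
  rw [quotientMatrix, ← hG.jumpMeasure_eq rfl, measureReal_def]
  refine ENNReal.toReal_pos (fun h0 => ?_) (hG.jumpMeasure_univ_ne_top _ _)
  rw [G.jumpMeasure_apply P x _ MeasurableSet.univ, ENNReal.tsum_eq_zero] at h0
  have := h0 y
  rw [if_pos rfl, measure_univ, mul_one, ENNReal.ofReal_eq_zero] at this
  linarith

theorem PeriodicGraph.IsTransition.isIrreducibleChain_quotientMatrix (hG : G.IsTransition P)
    (hirr : IsIrreducibleMod Λ P) : IsIrreducibleChain (G.quotientMatrix P) := by
  intro r r'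
  obtain ⟨γ, h⟩ := hirr r.out r'.out
  have h1 := Relation.ReflTransGen.lift (p := fun a b => 0 < G.quotientMatrix P a b)
    (latticeClass Λ) (fun x y hxy => hG.quotientMatrix_pos hxy) _ _ h
  rwa [Function.onFun, latticeClass_vadd, latticeClass_out, latticeClass_out] at h1

/-- Finitely many representatives with finitely many neighbours leave finitely many displacements.
-/
theorem PeriodicGraph.IsTransition.exists_jumpLaw_bound (hG : G.IsTransition P) :
    ∃ K : ℝ, ∀ r r', 0 < G.quotientMatrix P r r' → ∀ᵐ x ∂G.jumpLaw P r r', ‖x‖ ≤ K := by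
  classical
  have := G.finite_quotient
  have hfin : (⋃ r : AddAction.orbitRel.Quotient Λ V,
      (fun y => ‖G.pos y - G.pos r.out‖) '' {y | G.Adj r.out y}).Finite :=
    Set.finite_iUnion fun r => (G.locally_finite r.out).image _
  obtain ⟨K, hK⟩ := hfin.bddAbove
  refine ⟨K, fun r r' hpos => ?_⟩
  have h0 : G.jumpMeasure P r.out r' Set.univ ≠ 0 := fun h0 => by
    rw [quotientMatrix, measureReal_def, h0] at hpos
    simp at hpos
  have hB : MeasurableSet {x : EuclideanSpace ℝ (Fin d) | ¬ ‖x‖ ≤ K} :=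
    (measurableSet_le measurable_norm measurable_const).compl
  rw [ae_iff, jumpLaw, if_neg h0, Measure.smul_apply, G.jumpMeasure_apply P _ _ hB]
  have : ∀ y, (if latticeClass Λ y = r' then ENNReal.ofReal (P r.out y) else 0) *
      Measure.dirac (G.pos y - G.pos r.out) {x | ¬ ‖x‖ ≤ K} = 0 := by
    intro y
    rcases (hG.isTransitionMatrix.nonneg r.out y).eq_or_lt with h1 | h1
    · simp [← h1]
    · have h2 : ‖G.pos y - G.pos r.out‖ ≤ K :=
        hK (Set.mem_iUnion.2 ⟨r, y, hG.adj_of_pos _ _ h1, rfl⟩)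
      rw [Measure.dirac_apply' _ hB, Set.indicator_of_notMem (by simpa using h2), mul_zero]
  simp only [this, tsum_zero, smul_zero]

variable {Ω : Type*} [MeasurableSpace Ω] {μ : Measure Ω} {Y : ℕ → Ω → V}

theorem IsMarkovChain.measurableSet_preimage {S : Type*} [Countable S] {P : S → S → ℝ}
    {Y : ℕ → Ω → S} (h : IsMarkovChain μ P Y) (n : ℕ) (A : Set S) :
    MeasurableSet {ω | Y n ω ∈ A} := by
  have : {ω | Y n ω ∈ A} = ⋃ s ∈ A, {ω | Y n ω = s} := by ext ω; simp
  rw [this]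
  exact MeasurableSet.biUnion (Set.to_countable A) fun s _ => h.measurable n s

/-- A function of a Markov chain is a hidden Markov walk driven by the chain. -/
theorem IsMarkovChain.isHiddenMarkovWalk {S : Type*} [Countable S] {P : S → S → ℝ}
    {Y : ℕ → Ω → S} (h : IsMarkovChain μ P Y) (f : S → EuclideanSpace ℝ (Fin d)) :
    IsHiddenMarkovWalk μ P (fun x y => Measure.dirac (f y - f x)) Y fun n ω => f (Y n ω) where
  hidden_chain := h
  measurable n B _ := h.measurableSet_preimage n (f ⁻¹' B)
  law_increments n s A hA := by
    -- Along a given path the steps are deterministic: either all conditions hold and the product is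
    -- `1`, or one fails and both sides vanish.
    by_cases hs : ∀ i < n, f (s (i + 1)) - f (s i) ∈ A i
    · rw [Finset.prod_eq_one fun i hi => ?_, mul_one]
      · congr 1
        ext ω
        refine and_iff_left_of_imp fun hω i hi => ?_
        rw [hω (i + 1) hi, hω i hi.le]
        exact hs i hi
      · rw [measureReal_def, Measure.dirac_apply' _ (hA i),
          Set.indicator_of_mem (hs i (Finset.mem_range.1 hi))]
        simp
    · push Not at hs
      obtain ⟨i, hi, hs⟩ := hs
      rw [Finset.prod_eq_zero (Finset.mem_range.2 hi), mul_zero]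
      · convert measureReal_empty (μ := μ)
        refine Set.eq_empty_of_forall_notMem fun ω hω => hs ?_
        rw [← hω.1 (i + 1) hi, ← hω.1 i hi.le]
        exact hω.2 i hi
      · rw [measureReal_def, Measure.dirac_apply' _ (hA i), Set.indicator_of_notMem hs]
        simp

variable [IsProbabilityMeasure μ]

/-- The chain is summed over its present vertex `y` in the class `r n` and over its next vertex. By
invariance the inner sum depends on the class of `y` only and factors out. The Markov property is
that of `Y`, seen as a hidden Markov walk with deterministic steps. -/
theorem PeriodicGraph.IsTransition.measureReal_walkCylinder [Countable V] (hG : G.IsTransition P)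
    (hY : IsMarkovChain μ P Y) (n : ℕ) (r : ℕ → AddAction.orbitRel.Quotient Λ V)
    {A : ℕ → Set (EuclideanSpace ℝ (Fin d))} (hA : ∀ i, MeasurableSet (A i)) :
    μ.real (walkCylinder (fun n ω => latticeClass Λ (Y n ω)) (fun n ω => G.pos (Y n ω)) n r A) =
      μ.real {ω | latticeClass Λ (Y 0 ω) = r 0} *
        ∏ i ∈ Finset.range n, (G.jumpMeasure P (r i).out (r (i + 1))).real (A i) := by
  classical
  set R := fun n ω => latticeClass Λ (Y n ω)
  set X := fun n ω => G.pos (Y n ω)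
  have hW := hY.isHiddenMarkovWalk G.pos
  induction n with
  | zero =>
    rw [Finset.range_zero, Finset.prod_empty, mul_one]
    congr 1
    ext ω
    simp [walkCylinder, R]
  | succ n ih =>
    rw [Finset.prod_range_succ, ← mul_assoc, ← ih]
    set C := walkCylinder R X n r A
    have hR : ∀ i ≤ n, ∀ s, MeasurableSet[walkHistory Y X n] {ω | R i ω = s} := by
      intro i hi s
      have : {ω | R i ω = s} = ⋃ (y : V) (_ : latticeClass Λ y = s), {ω | Y i ω = y} := by
        ext ω; simp [R]
      rw [this]
      exact MeasurableSet.iUnion fun y => MeasurableSet.iUnion fun _ =>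
        measurableSet_walkHistory_chain hi y
    have hC : MeasurableSet[walkHistory Y X n] C := by
      simp only [C, walkCylinder_eq]
      refine MeasurableSet.inter ?_ ?_
      · exact MeasurableSet.biInter (Set.to_countable _) fun i hi => hR i hi _
      · exact MeasurableSet.biInter (Set.to_countable _) fun i hi =>
          measurableSet_walkHistory_increment hi (hA i)
    have hCm : MeasurableSet C := hW.walkHistory_le n _ hC
    have hC' : MeasurableSet (walkCylinder R X (n + 1) r A) := by
      rw [walkCylinder_succ]
      exact (hCm.inter (hY.measurableSet_preimage (n + 1) {y | latticeClass Λ y = r (n + 1)})).inter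
        (((hW.measurable (n + 1)).sub (hW.measurable n)) (hA n))
    have key : μ (walkCylinder R X (n + 1) r A) =
        μ C * G.jumpMeasure P (r n).out (r (n + 1)) (A n) := by
      rw [← hY.tsum_measure_inter n hC', ← hY.tsum_measure_inter n hCm, ← ENNReal.tsum_mul_right]
      refine tsum_congr fun y => ?_
      by_cases hy : latticeClass Λ y = r n
      · rw [← hG.jumpMeasure_eq hy, G.jumpMeasure_apply P _ _ (hA n), ← ENNReal.tsum_mul_left,
          ← hY.tsum_measure_inter (n + 1) (hC'.inter (hY.measurable n y))]
        refine tsum_congr fun y' => ?_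
        rw [walkCylinder_succ]
        split_ifs with hy'
        · rw [← hW.measure_inter_step hG.isTransitionMatrix.nonneg hC y y' (hA n)]
          congr 1
          ext ω
          simp only [Set.mem_inter_iff, Set.mem_ofPred_eq, R, X]
          constructor
          · tauto
          · rintro ⟨⟨h1, h2⟩, h3, h4⟩
            exact ⟨⟨⟨⟨h1, by rw [h3, hy']⟩, h4⟩, h2⟩, h3⟩
        · rw [zero_mul, mul_zero]
          convert measure_empty (μ := μ)
          refine Set.eq_empty_of_forall_notMem fun ω hω => hy' ?_
          rw [← show Y (n + 1) ω = y' from hω.2]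
          exact hω.1.1.1.2
      · have h1 : C ∩ {ω | Y n ω = y} = ∅ := Set.eq_empty_of_forall_notMem fun ω hω => hy (by
          rw [← show Y n ω = y from hω.2]
          exact hω.1.1 n le_rfl)
        have h2 : walkCylinder R X (n + 1) r A ∩ {ω | Y n ω = y} ⊆ C ∩ {ω | Y n ω = y} := by
          rw [walkCylinder_succ]
          exact fun ω hω => ⟨hω.1.1.1, hω.2⟩
        rw [h1] at h2
        rw [h1, Set.subset_empty_iff.1 h2]
        simp
    rw [measureReal_def, key, ENNReal.toReal_mul]
    rfl

/-- The position of a Markov chain on a periodic graph is a hidden Markov walk driven by the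
classes modulo the lattice. -/
theorem PeriodicGraph.IsTransition.isHiddenMarkovWalk [Countable V] (hG : G.IsTransition P)
    (hY : IsMarkovChain μ P Y) :
    IsHiddenMarkovWalk μ (G.quotientMatrix P) (G.jumpLaw P)
      (fun n ω => latticeClass Λ (Y n ω)) fun n ω => G.pos (Y n ω) := by
  have hlaw : ∀ (n : ℕ) (r : ℕ → AddAction.orbitRel.Quotient Λ V),
      μ.real {ω | ∀ i ≤ n, latticeClass Λ (Y i ω) = r i} =
        μ.real {ω | latticeClass Λ (Y 0 ω) = r 0} *
          ∏ i ∈ Finset.range n, G.quotientMatrix P (r i) (r (i + 1)) := by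
    intro n r
    have := hG.measureReal_walkCylinder hY n r (A := fun _ => Set.univ) fun _ => MeasurableSet.univ
    simpa [walkCylinder, quotientMatrix] using this
  refine ⟨⟨fun n s => hY.measurableSet_preimage n {y | latticeClass Λ y = s}, hlaw⟩,
    (hY.isHiddenMarkovWalk G.pos).measurable, fun n r A hA => ?_⟩
  rw [hlaw n r, mul_assoc, ← Finset.prod_mul_distrib]
  simp only [hG.quotientMatrix_mul_jumpLaw]
  exact hG.measureReal_walkCylinder hY n r hA

end PeriodicGraphs

theorem theorem5p6 (d : ℕ) {Ω : Type*} [MeasurableSpace Ω] (μ : Measure Ω)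
    [IsProbabilityMeasure μ] :
    -- irreducible Markov chains on periodic graphs
    (∀ (Λ : Submodule ℤ (EuclideanSpace ℝ (Fin d))) [DiscreteTopology Λ] [IsZLattice ℝ Λ]
        {V : Type*} [AddAction Λ V] (G : PeriodicGraph Λ V) (P : V → V → ℝ) (Y : ℕ → Ω → V),
      G.IsTransition P → IsIrreducibleMod Λ P → IsMarkovChain μ P Y →
      ∀ (e : AddAction.orbitRel.Quotient Λ V) (X : ℕ → Ω → EuclideanSpace ℝ (Fin d))
        (τ : ℕ → Ω → ℕ),
        X = (fun n ω => G.pos (Y n ω)) →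
        τ = visitTime (fun n ω => latticeClass Λ (Y n ω)) e →
        RoughInvarianceConditions μ X τ ∧ HasGeometricTails μ τ ∧
          ∀ p : ℝ, 1 ≤ p → HasBlockMoments μ τ (2 * p)) ∧
    -- irreducible hidden Markov walks with bounded jumps, driven by a finite chain
    (∀ {S : Type*} [Finite S] (P : S → S → ℝ)
        (ν : S → S → Measure (EuclideanSpace ℝ (Fin d))) [∀ r r', IsProbabilityMeasure (ν r r')]
        (R : ℕ → Ω → S) (X : ℕ → Ω → EuclideanSpace ℝ (Fin d)) (K : ℝ),
      IsTransitionMatrix P → IsIrreducibleChain P → IsHiddenMarkovWalk μ P ν R X →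
      (∀ r r', 0 < P r r' → ∀ᵐ x ∂ν r r', ‖x‖ ≤ K) →
      ∀ (e : S) (τ : ℕ → Ω → ℕ),
        τ = visitTime R e →
        RoughInvarianceConditions μ X τ ∧ HasGeometricTails μ τ ∧
          ∀ p : ℝ, 1 ≤ p → HasBlockMoments μ τ (2 * p)) := by
  refine ⟨?_, ?_⟩
  · rintro Λ _ _ V _ G P Y hG hirr hY e X τ rfl rfl
    have := G.countable
    have := G.finite_quotient
    have := hG.isProbabilityMeasure_jumpLaw
    have hP := hG.isTransitionMatrix_quotientMatrix
    have hirr' := hG.isIrreducibleChain_quotientMatrix hirr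
    have hW := hG.isHiddenMarkovWalk hY
    obtain ⟨K, hK⟩ := hG.exists_jumpLaw_bound
    have htail := hW.hasGeometricTails hP hirr' e
    have hcond := hW.roughInvarianceConditions hP hirr' hK e
    exact ⟨hcond, htail, fun p _ => htail.hasBlockMoments hcond.regeneration.measurable _⟩
  · rintro S _ P ν _ R X K hP hirr hW hK e τ rfl
    have htail := hW.hasGeometricTails hP hirr e
    have hcond := hW.roughInvarianceConditions hP hirr hK e
    exact ⟨hcond, htail, fun p _ => htail.hasBlockMoments hcond.regeneration.measurable _⟩
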